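/- **Proposition 3.3.** Let $n \ge 3$ and let $(\bar M,\bar g)$ be the doubled Schwarzschild manifold, i.e. $\bar M = \mathbb{R}^n \setminus \{0\}$ with the Riemannian metric $\bar g_{ij} = (1+|x|^{2-n})^{\frac{4}{n-2}}\,\delta_{ij}$. Then for every $V > 0$ and every compact set $K \subset \bar M$ there is a smooth region $D \subset \bar M \setminus K$ (that is, a compact connected subset of $\bar M$ with smooth boundary) such that $$\mathrm{vol}_{\bar g}(D) = V \qquad\text{and}\qquad \mathscr{H}^{n-1}_{\bar g}(\partial D) < (n^{n-1}\,\omega_{n-1})^{\frac1n}\, V^{\frac{n-1}{n}}.$$ Here $\mathrm{vol}_{\bar g}$ is the Riemannian volume, $\mathscr{H}^{n-1}_{\bar g}$ is the $(n-1)$-dimensional Hausdorff measure of the Riemannian distance of $\bar g$ (normalized so that it is the Riemannian area on smooth hypersurfaces), and $\omega_{n-1}$ is the area of the unit sphere $S^{n-1} \subset \mathbb{R}^n$. -/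

import Mathlib

open MeasureTheory Manifold Bundle
open scoped ContDiff ENNReal

noncomputable section

/-- The underlying space `ℝⁿ \ {0}` of the doubled Schwarzschild manifold. It is a definition and not
an abbreviation, so that it does not inherit the Euclidean distance. -/
def DoubledSchwarzschild (n : ℕ) : Type :=
  ((⟨{0}ᶜ, isOpen_compl_singleton⟩ : TopologicalSpace.Opens (EuclideanSpace ℝ (Fin n))) : Type)

namespace DoubledSchwarzschild

variable {n : ℕ}

/-- The inclusion of `ℝⁿ \ {0}` into `ℝⁿ`, which is a global chart. -/
def coord (x : DoubledSchwarzschild n) : EuclideanSpace ℝ (Fin n) := Subtype.val x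

lemma coord_ne_zero (x : DoubledSchwarzschild n) : coord x ≠ 0 := Subtype.property x

instance : TopologicalSpace (DoubledSchwarzschild n) :=
  inferInstanceAs (TopologicalSpace
    (⟨{0}ᶜ, isOpen_compl_singleton⟩ : TopologicalSpace.Opens (EuclideanSpace ℝ (Fin n))))

instance : T3Space (DoubledSchwarzschild n) :=
  inferInstanceAs (T3Space
    (⟨{0}ᶜ, isOpen_compl_singleton⟩ : TopologicalSpace.Opens (EuclideanSpace ℝ (Fin n))))

instance : ChartedSpace (EuclideanSpace ℝ (Fin n)) (DoubledSchwarzschild n) :=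
  inferInstanceAs (ChartedSpace (EuclideanSpace ℝ (Fin n))
    (⟨{0}ᶜ, isOpen_compl_singleton⟩ : TopologicalSpace.Opens (EuclideanSpace ℝ (Fin n))))

instance : IsManifold (𝓡 n) ∞ (DoubledSchwarzschild n) :=
  inferInstanceAs (IsManifold (𝓡 n) ∞
    (⟨{0}ᶜ, isOpen_compl_singleton⟩ : TopologicalSpace.Opens (EuclideanSpace ℝ (Fin n))))

instance : MeasurableSpace (DoubledSchwarzschild n) := borel _

lemma chartAt_eq (x y : DoubledSchwarzschild n) :
    chartAt (EuclideanSpace ℝ (Fin n)) x = chartAt (EuclideanSpace ℝ (Fin n)) y := rfl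

lemma contMDiff_coord : ContMDiff (𝓡 n) (𝓡 n) ∞ (coord (n := n)) :=
  contMDiff_subtype_val (I := 𝓡 n) (n := ∞)
    (U := (⟨{0}ᶜ, isOpen_compl_singleton⟩ : TopologicalSpace.Opens (EuclideanSpace ℝ (Fin n))))

/-- The conformal factor `(1 + |x|^(2-n))^(4/(n-2))`. -/
def conformalFactor (x : DoubledSchwarzschild n) : ℝ :=
  (1 + ‖coord x‖ ^ (2 - (n : ℝ))) ^ (4 / ((n : ℝ) - 2))

lemma conformalFactor_pos (x : DoubledSchwarzschild n) : 0 < conformalFactor x := by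
  unfold conformalFactor; positivity

lemma contMDiff_conformalFactor : ContMDiff (𝓡 n) 𝓘(ℝ, ℝ) ∞ (conformalFactor (n := n)) := by
  intro x
  have h : ContDiffAt ℝ ∞ (fun y : EuclideanSpace ℝ (Fin n) =>
      (1 + ‖y‖ ^ (2 - (n : ℝ))) ^ (4 / ((n : ℝ) - 2))) (coord x) := by
    have hx : coord x ≠ 0 := coord_ne_zero x
    have h1 : ContDiffAt ℝ ∞ (fun y : EuclideanSpace ℝ (Fin n) => ‖y‖) (coord x) :=
      contDiffAt_norm ℝ hx
    refine ContDiffAt.rpow_const_of_ne (contDiffAt_const.add (h1.rpow_const_of_ne (by simpa using hx))) ?_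
    positivity
  exact h.contMDiffAt.comp x (contMDiff_coord x)

/-- The metric tensor `g_x = (1 + |x|^(2-n))^(4/(n-2)) δ` on the tangent space at `x`. -/
def metricForm (x : DoubledSchwarzschild n) :
    TangentSpace (𝓡 n) x →L[ℝ] TangentSpace (𝓡 n) x →L[ℝ] ℝ :=
  letI g : EuclideanSpace ℝ (Fin n) →L[ℝ] EuclideanSpace ℝ (Fin n) →L[ℝ] ℝ :=
    conformalFactor x • innerSL ℝ
  g

lemma metricForm_apply (x : DoubledSchwarzschild n) (v w : EuclideanSpace ℝ (Fin n)) :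
    metricForm x v w = conformalFactor x * inner ℝ v w := rfl

lemma tangent_symm (x y : DoubledSchwarzschild n) (v : EuclideanSpace ℝ (Fin n)) :
    (trivializationAt (EuclideanSpace ℝ (Fin n))
      (fun b : DoubledSchwarzschild n => TangentSpace (𝓡 n) b) x).symm y v = v :=
  ((Bundle.Trivialization.symmL_apply (R := ℝ) (trivializationAt (EuclideanSpace ℝ (Fin n))
      (fun b : DoubledSchwarzschild n => TangentSpace (𝓡 n) b) x) (mem_chart_source _ y) v).symm.trans
  (congrArg (fun L : EuclideanSpace ℝ (Fin n) →L[ℝ] TangentSpace (𝓡 n) y => L v)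
    (TangentBundle.symmL_trivializationAt_eq_core (I := 𝓡 n) (b₀ := x) (b := y)
      (mem_chart_source _ y)))).trans
    (tangentCoordChange_self (I := 𝓡 n) (x := x) (z := y) (v := v) (mem_extChartAt_source y))

variable (n) in
/-- The Euclidean inner product `δ` as a bilinear form. -/
def euclideanForm : EuclideanSpace ℝ (Fin n) →L[ℝ] EuclideanSpace ℝ (Fin n) →L[ℝ] ℝ := innerSL ℝ

lemma metricForm_trivialization (x y : DoubledSchwarzschild n) :
    (trivializationAt (EuclideanSpace ℝ (Fin n) →L[ℝ] EuclideanSpace ℝ (Fin n) →L[ℝ] ℝ)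
      (fun b : DoubledSchwarzschild n =>
        TangentSpace (𝓡 n) b →L[ℝ] TangentSpace (𝓡 n) b →L[ℝ] ℝ) x ⟨y, metricForm y⟩).2 =
    conformalFactor y • euclideanForm n := by
  have key : ∀ v w : EuclideanSpace ℝ (Fin n), ContinuousLinearMap.inCoordinates
      (EuclideanSpace ℝ (Fin n)) (fun b : DoubledSchwarzschild n => TangentSpace (𝓡 n) b)
      (EuclideanSpace ℝ (Fin n) →L[ℝ] ℝ)
      (fun b : DoubledSchwarzschild n => TangentSpace (𝓡 n) b →L[ℝ] ℝ) x y x y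
      (metricForm y) v w = conformalFactor y * inner ℝ v w := by
    intro v w
    refine (inCoordinates_apply_eq₂ (F₃ := ℝ) (E₃ := Bundle.Trivial (DoubledSchwarzschild n) ℝ)
      (x₀ := x) (x := y) (ϕ := metricForm y) (v := v) (w := w)
      (mem_chart_source _ y) (mem_chart_source _ y) (Set.mem_univ _)).trans ?_
    rw [tangent_symm x y v, tangent_symm x y w]
    simpa using metricForm_apply y v w
  exact ContinuousLinearMap.ext fun v => ContinuousLinearMap.ext fun w => key v w

variable (n) in
/-- The metric of the doubled Schwarzschild manifold, as a smooth Riemannian metric. -/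
def metric : ContMDiffRiemannianMetric (𝓡 n) ∞ (EuclideanSpace ℝ (Fin n))
    (fun x : DoubledSchwarzschild n => TangentSpace (𝓡 n) x) where
  inner := metricForm
  symm x v w := (metricForm_apply x v w).trans
    ((congrArg (conformalFactor x * ·) (real_inner_comm (F := EuclideanSpace ℝ (Fin n)) w v)).trans (metricForm_apply x w v).symm)
  pos x v hv := (mul_pos (conformalFactor_pos x)
    (real_inner_self_pos (F := EuclideanSpace ℝ (Fin n)).2 hv)).trans_eq (metricForm_apply x v v).symm
  isVonNBounded x := by
    change Bornology.IsVonNBounded ℝ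
      {v : EuclideanSpace ℝ (Fin n) | conformalFactor x * inner ℝ v v < 1}
    refine (NormedSpace.isVonNBounded_ball ℝ (EuclideanSpace ℝ (Fin n))
      (√(1 / conformalFactor x))).subset ?_
    intro v hv
    have := conformalFactor_pos x
    simp only [Set.mem_ofPred_eq, real_inner_self_eq_norm_sq] at hv
    rw [mem_ball_zero_iff]
    apply Real.lt_sqrt_of_sq_lt
    rw [lt_div_iff₀ this]; linarith
  contMDiff := by
    intro x
    rw [contMDiffAt_section]
    have h : ContMDiffAt (𝓡 n) 𝓘(ℝ, EuclideanSpace ℝ (Fin n) →L[ℝ] EuclideanSpace ℝ (Fin n) →L[ℝ] ℝ)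
        ∞ (fun y : DoubledSchwarzschild n => conformalFactor y • euclideanForm n) x :=
      (contMDiff_conformalFactor x).smul contMDiffAt_const
    exact h.congr_of_eventuallyEq
      (Filter.Eventually.of_forall fun y => metricForm_trivialization x y)

instance : RiemannianBundle (fun x : DoubledSchwarzschild n => TangentSpace (𝓡 n) x) :=
  ⟨(metric n).toRiemannianMetric⟩

instance : IsContMDiffRiemannianBundle (𝓡 n) ∞ (EuclideanSpace ℝ (Fin n))
    (fun x : DoubledSchwarzschild n => TangentSpace (𝓡 n) x) := inferInstance
instance : IsContinuousRiemannianBundle (EuclideanSpace ℝ (Fin n))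
    (fun x : DoubledSchwarzschild n => TangentSpace (𝓡 n) x) :=
  ⟨⟨metricForm, (metric n).contMDiff.continuous, fun _ _ _ => rfl⟩⟩

/-- The Riemannian distance of the doubled Schwarzschild metric: the infimum of the lengths of `C¹`
paths. It induces the given topology. -/
instance : EMetricSpace (DoubledSchwarzschild n) :=
  EMetricSpace.ofRiemannianMetric (𝓡 n) (DoubledSchwarzschild n)

instance : BorelSpace (DoubledSchwarzschild n) := ⟨rfl⟩
instance : IsRiemannianManifold (𝓡 n) (DoubledSchwarzschild n) := inferInstance

/-- The matrix `g_ij(x) = g_x(∂_i, ∂_j)` of the metric in the coordinates of `ℝⁿ`. -/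
def metricMatrix (x : DoubledSchwarzschild n) : Matrix (Fin n) (Fin n) ℝ :=
  Matrix.of fun i j => metricForm x
    (EuclideanSpace.single i 1 : EuclideanSpace ℝ (Fin n))
    (EuclideanSpace.single j 1 : EuclideanSpace ℝ (Fin n))

variable (n) in
/-- The Riemannian volume measure `√(det g_ij) dx`. -/
def vol : Measure (DoubledSchwarzschild n) :=
  (Measure.comap coord (volume : Measure (EuclideanSpace ℝ (Fin n)))).withDensity
    fun x => ENNReal.ofReal √(metricMatrix x).det

/-- The `(n-1)`-dimensional Hausdorff measure of the Riemannian distance, with the normalization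
under which it is the Riemannian area on smooth hypersurfaces. -/
def area (S : Set (DoubledSchwarzschild n)) : ℝ≥0∞ := μHE[n - 1] S

/-- A set has smooth boundary if near each boundary point `p` it is a sublevel set `{ρ ≤ 0}` of a
smooth function `ρ` with `dρ ≠ 0` at `p`. -/
def HasSmoothBoundary (D : Set (DoubledSchwarzschild n)) : Prop :=
  ∀ p ∈ frontier D, ∃ U : Set (DoubledSchwarzschild n), IsOpen U ∧ p ∈ U ∧
    ∃ ρ : DoubledSchwarzschild n → ℝ, ContMDiffOn (𝓡 n) 𝓘(ℝ, ℝ) ∞ ρ U ∧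
      mfderiv (𝓡 n) 𝓘(ℝ, ℝ) ρ p ≠ 0 ∧ D ∩ U = {x ∈ U | ρ x ≤ 0}

/-- A (bounded, closed) smooth region: a compact connected set with smooth boundary. -/
structure IsSmoothRegion (D : Set (DoubledSchwarzschild n)) : Prop where
  isCompact : IsCompact D
  isConnected : IsConnected D
  hasSmoothBoundary : HasSmoothBoundary D

end DoubledSchwarzschild

/-- `ω_{n-1}`: the total surface measure of the Euclidean unit sphere `S^{n-1} ⊂ ℝⁿ`. -/
def unitSphereArea (n : ℕ) : ℝ :=
  (volume : Measure (EuclideanSpace ℝ (Fin n))).toSphere.real Set.univ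

end

/-!
Far from the origin the metric is nearly flat, so the isoperimetric ratio of a round ball is nearly
Euclidean there, and the competition is decided by a higher order term. The region `D` is an
ellipsoid of revolution centered at `R e`, `e` a unit vector, with semi-axes `r` and, in the
direction `e`, `(1 + τ) r`, for suitable `τ < 0` and large `R`.

Let `φ = 1 + |x|^(2-n)`, `m = R^(2-n)`, `μ = m / (1 + m)`, `δ = r / R` and let `T` be the stretching
by `1 + τ` in the direction `e`. Then `φ (R e + r T y) = (1 + m) (1 + X(y))` with
`X = μ (|e + δ T y|^(2-n) - 1)`. The volume is the integral of `φ^b`, `b = 2n / (n-2)`, over the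
ellipsoid, and the area that of `φ^a`, `a = 2(n-1) / (n-2)`, over its boundary. As
`a = b (n-1) / n`, the factors `r` and `1 + m` cancel from the isoperimetric ratio, and the claim
becomes `A < W ^ ((n-1)/n)`, where `A` is the average over the unit sphere of `(1 + X)^a` times the
area density of the ellipsoid, and `W` is `1 + τ` times the average of `(1 + X)^b` over the unit ball.

For `τ = 0` the first order term `μ (|e + δ y|^(2-n) - 1)` of `X` is harmonic and vanishes at `0`, so
its averages over spheres and balls vanish, and the contributions of its square of order `μ² δ²`
cancel. With `z = μ δ²` and `τ = O(z)` one is left with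
`A - W ^ ((n-1)/n) = (n-1) / (n (n+2)) * (α τ² + β z τ + κ z²) + O((μ + δ) z²)`, where `α = (n+1)/n`,
`β = 2(n-1)` and `κ = n² (n-1) / (n+4)`. Here `κ > 0`, so round balls lose, but the minimum over `τ`,
at `τ = -n (n-1) / (n+1) * z`, is a negative multiple of `z²` (`areaPoly_eq`,
`exists_isoperimetric_gain`). So for fixed `V` and large `R` the ellipsoid of volume `V`, which exists
by the intermediate value theorem (`exists_radius_of_volume`), has the required area.

The error terms are uniform over the ball (`rpow_expansion`, `area_expansion`). The averages use the
moments of the sphere and the mean value property of `|x|^(2-n)`, which follow from the invariance of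
the surface measure under reflections (`integral_sphere_zonal_divergence`). Only an upper bound for
the Hausdorff measure of the boundary is needed: `hausdorff_range_le_lintegral` proves it by
comparing the sphere locally with its tangent hyperplanes, whose Hausdorff measure is related to the
volume of cones and thereby to the surface measure.
-/

open MeasureTheory Manifold Bundle
open scoped ContDiff ENNReal

noncomputable section

/-! ### Cones and Hausdorff measure -/

section ConeArea

open Module Measure Filter Topology
open scoped Pointwise NNReal RealInnerProductSpace

variable {V : Type*} [NormedAddCommGroup V] [InnerProductSpace ℝ V]

lemma mem_cone_iff_of_inner_eq_one {A : Set V} {ν : V} (hA : ∀ x ∈ A, ⟪ν, x⟫ = 1) (x : V) :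
    x ∈ Set.Ioo (0 : ℝ) 1 • A ↔ ⟪ν, x⟫ ∈ Set.Ioo (0 : ℝ) 1 ∧ (⟪ν, x⟫)⁻¹ • x ∈ A := by
  constructor
  · rintro ⟨t, ht, y, hy, rfl⟩
    have : ⟪ν, t • y⟫ = t := by rw [inner_smul_right, hA y hy, mul_one]
    simp only [this]
    exact ⟨ht, by rwa [inv_smul_smul₀ ht.1.ne']⟩
  · rintro ⟨ht, hy⟩
    exact ⟨_, ht, _, hy, smul_inv_smul₀ ht.1.ne' x⟩

variable [MeasurableSpace V] [BorelSpace V] [FiniteDimensional ℝ V]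

/-- The volume of the cone with apex `0` over a subset of the affine hyperplane `⟪ν, x⟫ = 1`, which
lies at distance `‖ν‖⁻¹` from the apex. -/
lemma volume_cone_eq {A : Set V} {ν : V} (hν : ν ≠ 0) (hA : ∀ x ∈ A, ⟪ν, x⟫ = 1)
    (hAm : MeasurableSet A) :
    volume (Set.Ioo (0 : ℝ) 1 • A) =
      ENNReal.ofReal (1 / (finrank ℝ V * ‖ν‖)) * μHE[finrank ℝ V - 1] A := by
  have hN : 0 < finrank ℝ V := by
    have : Nontrivial V := ⟨ν, 0, hν⟩
    exact finrank_pos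
  have hn : 0 < ‖ν‖ := norm_pos_iff.2 hν
  have hmeas : MeasurableSet (Set.Ioo (0 : ℝ) 1 • A) := by
    have : Set.Ioo (0 : ℝ) 1 • A =
        {x | ⟪ν, x⟫ ∈ Set.Ioo (0 : ℝ) 1} ∩ (fun x => (⟪ν, x⟫)⁻¹ • x) ⁻¹' A := by
      ext x; exact mem_cone_iff_of_inner_eq_one hA x
    rw [this]
    have h1 : Measurable fun x : V => ⟪ν, x⟫ := (by fun_prop : Continuous fun x : V => ⟪ν, x⟫).measurable
    exact (h1 measurableSet_Ioo).inter ((h1.inv.smul measurable_id) hAm)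
  rw [← InnerProductSpace.euclideanHausdorffMeasure_eq_volume,
    EuclideanGeometry.euclideanHausdorffMeasure_eq_lintegral (0 : V) hν hmeas]
  set I : Set ℝ := Set.Ioo 0 (‖ν‖ ^ 2)⁻¹
  have hslice : ∀ x : ℝ, μHE[finrank ℝ V - 1]
      (Set.Ioo (0 : ℝ) 1 • A ∩ AffineSubspace.mk' (x • ν +ᵥ (0 : V)) (ℝ ∙ ν)ᗮ) =
      I.indicator (fun x => ENNReal.ofReal ((x * ‖ν‖ ^ 2) ^ (finrank ℝ V - 1)) *
        μHE[finrank ℝ V - 1] A) x := by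
    intro x
    have hmem : ∀ y : V, y ∈ (AffineSubspace.mk' (x • ν +ᵥ (0 : V)) (ℝ ∙ ν)ᗮ : Set V) ↔
        ⟪ν, y⟫ = x * ‖ν‖ ^ 2 := by
      intro y
      rw [SetLike.mem_coe, AffineSubspace.mem_mk', Submodule.mem_orthogonal_singleton_iff_inner_right]
      simp [inner_sub_right, inner_smul_right, sub_eq_zero]
    by_cases hx : x ∈ I
    · have ht : 0 < x * ‖ν‖ ^ 2 := mul_pos hx.1 (by positivity)
      have ht1 : x * ‖ν‖ ^ 2 < 1 := by
        have := hx.2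
        rwa [lt_inv_comm₀ hx.1 (by positivity), ← one_div, lt_div_iff₀ hx.1, mul_comm] at this
      have hset : Set.Ioo (0 : ℝ) 1 • A ∩ AffineSubspace.mk' (x • ν +ᵥ (0 : V)) (ℝ ∙ ν)ᗮ =
          (x * ‖ν‖ ^ 2) • A := by
        ext y
        rw [Set.mem_inter_iff, hmem, mem_cone_iff_of_inner_eq_one hA,
          Set.mem_smul_set_iff_inv_smul_mem₀ ht.ne']
        constructor
        · rintro ⟨⟨-, h⟩, h'⟩; rwa [h'] at h
        · intro h
          have h1 := hA _ h
          rw [inner_smul_right, inv_mul_eq_one₀ ht.ne'] at h1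
          rw [← h1]; exact ⟨⟨⟨ht, ht1⟩, h⟩, rfl⟩
      rw [hset, Set.indicator_of_mem hx, euclideanHausdorffMeasure_smul₀ _ ht.ne',
        ENNReal.smul_def, smul_eq_mul, ENNReal.coe_pow, ENNReal.ofReal_pow ht.le]
      congr 2
      rw [← enorm_eq_nnnorm, Real.enorm_of_nonneg ht.le]
    · have hset : Set.Ioo (0 : ℝ) 1 • A ∩ AffineSubspace.mk' (x • ν +ᵥ (0 : V)) (ℝ ∙ ν)ᗮ = ∅ := by
        ext y
        rw [Set.mem_inter_iff, hmem, mem_cone_iff_of_inner_eq_one hA]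
        simp only [Set.mem_empty_iff_false, iff_false]
        rintro ⟨⟨h, -⟩, h'⟩
        rw [h'] at h
        refine hx ⟨pos_of_mul_pos_left h.1 (by positivity), ?_⟩
        rw [← one_div, lt_div_iff₀ (by positivity)]; exact h.2
      rw [hset, Set.indicator_of_notMem hx, measure_empty]
  simp_rw [hslice]
  rw [lintegral_indicator measurableSet_Ioo, lintegral_mul_const _ (by fun_prop), ← mul_assoc]
  congr 1
  rw [← ofReal_integral_eq_lintegral_ofReal, ← integral_Ioc_eq_integral_Ioo,
    ← intervalIntegral.integral_of_le (by positivity)]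
  · rw [← ofReal_norm, ← ENNReal.ofReal_mul hn.le]
    congr 1
    simp_rw [mul_pow]
    rw [intervalIntegral.integral_mul_const, integral_pow]
    have hc : ((finrank ℝ V - 1 : ℕ) : ℝ) + 1 = finrank ℝ V := by
      rw [Nat.cast_sub hN]; simp
    rw [hc, Nat.sub_add_cancel hN, zero_pow hN.ne']
    have : ((‖ν‖ ^ 2)⁻¹) ^ finrank ℝ V = ((‖ν‖ ^ 2)⁻¹) ^ (finrank ℝ V - 1) * (‖ν‖ ^ 2)⁻¹ := by
      rw [← pow_succ, Nat.sub_add_cancel hN]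
    have hK : (‖ν‖ ^ 2) ^ (finrank ℝ V - 1) ≠ 0 := by positivity
    rw [this, inv_pow]
    generalize (‖ν‖ ^ 2) ^ (finrank ℝ V - 1) = K at hK
    field_simp
    ring
  · exact ((by fun_prop : Continuous fun x : ℝ => (x * ‖ν‖ ^ 2) ^ (finrank ℝ V - 1)).integrableOn_Icc
      (a := 0) (b := (‖ν‖ ^ 2)⁻¹)).mono_set Set.Ioo_subset_Icc_self
  · filter_upwards [ae_restrict_mem measurableSet_Ioo] with x hx
    exact pow_nonneg (mul_nonneg hx.1.le (by positivity)) _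

/-- A Lipschitz comparison of two maps on a common index set bounds the Hausdorff measure of one
image by that of the other. -/
lemma euclideanHausdorffMeasure_image_le_of_edist_le {ι X Y : Type*} [EMetricSpace X]
    [MeasurableSpace X] [BorelSpace X] [EMetricSpace Y] [MeasurableSpace Y] [BorelSpace Y]
    {f : ι → Y} {g : ι → X} {P : Set ι} {K : ℝ≥0} (d : ℕ)
    (h : ∀ i ∈ P, ∀ j ∈ P, edist (g i) (g j) ≤ K * edist (f i) (f j)) :
    μHE[d] (g '' P) ≤ (K : ℝ≥0∞) ^ d * μHE[d] (f '' P) := by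
  rcases P.eq_empty_or_nonempty with rfl | ⟨i₀, hi₀⟩
  · simp
  have : Nonempty ι := ⟨i₀⟩
  set G : Y → X := g ∘ Function.invFunOn f P
  have hmem : ∀ i ∈ P, Function.invFunOn f P (f i) ∈ P ∧ f (Function.invFunOn f P (f i)) = f i :=
    fun i hi => ⟨Function.invFunOn_mem ⟨i, hi, rfl⟩, Function.invFunOn_eq ⟨i, hi, rfl⟩⟩
  have hG : ∀ i ∈ P, G (f i) = g i := by
    intro i hi
    have := h _ (hmem i hi).1 i hi
    rw [(hmem i hi).2, edist_self, mul_zero, nonpos_iff_eq_zero, edist_eq_zero] at this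
    exact this
  have hLip : LipschitzOnWith K G (f '' P) := by
    rintro _ ⟨i, hi, rfl⟩ _ ⟨j, hj, rfl⟩
    rw [hG i hi, hG j hj]; exact h i hi j hj
  have himg : g '' P = G '' (f '' P) := by
    rw [Set.image_image]; exact Set.image_congr fun i hi => (hG i hi).symm
  have hle := hLip.hausdorffMeasure_image_le (d := (d : ℝ)) (by positivity)
  rw [himg, euclideanHausdorffMeasure_def, euclideanHausdorffMeasure_def, Measure.smul_apply,
    Measure.smul_apply, ENNReal.smul_def, ENNReal.smul_def, smul_eq_mul, smul_eq_mul, mul_left_comm]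
  rw [ENNReal.rpow_natCast] at hle
  gcongr

/-- A local bound for the measure of images by a density globalizes to an integral bound. -/
lemma measure_range_le_lintegral_of_local {S X : Type*} [TopologicalSpace S] [CompactSpace S]
    [MeasurableSpace S] [BorelSpace S] [MeasurableSpace X] (σ : Measure S) [IsFiniteMeasure σ]
    (m : Measure X) (F : S → X) (h : S → ℝ) (hc : Continuous h) (h0 : ∀ s, 0 ≤ h s)
    (hloc : ∀ s, ∀ C > h s, ∃ U ∈ 𝓝 s, ∀ P ⊆ U, MeasurableSet P →
      m (F '' P) ≤ ENNReal.ofReal C * σ P) :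
    m (Set.range F) ≤ ∫⁻ s, ENNReal.ofReal (h s) ∂σ := by
  have key : ∀ ε : ℝ, 0 < ε →
      m (Set.range F) ≤ ∫⁻ s, ENNReal.ofReal (h s) ∂σ + ENNReal.ofReal (2 * ε) * σ Set.univ := by
    intro ε hε
    have hind : ∃ U : Set S, IsOpen U ∧ Set.univ ⊆ U ∧ ∀ P ⊆ U, MeasurableSet P →
        m (F '' P) ≤ ∫⁻ s in P, ENNReal.ofReal (h s + 2 * ε) ∂σ := by
      refine isCompact_univ.induction_on
        (p := fun A => ∃ U : Set S, IsOpen U ∧ A ⊆ U ∧ ∀ P ⊆ U, MeasurableSet P →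
          m (F '' P) ≤ ∫⁻ s in P, ENNReal.ofReal (h s + 2 * ε) ∂σ) ?_ ?_ ?_ ?_
      · exact ⟨∅, isOpen_empty, subset_rfl, fun P hP _ => by simp [Set.subset_empty_iff.1 hP]⟩
      · rintro A B hAB ⟨U, hU, hBU, h⟩
        exact ⟨U, hU, hAB.trans hBU, h⟩
      · rintro A B ⟨U, hU, hAU, h1⟩ ⟨W, hW, hBW, h2⟩
        refine ⟨U ∪ W, hU.union hW, Set.union_subset_union hAU hBW, fun P hP hPm => ?_⟩
        have hd : Disjoint (P ∩ U) (P \ U) := Set.disjoint_sdiff_right.mono_left Set.inter_subset_right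
        have hPU := h1 (P ∩ U) Set.inter_subset_right (hPm.inter hU.measurableSet)
        have hPW := h2 (P \ U) (fun x hx => (hP hx.1).resolve_left hx.2) (hPm.diff hU.measurableSet)
        conv_lhs => rw [← Set.inter_union_sdiff P U, Set.image_union]
        conv_rhs => rw [← Set.inter_union_sdiff P U]
        rw [lintegral_union (hPm.diff hU.measurableSet) hd]
        exact (measure_union_le _ _).trans (add_le_add hPU hPW)
      · intro s _
        obtain ⟨U, hU, hUP⟩ := hloc s (h s + ε) (by linarith)
        have hnear : ∀ᶠ t in 𝓝 s, h s - ε < h t :=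
          hc.continuousAt.eventually_const_lt (by linarith)
        obtain ⟨W, hW, hWo, hsW⟩ := mem_nhds_iff.1 (Filter.inter_mem hU hnear)
        refine ⟨W, mem_nhdsWithin_of_mem_nhds (hWo.mem_nhds hsW), W, hWo, subset_rfl,
          fun P hP hPm => (hUP P (fun x hx => (hW (hP hx)).1) hPm).trans ?_⟩
        rw [← setLIntegral_const]
        refine setLIntegral_mono' hPm fun t ht => ENNReal.ofReal_le_ofReal ?_
        have : h s - ε < h t := (hW (hP ht)).2
        linarith
    obtain ⟨U, -, hU, hP⟩ := hind
    have h1 := hP Set.univ hU MeasurableSet.univ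
    rw [Set.image_univ, Measure.restrict_univ] at h1
    refine h1.trans_eq ?_
    simp_rw [fun s => ENNReal.ofReal_add (h0 s) (by positivity : 0 ≤ 2 * ε)]
    rw [lintegral_add_right _ measurable_const, lintegral_const]
  have hlim : Tendsto (fun ε : ℝ => ∫⁻ s, ENNReal.ofReal (h s) ∂σ +
      ENNReal.ofReal (2 * ε) * σ Set.univ) (𝓝[>] 0) (𝓝 (∫⁻ s, ENNReal.ofReal (h s) ∂σ + 0)) := by
    refine tendsto_const_nhds.add ?_
    have h1 : Tendsto (fun ε : ℝ => ENNReal.ofReal (2 * ε)) (𝓝[>] 0) (𝓝 0) := by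
      have := (ENNReal.continuous_ofReal.comp (continuous_const_mul (2 : ℝ))).tendsto 0
      simp only [Function.comp_apply, mul_zero, ENNReal.ofReal_zero] at this
      exact this.mono_left nhdsWithin_le_nhds
    simpa using ENNReal.Tendsto.mul_const h1 (Or.inr (measure_ne_top σ Set.univ))
  rw [add_zero] at hlim
  exact ge_of_tendsto hlim (eventually_mem_nhdsWithin.mono fun ε hε => key ε hε)

end ConeArea

/-! ### An area bound for images of the unit sphere -/

section SphereParametrization

open Module Measure Filter Topology Metric
open scoped Pointwise NNReal RealInnerProductSpace

variable {V : Type*} [NormedAddCommGroup V] [InnerProductSpace ℝ V]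

/-- The central projection of the unit sphere to the tangent hyperplane at `θ₀` is close to an
isometry near `θ₀`. -/
lemma norm_sub_sub_centralProjection_le {θ₀ v v' : V} (hv : ⟪θ₀, v⟫ = 1)
    (hv' : ⟪θ₀, v'⟫ = 1) (h1 : 1 ≤ ‖v‖) (h1' : 1 ≤ ‖v'‖) :
    ‖‖v‖⁻¹ • v - ‖v'‖⁻¹ • v' - (v - v')‖ ≤
      ((1 - ‖v‖⁻¹) + (‖v - θ₀‖ + ‖v' - θ₀‖)) * ‖v - v'‖ := by
  have hdecomp : ‖v‖⁻¹ • v - ‖v'‖⁻¹ • v' - (v - v') =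
      (‖v‖⁻¹ - 1) • (v - v') + (‖v‖⁻¹ - ‖v'‖⁻¹) • v' := by module
  have hsq : ‖v'‖ ^ 2 - ‖v‖ ^ 2 = ⟪v' - v, (v' - θ₀) + (v - θ₀)⟫ := by
    rw [← real_inner_self_eq_norm_sq, ← real_inner_self_eq_norm_sq]
    simp only [inner_sub_left, inner_add_right, inner_sub_right]
    rw [real_inner_comm v v', real_inner_comm θ₀ v, real_inner_comm θ₀ v', hv, hv']
    ring
  have habs : |‖v'‖ ^ 2 - ‖v‖ ^ 2| ≤ ‖v - v'‖ * (‖v - θ₀‖ + ‖v' - θ₀‖) := by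
    rw [hsq]
    refine (abs_real_inner_le_norm _ _).trans ?_
    rw [norm_sub_rev v' v, add_comm ‖v - θ₀‖]
    gcongr
    exact norm_add_le _ _
  have hdiff : |‖v‖⁻¹ - ‖v'‖⁻¹| * ‖v'‖ ≤ ‖v - v'‖ * (‖v - θ₀‖ + ‖v' - θ₀‖) := by
    refine le_trans ?_ habs
    have e1 : (‖v‖⁻¹ - ‖v'‖⁻¹) * ‖v'‖ = (‖v'‖ - ‖v‖) / ‖v‖ := by
      field_simp
    rw [← abs_of_pos (by linarith : 0 < ‖v'‖), ← abs_mul, abs_of_pos (by linarith : 0 < ‖v'‖), e1,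
      abs_div, abs_of_pos (by linarith : 0 < ‖v‖), sq_sub_sq, abs_mul]
    refine (div_le_self (abs_nonneg _) h1).trans ?_
    refine le_mul_of_one_le_left (abs_nonneg _) ?_
    rw [abs_of_pos (by linarith)]; linarith
  rw [hdecomp]
  refine (norm_add_le _ _).trans ?_
  rw [norm_smul, norm_smul, Real.norm_eq_abs, Real.norm_eq_abs, abs_sub_comm,
    abs_of_nonneg (by have := inv_le_one_of_one_le₀ h1; linarith)]
  linarith

variable [MeasurableSpace V] [BorelSpace V] [FiniteDimensional ℝ V]

/-- The part of the image of the sphere under a linear map `T` lying over a small set `P` near `θ₀`,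
projected to the hyperplane `T (θ₀ + θ₀ᗮ)`, has area at most `|det T| ‖T⁻ᵀ θ₀‖ σ(P)` up to a factor
close to one: compare the cones over the two sets. -/
lemma area_centralProjection_le (T : V ≃L[ℝ] V) (θ₀ : sphere (0 : V) 1) {c : ℝ} (hc : 0 < c)
    {P : Set (sphere (0 : V) 1)} (hP : MeasurableSet P) (hPc : ∀ θ ∈ P, c ≤ ⟪(θ₀ : V), (θ : V)⟫) :
    μHE[finrank ℝ V - 1] ((fun θ : sphere (0 : V) 1 => T ((⟪(θ₀ : V), (θ : V)⟫)⁻¹ • (θ : V))) '' P) ≤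
      ENNReal.ofReal (|(T : V →L[ℝ] V).det| *
        ‖ContinuousLinearMap.adjoint (T.symm : V →L[ℝ] V) (θ₀ : V)‖ * (c⁻¹) ^ finrank ℝ V) *
        (volume : Measure V).toSphere P := by
  set A := (fun θ : sphere (0 : V) 1 => T ((⟪(θ₀ : V), (θ : V)⟫)⁻¹ • (θ : V))) '' P with hA
  set ν := ContinuousLinearMap.adjoint (T.symm : V →L[ℝ] V) (θ₀ : V) with hν
  have hθ₀ : ‖(θ₀ : V)‖ = 1 := by simp
  have hνT : ∀ v, ⟪ν, T v⟫ = ⟪(θ₀ : V), v⟫ := by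
    intro v
    rw [hν, ContinuousLinearMap.adjoint_inner_left]
    simp
  have hν0 : ν ≠ 0 := by
    intro h
    have := hνT θ₀
    rw [h, inner_zero_left, real_inner_self_eq_norm_sq, hθ₀] at this
    norm_num at this
  have hN : 0 < finrank ℝ V := by
    have : Nontrivial V := ⟨ν, 0, hν0⟩
    exact finrank_pos
  have hAν : ∀ x ∈ A, ⟪ν, x⟫ = 1 := by
    rintro _ ⟨θ, hθ, rfl⟩
    have := hPc θ hθ
    simp only [hνT, inner_smul_right]
    exact inv_mul_cancel₀ (by linarith)
  have hAm : MeasurableSet A := by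
    have hset : A = {x | ⟪ν, x⟫ = 1} ∩
        (fun x => ‖T.symm x‖⁻¹ • T.symm x) ⁻¹' (((↑) : sphere (0 : V) 1 → V) '' P) := by
      ext x
      constructor
      · intro hx
        refine ⟨hAν x hx, ?_⟩
        obtain ⟨θ, hθ, rfl⟩ := hx
        have h1 := hPc θ hθ
        have h2 : ‖(θ : V)‖ = 1 := by simp
        refine ⟨θ, hθ, ?_⟩
        simp only [ContinuousLinearEquiv.symm_apply_apply, norm_smul, h2, mul_one, norm_inv,
          Real.norm_eq_abs, inv_inv]
        rw [abs_of_pos (by linarith), smul_inv_smul₀ (by linarith)]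
      · rintro ⟨hx1, θ, hθ, hx2⟩
        have hx1' : ⟪(θ₀ : V), T.symm x⟫ = 1 := by rw [← hνT]; simpa using hx1
        have hne : ‖T.symm x‖ ≠ 0 := by
          intro h
          rw [norm_eq_zero] at h
          rw [h, inner_zero_right] at hx1'
          norm_num at hx1'
        refine ⟨θ, hθ, ?_⟩
        simp only [hx2, inner_smul_right, hx1', mul_one, inv_inv]
        rw [smul_inv_smul₀ hne, ContinuousLinearEquiv.apply_symm_apply]
    rw [hset]
    have hT : Measurable fun x : V => T.symm x := T.symm.continuous.measurable
    refine (measurableSet_eq_fun (by fun_prop : Continuous fun x : V => ⟪ν, x⟫).measurable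
      measurable_const).inter ((hT.norm.inv.smul hT) ?_)
    exact (MeasurableEmbedding.subtype_coe isClosed_sphere.measurableSet).measurableSet_image' hP
  have hcone : Set.Ioo (0 : ℝ) 1 • A ⊆
      T '' (c⁻¹ • (Set.Ioo (0 : ℝ) 1 • (((↑) : sphere (0 : V) 1 → V) '' P))) := by
    rintro _ ⟨s, hs, _, ⟨θ, hθ, rfl⟩, rfl⟩
    have h1 := hPc θ hθ
    have h1' : 0 < ⟪(θ₀ : V), (θ : V)⟫ := hc.trans_le h1
    refine ⟨c⁻¹ • ((s * c * (⟪(θ₀ : V), (θ : V)⟫)⁻¹) • (θ : V)), Set.smul_mem_smul_set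
      ⟨_, ⟨by have := hs.1; positivity, ?_⟩, _, ⟨θ, hθ, rfl⟩, rfl⟩, ?_⟩
    · rw [← div_eq_mul_inv, div_lt_one h1']
      nlinarith [hs.1, hs.2]
    · simp only [map_smul, smul_smul]
      congr 1
      field_simp
  have hvol := (measure_mono hcone).trans_eq
    (addHaar_image_continuousLinearMap (volume : Measure V) (T : V →L[ℝ] V) _)
  rw [addHaar_smul_of_nonneg _ (by positivity)] at hvol
  rw [volume_cone_eq hν0 hAν hAm] at hvol
  rw [toSphere_apply' _ hP]
  have hn : 0 < ‖ν‖ := norm_pos_iff.2 hν0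
  have hNr : (0 : ℝ) < finrank ℝ V := by exact_mod_cast hN
  calc μHE[finrank ℝ V - 1] A
      = ENNReal.ofReal (finrank ℝ V * ‖ν‖) * (ENNReal.ofReal (1 / (finrank ℝ V * ‖ν‖)) *
          μHE[finrank ℝ V - 1] A) := by
        rw [← mul_assoc, ← ENNReal.ofReal_mul (by positivity), mul_one_div_cancel (by positivity),
          ENNReal.ofReal_one, one_mul]
    _ ≤ ENNReal.ofReal (finrank ℝ V * ‖ν‖) * (ENNReal.ofReal |(T : V →L[ℝ] V).det| *
          (ENNReal.ofReal (c⁻¹ ^ finrank ℝ V) *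
            volume (Set.Ioo (0 : ℝ) 1 • (((↑) : sphere (0 : V) 1 → V) '' P)))) := by gcongr
    _ = _ := by
        rw [ENNReal.ofReal_mul (by positivity), ENNReal.ofReal_mul (by positivity),
          ENNReal.ofReal_mul (by positivity), ENNReal.ofReal_natCast]
        ring

/-- Local area bound: near `θ₀`, a map of the sphere which dilates distances at most by `lam`
relative to the linear map `T` increases area at most by `lam ^ (n - 1) |det T| ‖T⁻ᵀ θ₀‖`. -/
lemma hausdorff_image_le_of_local_dilation {X : Type*} [EMetricSpace X] [MeasurableSpace X]
    [BorelSpace X] (T : V ≃L[ℝ] V) (F : sphere (0 : V) 1 → X) (θ₀ : sphere (0 : V) 1) {lam : ℝ}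
    (hlam : 0 ≤ lam)
    (hF : ∀ L > lam, ∀ᶠ p : sphere (0 : V) 1 × sphere (0 : V) 1 in 𝓝 (θ₀, θ₀),
      edist (F p.1) (F p.2) ≤ ENNReal.ofReal L * edist (T p.1) (T p.2))
    {C : ℝ} (hC : lam ^ (finrank ℝ V - 1) * (|(T : V →L[ℝ] V).det| *
      ‖ContinuousLinearMap.adjoint (T.symm : V →L[ℝ] V) (θ₀ : V)‖) < C) :
    ∃ U ∈ 𝓝 θ₀, ∀ P ⊆ U, MeasurableSet P →
      μHE[finrank ℝ V - 1] (F '' P) ≤ ENNReal.ofReal C * (volume : Measure V).toSphere P := by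
  set J := |(T : V →L[ℝ] V).det| * ‖ContinuousLinearMap.adjoint (T.symm : V →L[ℝ] V) (θ₀ : V)‖
    with hJ
  have hJ0 : 0 ≤ J := by positivity
  set κ := ‖(T : V →L[ℝ] V)‖ * ‖(T.symm : V →L[ℝ] V)‖ with hκ
  have hκ0 : 0 ≤ κ := by positivity
  have hθ₀ : ‖(θ₀ : V)‖ = 1 := by simp
  -- a small parameter `η` governs the three errors: dilation, central projection, cone height
  obtain ⟨η, hη0, hη1, hηC⟩ : ∃ η : ℝ, 0 < η ∧ η < 1 ∧
      ((lam + η) * (1 + κ * (3 * η))) ^ (finrank ℝ V - 1) *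
        (J * ((1 - η)⁻¹) ^ finrank ℝ V) < C := by
    have hcont : ContinuousAt (fun η : ℝ => ((lam + η) * (1 + κ * (3 * η))) ^ (finrank ℝ V - 1) *
        (J * ((1 - η)⁻¹) ^ finrank ℝ V)) 0 := by
      have : ContinuousAt (fun η : ℝ => (1 - η)⁻¹) 0 :=
        ContinuousAt.inv₀ (by fun_prop) (by norm_num)
      fun_prop
    have hev := hcont.eventually_lt_const (by simpa using hC)
    have h1 : ∀ᶠ η : ℝ in 𝓝 0, η < 1 := eventually_lt_nhds one_pos
    obtain ⟨η, ⟨h2, h3⟩, h4⟩ := (((hev.and h1).filter_mono nhdsWithin_le_nhds).and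
      (self_mem_nhdsWithin (s := Set.Ioi (0 : ℝ)))).exists
    exact ⟨η, h4, h3, h2⟩
  set proj : sphere (0 : V) 1 → V := fun θ => (⟪(θ₀ : V), (θ : V)⟫)⁻¹ • (θ : V) with hproj
  have hinner : Continuous fun θ : sphere (0 : V) 1 => ⟪(θ₀ : V), (θ : V)⟫ := by fun_prop
  have hself : ⟪(θ₀ : V), (θ₀ : V)⟫ = 1 := by rw [real_inner_self_eq_norm_sq, hθ₀, one_pow]
  have hprojc : ContinuousAt proj θ₀ :=
    (hinner.continuousAt.inv₀ (by rw [hself]; exact one_ne_zero)).smul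
      continuous_subtype_val.continuousAt
  have hproj0 : proj θ₀ = θ₀ := by simp only [hproj, hself, inv_one, one_smul]
  have hU1 : ∀ᶠ θ : sphere (0 : V) 1 in 𝓝 θ₀, 1 - η < ⟪(θ₀ : V), (θ : V)⟫ :=
    (hinner.continuousAt (x := θ₀)).eventually_const_lt (by simp only [hself]; linarith)
  have hU2 : ∀ᶠ θ : sphere (0 : V) 1 in 𝓝 θ₀, ‖proj θ - θ₀‖ < η := by
    have : ContinuousAt (fun θ => ‖proj θ - θ₀‖) θ₀ := (hprojc.sub continuousAt_const).norm
    exact this.eventually_lt_const (by simpa only [hproj0, sub_self, norm_zero] using hη0)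
  have hU3 := hF (lam + η) (by linarith)
  rw [nhds_prod_eq] at hU3
  obtain ⟨W, hW, hWF⟩ := mem_prod_self_iff.1 hU3
  refine ⟨_, Filter.inter_mem hW (hU1.and hU2), fun P hPU hP => ?_⟩
  have hfacts : ∀ θ ∈ P, 1 ≤ ‖proj θ‖ ∧ ‖proj θ‖⁻¹ • proj θ = (θ : V) ∧ 1 - ‖proj θ‖⁻¹ ≤ η ∧
      ⟪(θ₀ : V), proj θ⟫ = 1 := by
    intro θ hθ
    have ht : 1 - η < ⟪(θ₀ : V), (θ : V)⟫ := (hPU hθ).2.1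
    have ht0 : 0 < ⟪(θ₀ : V), (θ : V)⟫ := by linarith
    have ht1 : ⟪(θ₀ : V), (θ : V)⟫ ≤ 1 := by
      have := real_inner_le_norm (θ₀ : V) (θ : V)
      rwa [hθ₀, show ‖(θ : V)‖ = 1 by simp, mul_one] at this
    have hnorm : ‖proj θ‖ = (⟪(θ₀ : V), (θ : V)⟫)⁻¹ := by
      simp only [hproj, norm_smul, norm_inv, Real.norm_eq_abs, abs_of_pos ht0]
      simp
    refine ⟨by rw [hnorm]; exact (one_le_inv₀ ht0).2 ht1, ?_, by rw [hnorm, inv_inv]; linarith, ?_⟩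
    · rw [hnorm, inv_inv]; exact smul_inv_smul₀ ht0.ne' _
    · simp only [hproj, inner_smul_right]; exact inv_mul_cancel₀ ht0.ne'
  have hdil : ∀ θ ∈ P, ∀ θ' ∈ P, edist (F θ) (F θ') ≤
      ((Real.toNNReal ((lam + η) * (1 + κ * (3 * η))) : ℝ≥0) : ℝ≥0∞) *
        edist (T (proj θ)) (T (proj θ')) := by
    intro θ hθ θ' hθ'
    obtain ⟨a1, a2, a3, a4⟩ := hfacts θ hθ
    obtain ⟨b1, b2, b3, b4⟩ := hfacts θ' hθ'
    have h1 := norm_sub_sub_centralProjection_le a4 b4 a1 b1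
    rw [a2, b2] at h1
    have a5 : ‖proj θ - θ₀‖ < η := (hPU hθ).2.2
    have b5 : ‖proj θ' - θ₀‖ < η := (hPU hθ').2.2
    have h2 : ‖(θ : V) - θ' - (proj θ - proj θ')‖ ≤ 3 * η * ‖proj θ - proj θ'‖ :=
      h1.trans (by gcongr; linarith)
    have h3 : ‖proj θ - proj θ'‖ ≤ ‖(T.symm : V →L[ℝ] V)‖ * ‖T (proj θ) - T (proj θ')‖ := by
      have := (T.symm : V →L[ℝ] V).le_opNorm (T (proj θ) - T (proj θ'))
      simpa [map_sub] using this
    have h4 : ‖T (θ : V) - T (θ' : V)‖ ≤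
        (1 + κ * (3 * η)) * ‖T (proj θ) - T (proj θ')‖ := by
      have e : T (θ : V) - T (θ' : V) = (T (proj θ) - T (proj θ')) +
          (T : V →L[ℝ] V) ((θ : V) - θ' - (proj θ - proj θ')) := by
        simp only [ContinuousLinearEquiv.coe_coe, map_sub]; abel
      rw [e]
      refine (norm_add_le _ _).trans ?_
      have h5 := (T : V →L[ℝ] V).le_opNorm ((θ : V) - θ' - (proj θ - proj θ'))
      have h6 : ‖(T : V →L[ℝ] V)‖ * ‖(θ : V) - θ' - (proj θ - proj θ')‖ ≤
          ‖(T : V →L[ℝ] V)‖ * (3 * η * (‖(T.symm : V →L[ℝ] V)‖ * ‖T (proj θ) - T (proj θ')‖)) := by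
        gcongr
        exact h2.trans (by gcongr)
      rw [hκ]
      linarith [h5.trans h6]
    refine (hWF (Set.mk_mem_prod (hPU hθ).1 (hPU hθ').1)).trans ?_
    change _ ≤ ENNReal.ofReal _ * _
    rw [ENNReal.ofReal_mul (by linarith), mul_assoc]
    gcongr
    rw [edist_dist, edist_dist, dist_eq_norm, dist_eq_norm, ← ENNReal.ofReal_mul (by positivity)]
    exact ENNReal.ofReal_le_ofReal h4
  have hmeas := euclideanHausdorffMeasure_image_le_of_edist_le (f := fun θ => T (proj θ)) (g := F)
    (finrank ℝ V - 1) hdil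
  have hproj' := area_centralProjection_le T θ₀ (by linarith : 0 < 1 - η) hP
    (fun θ hθ => (le_of_lt (hPU hθ).2.1 : 1 - η ≤ ⟪(θ₀ : V), (θ : V)⟫))
  calc μHE[finrank ℝ V - 1] (F '' P) ≤ _ := hmeas
    _ ≤ ENNReal.ofReal ((lam + η) * (1 + κ * (3 * η))) ^ (finrank ℝ V - 1) *
          (ENNReal.ofReal (J * ((1 - η)⁻¹) ^ finrank ℝ V) * (volume : Measure V).toSphere P) := by
        exact mul_le_mul' le_rfl hproj'
    _ = ENNReal.ofReal (((lam + η) * (1 + κ * (3 * η))) ^ (finrank ℝ V - 1) *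
          (J * ((1 - η)⁻¹) ^ finrank ℝ V)) * (volume : Measure V).toSphere P := by
        rw [← ENNReal.ofReal_pow (by positivity), ← mul_assoc,
          ← ENNReal.ofReal_mul (by positivity)]
    _ ≤ _ := by gcongr

/-- The area formula as an upper bound: if `F` dilates distances at `θ` at most by `lam θ` relative
to the linear map `T`, then the image of the unit sphere under `F` has Hausdorff measure at most
`∫ lam ^ (n - 1) |det T| ‖T⁻ᵀ θ‖ dσ`. -/
theorem hausdorff_range_le_lintegral {X : Type*} [EMetricSpace X] [MeasurableSpace X]
    [BorelSpace X] (T : V ≃L[ℝ] V) (F : sphere (0 : V) 1 → X) (lam : sphere (0 : V) 1 → ℝ)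
    (hlam : ∀ θ, 0 ≤ lam θ) (hlamc : Continuous lam)
    (hF : ∀ θ₀, ∀ L > lam θ₀, ∀ᶠ p : sphere (0 : V) 1 × sphere (0 : V) 1 in 𝓝 (θ₀, θ₀),
      edist (F p.1) (F p.2) ≤ ENNReal.ofReal L * edist (T p.1) (T p.2)) :
    μHE[finrank ℝ V - 1] (Set.range F) ≤
      ∫⁻ θ, ENNReal.ofReal (lam θ ^ (finrank ℝ V - 1) * (|(T : V →L[ℝ] V).det| *
        ‖ContinuousLinearMap.adjoint (T.symm : V →L[ℝ] V) (θ : V)‖))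
        ∂(volume : Measure V).toSphere :=
  measure_range_le_lintegral_of_local _ _ F _ (by fun_prop)
    (fun θ => by have := hlam θ; positivity)
    fun θ _ hC => hausdorff_image_le_of_local_dilation T F θ (hlam θ) (hF θ) hC

end SphereParametrization

/-! ### The Riemannian distance in the global chart -/

namespace DoubledSchwarzschild
open Filter Topology Metric

variable {n : ℕ}

lemma edist_eq_riemannianEDist (x y : DoubledSchwarzschild n) :
    edist x y = riemannianEDist (𝓡 n) x y := rfl

lemma isOpenEmbedding_coord : IsOpenEmbedding (coord (n := n)) :=
  IsOpen.isOpenEmbedding_subtypeVal (isOpen_compl_singleton (x := (0 : EuclideanSpace ℝ (Fin n))))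

lemma range_coord : Set.range (coord (n := n)) = {0}ᶜ :=
  Subtype.range_coe (s := ({0}ᶜ : Set (EuclideanSpace ℝ (Fin n))))

lemma norm_tangent (x : DoubledSchwarzschild n) (v : EuclideanSpace ℝ (Fin n)) :
    ‖(show TangentSpace (𝓡 n) x from v)‖ = √(conformalFactor x) * ‖v‖ := by
  have h : ‖(show TangentSpace (𝓡 n) x from v)‖ ^ 2 = conformalFactor x * ‖v‖ ^ 2 := by
    rw [← real_inner_self_eq_norm_sq, ← real_inner_self_eq_norm_sq]
    exact metricForm_apply x v v
  rw [← Real.sqrt_sq (norm_nonneg _), h, Real.sqrt_mul (conformalFactor_pos x).le,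
    Real.sqrt_sq (norm_nonneg _)]

lemma enorm_mfderivWithin {γ : ℝ → DoubledSchwarzschild n} {t : ℝ} {s : Set ℝ}
    (h : MDifferentiableWithinAt 𝓘(ℝ, ℝ) (𝓡 n) γ s t) :
    ‖mfderivWithin 𝓘(ℝ, ℝ) (𝓡 n) γ s t 1‖ₑ =
      ENNReal.ofReal (√(conformalFactor (γ t)) * ‖fderivWithin ℝ (fun t => coord (γ t)) s t 1‖) := by
  have h1 : fderivWithin ℝ (writtenInExtChartAt 𝓘(ℝ, ℝ) (𝓡 n) t γ)
      ((extChartAt 𝓘(ℝ, ℝ) t).symm ⁻¹' s ∩ Set.range 𝓘(ℝ, ℝ))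
        (extChartAt 𝓘(ℝ, ℝ) t t) = fderivWithin ℝ (fun t => coord (γ t)) s t := by
    simp only [mfld_simps]
    rfl
  have h2 := h.mfderivWithin.trans h1
  rw [← ofReal_norm]
  refine congrArg ENNReal.ofReal (Eq.trans ?_ (norm_tangent (γ t) _))
  exact congrArg (fun A : ℝ →L[ℝ] EuclideanSpace ℝ (Fin n) => ‖(show TangentSpace (𝓡 n) (γ t) from A 1)‖) h2

/-- The Riemannian distance of two points is at most the Euclidean one, times a bound for the square
root of the conformal factor along a convex set containing them. -/
lemma edist_le_of_convex {S : Set (EuclideanSpace ℝ (Fin n))} (hS : Convex ℝ S)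
    (h0 : (0 : EuclideanSpace ℝ (Fin n)) ∉ S)
    {L : ℝ} (hL : ∀ z : DoubledSchwarzschild n, coord z ∈ S → √(conformalFactor z) ≤ L)
    {x y : DoubledSchwarzschild n} (hx : coord x ∈ S) (hy : coord y ∈ S) :
    edist x y ≤ ENNReal.ofReal L * edist (coord x) (coord y) := by
  classical
  set η := ContinuousAffineMap.lineMap (R := ℝ) (coord x) (coord y) with hη
  have hηS : ∀ t ∈ Set.Icc (0 : ℝ) 1, η t ∈ S := by
    intro t ht
    rw [hη, ContinuousAffineMap.coe_lineMap_eq]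
    exact hS.lineMap_mem hx hy ht
  have hne : ∀ t ∈ Set.Icc (0 : ℝ) 1, η t ≠ 0 := fun t ht h => h0 (h ▸ hηS t ht)
  set γ : ℝ → DoubledSchwarzschild n := fun t => if h : η t ≠ 0 then ⟨η t, h⟩ else x with hγ
  have hγη : ∀ t ∈ Set.Icc (0 : ℝ) 1, coord (γ t) = η t := by
    intro t ht
    have : γ t = ⟨η t, hne t ht⟩ := dif_pos (hne t ht)
    rw [this]; rfl
  have hcoord : Function.Injective (coord (n := n)) := Subtype.val_injective
  have hsm : ContMDiffOn 𝓘(ℝ, ℝ) (𝓡 n) 1 γ (Set.Icc 0 1) := by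
    intro t ht
    rw [contMDiffWithinAt_iff]
    constructor
    · rw [isOpenEmbedding_coord.isInducing.continuousWithinAt_iff]
      exact (η.continuous.continuousWithinAt).congr hγη (hγη t ht)
    · have : ContDiffWithinAt ℝ 1 (fun s => coord (γ s)) (Set.Icc 0 1) t :=
        (η.contDiff.contDiffWithinAt).congr hγη (hγη t ht)
      simp only [mfld_simps]
      exact this
  have hle : edist x y ≤ pathELength (𝓡 n) γ 0 1 := by
    rw [edist_eq_riemannianEDist]
    refine riemannianEDist_le_pathELength hsm ?_ ?_ zero_le_one
    · apply hcoord; rw [hγη 0 (by simp)]; simp [hη, ContinuousAffineMap.coe_lineMap_eq]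
    · apply hcoord; rw [hγη 1 (by simp)]; simp [hη, ContinuousAffineMap.coe_lineMap_eq]
  refine hle.trans ?_
  rw [← lintegral_fderiv_lineMap_eq_edist, pathELength_eq_lintegral_mfderivWithin_Icc,
    ← lintegral_const_mul' _ _ ENNReal.ofReal_ne_top]
  refine setLIntegral_mono' measurableSet_Icc fun t ht => ?_
  rw [enorm_mfderivWithin ((hsm t ht).mdifferentiableWithinAt one_ne_zero),
    fderivWithin_congr hγη (hγη t ht), ENNReal.ofReal_mul (Real.sqrt_nonneg _), ofReal_norm]
  gcongr
  exact hL _ (by rw [hγη t ht]; exact hηS t ht)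

lemma continuous_conformalFactor : Continuous (conformalFactor (n := n)) :=
  contMDiff_conformalFactor.continuous

lemma eventually_edist_le (x₀ : DoubledSchwarzschild n) {L : ℝ} (hL : √(conformalFactor x₀) < L) :
    ∀ᶠ p : DoubledSchwarzschild n × DoubledSchwarzschild n in 𝓝 (x₀, x₀),
      edist p.1 p.2 ≤ ENNReal.ofReal L * edist (coord p.1) (coord p.2) := by
  have h1 : ∀ᶠ z in 𝓝 x₀, √(conformalFactor z) < L :=
    (continuous_conformalFactor.sqrt.continuousAt (x := x₀)).eventually_lt_const hL
  have h2 : coord '' {z | √(conformalFactor z) < L} ∈ 𝓝 (coord x₀) :=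
    isOpenEmbedding_coord.isOpenMap.image_mem_nhds h1
  obtain ⟨r, hr, hball⟩ := Metric.mem_nhds_iff.1 h2
  have h3 : ∀ᶠ z in 𝓝 x₀, coord z ∈ ball (coord x₀) r :=
    isOpenEmbedding_coord.continuous.continuousAt.eventually_mem (ball_mem_nhds _ hr)
  rw [nhds_prod_eq]
  filter_upwards [h3.prod_mk h3] with p hp
  refine edist_le_of_convex (convex_ball (coord x₀) r) ?_ ?_ hp.1 hp.2
  · intro h
    obtain ⟨z, -, hz⟩ := hball h
    exact coord_ne_zero z hz
  · intro z hz
    obtain ⟨w, hw, hwz⟩ := hball hz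
    rw [← isOpenEmbedding_coord.injective hwz]
    exact hw.le

/-! ### Ellipsoidal regions -/

/-- The closed region of `ℝⁿ \ {0}` whose coordinates fill the ellipsoid `p + r T B`, with `B` the
closed unit ball. -/
def ellipsoid (p : EuclideanSpace ℝ (Fin n)) (r : ℝ)
    (T : EuclideanSpace ℝ (Fin n) ≃L[ℝ] EuclideanSpace ℝ (Fin n)) :
    Set (DoubledSchwarzschild n) :=
  coord ⁻¹' ((fun y => p + r • T y) '' closedBall 0 1)

section Ellipsoid

variable {p : EuclideanSpace ℝ (Fin n)} {r : ℝ}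
  {T : EuclideanSpace ℝ (Fin n) ≃L[ℝ] EuclideanSpace ℝ (Fin n)}

/-- The homeomorphism `y ↦ p + r T y`. -/
def affineHomeomorph (p : EuclideanSpace ℝ (Fin n)) {r : ℝ} (hr : r ≠ 0)
    (T : EuclideanSpace ℝ (Fin n) ≃L[ℝ] EuclideanSpace ℝ (Fin n)) :
    EuclideanSpace ℝ (Fin n) ≃ₜ EuclideanSpace ℝ (Fin n) :=
  (T.toHomeomorph.trans (Homeomorph.smulOfNeZero r hr)).trans (Homeomorph.addLeft p)

lemma mem_image_affine_iff (hr : r ≠ 0) (x : EuclideanSpace ℝ (Fin n))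
    (S : Set (EuclideanSpace ℝ (Fin n))) :
    x ∈ (fun y => p + r • T y) '' S ↔ T.symm (r⁻¹ • (x - p)) ∈ S := by
  constructor
  · rintro ⟨y, hy, rfl⟩
    simpa [smul_smul, hr] using hy
  · intro h
    exact ⟨_, h, by simp [smul_smul, hr]⟩

lemma frontier_ellipsoid_eq (hn : n ≠ 0) (hr : r ≠ 0) :
    frontier (ellipsoid p r T) = coord ⁻¹' ((fun y => p + r • T y) '' sphere 0 1) := by
  have : Nontrivial (EuclideanSpace ℝ (Fin n)) := by
    have : Nonempty (Fin n) := ⟨⟨0, Nat.pos_of_ne_zero hn⟩⟩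
    infer_instance
  have h := (affineHomeomorph p hr T).image_frontier (closedBall 0 1)
  rw [frontier_closedBall _ one_ne_zero] at h
  rw [ellipsoid, ← isOpenEmbedding_coord.isOpenMap.preimage_frontier_eq_frontier_preimage
    isOpenEmbedding_coord.continuous]
  exact congrArg _ h.symm

lemma mfderiv_comp_coord_ne_zero {f : EuclideanSpace ℝ (Fin n) → ℝ} (hf : ContDiff ℝ ∞ f)
    (x : DoubledSchwarzschild n) (w : EuclideanSpace ℝ (Fin n))
    (hw : fderiv ℝ f (coord x) w ≠ 0) :
    mfderiv (𝓡 n) 𝓘(ℝ, ℝ) (fun z => f (coord z)) x ≠ 0 := by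
  intro h0
  have hcoord : MDifferentiableAt (𝓡 n) (𝓡 n) (coord (n := n)) x :=
    (contMDiff_coord x).mdifferentiableAt (by simp)
  have hcomp : mfderiv (𝓡 n) 𝓘(ℝ, ℝ) (fun z => f (coord z)) x =
      (mfderiv (𝓡 n) 𝓘(ℝ, ℝ) f (coord x)).comp (mfderiv (𝓡 n) (𝓡 n) coord x) :=
    mfderiv_comp x (hf.contMDiff.mdifferentiable (by simp) _) hcoord
  have hinv : (mfderiv (𝓡 n) (𝓡 n) (coord (n := n)) x).IsInvertible :=
    isInvertible_mfderiv_extChartAt (I := 𝓡 n) (mem_extChartAt_source x)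
  obtain ⟨v, hv⟩ := hinv.bijective.2 w
  apply hw
  have h1 : (mfderiv (𝓡 n) 𝓘(ℝ, ℝ) f (coord x)) (mfderiv (𝓡 n) (𝓡 n) coord x v) = (0 : ℝ) :=
    (congrArg (fun A : TangentSpace (𝓡 n) x →L[ℝ] ℝ => A v) hcomp).symm.trans
      (congrArg (fun A : TangentSpace (𝓡 n) x →L[ℝ] ℝ => A v) h0)
  rw [hv, mfderiv_eq_fderiv] at h1
  exact h1

/-- The defining function of the ellipsoid `p + r T B`, whose derivative at a boundary point `x` in
the direction `x - p` is `2`. -/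
lemma fderiv_ellipsoid_defining (x : EuclideanSpace ℝ (Fin n))
    (hx : ‖T.symm (r⁻¹ • (x - p))‖ = 1) :
    fderiv ℝ (fun v => ‖T.symm (r⁻¹ • (v - p))‖ ^ 2 - 1) x (x - p) = 2 := by
  set S : EuclideanSpace ℝ (Fin n) →L[ℝ] EuclideanSpace ℝ (Fin n) :=
    r⁻¹ • (T.symm : EuclideanSpace ℝ (Fin n) →L[ℝ] EuclideanSpace ℝ (Fin n)) with hS
  have hSv : ∀ v, T.symm (r⁻¹ • v) = S v := by intro v; simp [hS]
  simp_rw [hSv] at hx ⊢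
  have h1 : HasFDerivAt (fun v => S (v - p)) S x :=
    S.hasFDerivAt.comp x ((hasFDerivAt_id x).sub_const p)
  rw [(h1.norm_sq.sub_const 1).fderiv]
  simp [-map_sub, hx]

lemma contDiff_ellipsoid_defining :
    ContDiff ℝ ∞ (fun v : EuclideanSpace ℝ (Fin n) => ‖T.symm (r⁻¹ • (v - p))‖ ^ 2 - 1) := by
  have h : ContDiff ℝ ∞ fun v : EuclideanSpace ℝ (Fin n) => T.symm (r⁻¹ • (v - p)) := by fun_prop
  exact (h.norm_sq ℝ).sub contDiff_const

lemma contMDiff_comp_coord {f : EuclideanSpace ℝ (Fin n) → ℝ} (hf : ContDiff ℝ ∞ f) :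
    ContMDiff (𝓡 n) 𝓘(ℝ, ℝ) ∞ (fun z => f (coord z)) :=
  hf.contMDiff.comp contMDiff_coord

lemma hasSmoothBoundary_of_sublevel {D : Set (DoubledSchwarzschild n)}
    {f : EuclideanSpace ℝ (Fin n) → ℝ} (hf : ContDiff ℝ ∞ f)
    (hD : ∀ x, x ∈ D ↔ f (coord x) ≤ 0)
    (hd : ∀ x ∈ frontier D, ∃ w, fderiv ℝ f (coord x) w ≠ 0) : HasSmoothBoundary D := by
  intro x hx
  obtain ⟨w, hw⟩ := hd x hx
  refine ⟨Set.univ, isOpen_univ, trivial, fun z => f (coord z),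
    (contMDiff_comp_coord hf).contMDiffOn, mfderiv_comp_coord_ne_zero hf x w hw, ?_⟩
  ext z
  rw [Set.inter_univ, hD]
  exact ⟨fun h => ⟨trivial, h⟩, fun h => h.2⟩

lemma ellipsoid_hasSmoothBoundary (hn : n ≠ 0) (hr : r ≠ 0) :
    HasSmoothBoundary (ellipsoid p r T) := by
  refine hasSmoothBoundary_of_sublevel (contDiff_ellipsoid_defining (p := p) (r := r) (T := T))
    (fun x => ?_) (fun x hx => ⟨coord x - p, ?_⟩)
  · rw [ellipsoid, Set.mem_preimage, mem_image_affine_iff hr, mem_closedBall_zero_iff, sub_nonpos]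
    exact (sq_le_one_iff₀ (norm_nonneg _)).symm
  · rw [frontier_ellipsoid_eq hn hr, Set.mem_preimage, mem_image_affine_iff hr,
      mem_sphere_zero_iff_norm] at hx
    rw [fderiv_ellipsoid_defining _ hx]
    norm_num

lemma image_affine_subset_range
    (h0 : ∀ y ∈ closedBall (0 : EuclideanSpace ℝ (Fin n)) 1, p + r • T y ≠ 0) :
    (fun y => p + r • T y) '' closedBall 0 1 ⊆ Set.range (coord (n := n)) := by
  rintro _ ⟨y, hy, rfl⟩
  rw [range_coord]
  exact h0 y hy

lemma ellipsoid_isSmoothRegion (hn : n ≠ 0) (hr : r ≠ 0)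
    (h0 : ∀ y ∈ closedBall (0 : EuclideanSpace ℝ (Fin n)) 1, p + r • T y ≠ 0) :
    IsSmoothRegion (ellipsoid p r T) where
  isCompact := by
    refine (isOpenEmbedding_coord.isInducing.isCompact_preimage_iff (image_affine_subset_range h0)).2 ?_
    exact (isCompact_closedBall _ _).image (by fun_prop)
  isConnected := by
    refine IsConnected.preimage_of_isOpenMap ?_ isOpenEmbedding_coord.injective
      isOpenEmbedding_coord.isOpenMap (image_affine_subset_range h0)
    exact ((convex_closedBall _ _).isConnected ⟨0, by simp⟩).image _ (by fun_prop)
  hasSmoothBoundary := ellipsoid_hasSmoothBoundary hn hr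

end Ellipsoid

end DoubledSchwarzschild

/-! ### Volume and boundary area of ellipsoids -/

namespace DoubledSchwarzschild
open Filter Topology Metric Module
variable {n : ℕ}

/-- The harmonic function `φ = 1 + |x|^(2-n)`, of which the conformal factor is a power. -/
def harmonicFactor (v : EuclideanSpace ℝ (Fin n)) : ℝ := 1 + ‖v‖ ^ (2 - (n : ℝ))

lemma one_le_harmonicFactor (v : EuclideanSpace ℝ (Fin n)) : 1 ≤ harmonicFactor v := by
  unfold harmonicFactor
  have : 0 ≤ ‖v‖ ^ (2 - (n : ℝ)) := by positivity
  linarith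

lemma harmonicFactor_pos (v : EuclideanSpace ℝ (Fin n)) : 0 < harmonicFactor v :=
  one_pos.trans_le (one_le_harmonicFactor v)

lemma conformalFactor_eq (x : DoubledSchwarzschild n) :
    conformalFactor x = harmonicFactor (coord x) ^ (4 / ((n : ℝ) - 2)) := rfl

lemma continuousAt_harmonicFactor {v : EuclideanSpace ℝ (Fin n)} (hv : v ≠ 0) :
    ContinuousAt harmonicFactor v := by
  unfold harmonicFactor
  exact continuousAt_const.add
    (continuousAt_id.norm.rpow_const (Or.inl (norm_ne_zero_iff.2 hv)))

lemma metricMatrix_eq (x : DoubledSchwarzschild n) :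
    metricMatrix x = conformalFactor x • (1 : Matrix (Fin n) (Fin n) ℝ) := by
  ext i j
  rw [metricMatrix, Matrix.of_apply, metricForm_apply, Matrix.smul_apply, smul_eq_mul,
    Matrix.one_apply]
  congr 1
  rw [EuclideanSpace.inner_single_left]
  simp

lemma sqrt_det_metricMatrix (x : DoubledSchwarzschild n) :
    √(metricMatrix x).det = harmonicFactor (coord x) ^ (2 * (n : ℝ) / ((n : ℝ) - 2)) := by
  have h0 := (harmonicFactor_pos (coord x)).le
  rw [metricMatrix_eq, Matrix.det_smul, Matrix.det_one, mul_one, Fintype.card_fin,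
    conformalFactor_eq, Real.sqrt_eq_rpow, ← Real.rpow_natCast, ← Real.rpow_mul h0,
    ← Real.rpow_mul h0]
  congr 1
  ring

lemma sqrt_conformalFactor_pow (hn : 1 ≤ n) (x : DoubledSchwarzschild n) :
    √(conformalFactor x) ^ (n - 1) =
      harmonicFactor (coord x) ^ (2 * ((n : ℝ) - 1) / ((n : ℝ) - 2)) := by
  have h0 := (harmonicFactor_pos (coord x)).le
  rw [conformalFactor_eq, Real.sqrt_eq_rpow, ← Real.rpow_natCast, ← Real.rpow_mul h0,
    ← Real.rpow_mul h0, Nat.cast_sub hn]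
  congr 1
  push_cast
  ring

section Ellipsoid

variable {p : EuclideanSpace ℝ (Fin n)} {r : ℝ}
  {T : EuclideanSpace ℝ (Fin n) ≃L[ℝ] EuclideanSpace ℝ (Fin n)}

lemma continuousOn_harmonicFactor_affine
    (h0 : ∀ y ∈ closedBall (0 : EuclideanSpace ℝ (Fin n)) 1, p + r • T y ≠ 0) (s : ℝ) :
    ContinuousOn (fun y => harmonicFactor (p + r • T y) ^ s) (closedBall 0 1) := by
  intro y hy
  have h1 : ContinuousAt (fun y => p + r • T y) y := by fun_prop
  exact ((ContinuousAt.comp (f := fun y => p + r • T y)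
    (continuousAt_harmonicFactor (h0 y hy)) h1).rpow_const
      (Or.inl (harmonicFactor_pos _).ne')).continuousWithinAt

lemma vol_ellipsoid (hr : 0 < r)
    (h0 : ∀ y ∈ closedBall (0 : EuclideanSpace ℝ (Fin n)) 1, p + r • T y ≠ 0) :
    vol n (ellipsoid p r T) = ENNReal.ofReal (r ^ n *
      |(T : EuclideanSpace ℝ (Fin n) →L[ℝ] EuclideanSpace ℝ (Fin n)).det| *
      ∫ y in closedBall (0 : EuclideanSpace ℝ (Fin n)) 1,
        harmonicFactor (p + r • T y) ^ (2 * (n : ℝ) / ((n : ℝ) - 2))) := by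
  set g : EuclideanSpace ℝ (Fin n) → ℝ≥0∞ := fun v =>
    ENNReal.ofReal (harmonicFactor v ^ (2 * (n : ℝ) / ((n : ℝ) - 2))) with hg
  set f : EuclideanSpace ℝ (Fin n) → EuclideanSpace ℝ (Fin n) := fun y => p + r • T y with hf
  have hcont : Continuous f := by fun_prop
  have hSm : MeasurableSet (f '' closedBall 0 1) :=
    ((isCompact_closedBall _ _).image hcont).isClosed.measurableSet
  have hemb : MeasurableEmbedding (coord (n := n)) := isOpenEmbedding_coord.measurableEmbedding
  have hgm : Measurable g := by
    have : Measurable (harmonicFactor (n := n)) :=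
      measurable_const.add (measurable_norm.pow_const _)
    exact (this.pow_const _).ennreal_ofReal
  rw [vol, ellipsoid, withDensity_apply _ (hemb.measurable hSm)]
  simp_rw [sqrt_det_metricMatrix]
  change ∫⁻ x in coord ⁻¹' (f '' closedBall 0 1), g (coord x) ∂_ = _
  rw [← setLIntegral_map hSm hgm hemb.measurable, hemb.map_comap,
    Measure.restrict_restrict hSm, Set.inter_eq_left.2 (image_affine_subset_range h0)]
  set A : EuclideanSpace ℝ (Fin n) →L[ℝ] EuclideanSpace ℝ (Fin n) :=
    r • (T : EuclideanSpace ℝ (Fin n) →L[ℝ] EuclideanSpace ℝ (Fin n)) with hA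
  have hder : ∀ y ∈ closedBall (0 : EuclideanSpace ℝ (Fin n)) 1,
      HasFDerivWithinAt f A (closedBall 0 1) y := fun y _ =>
    (A.hasFDerivAt.const_add p).hasFDerivWithinAt
  have hinj : Set.InjOn f (closedBall 0 1) := by
    intro y _ z _ hyz
    exact T.injective (smul_right_injective _ hr.ne' (add_left_cancel hyz))
  rw [lintegral_image_eq_lintegral_abs_det_fderiv_mul volume measurableSet_closedBall hder hinj,
    lintegral_const_mul' _ _ ENNReal.ofReal_ne_top]
  have hdet : A.det = r ^ n * (T : EuclideanSpace ℝ (Fin n) →L[ℝ] EuclideanSpace ℝ (Fin n)).det := by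
    have := LinearMap.det_smul r ((T : EuclideanSpace ℝ (Fin n) →L[ℝ] EuclideanSpace ℝ (Fin n)) :
      EuclideanSpace ℝ (Fin n) →ₗ[ℝ] EuclideanSpace ℝ (Fin n))
    rw [finrank_euclideanSpace_fin] at this
    exact this
  rw [hdet, abs_mul, abs_of_pos (pow_pos hr n), ENNReal.ofReal_mul (p := r ^ n * _) (by positivity)]
  congr 1
  rw [ofReal_integral_eq_lintegral_ofReal]
  · exact (continuousOn_harmonicFactor_affine h0 _).integrableOn_compact (isCompact_closedBall _ _)
  · exact Eventually.of_forall fun y => Real.rpow_nonneg (harmonicFactor_pos _).le _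

/-- At a boundary point the Riemannian distance dilates the Euclidean one by the square root of the
conformal factor, which gives the dilation in the area bound. -/
lemma area_frontier_ellipsoid_le (hn : 2 ≤ n) (hr : 0 < r)
    (h0 : ∀ y ∈ closedBall (0 : EuclideanSpace ℝ (Fin n)) 1, p + r • T y ≠ 0) :
    area (frontier (ellipsoid p r T)) ≤ ENNReal.ofReal (r ^ (n - 1) *
      ∫ θ : sphere (0 : EuclideanSpace ℝ (Fin n)) 1,
        harmonicFactor (p + r • T θ) ^ (2 * ((n : ℝ) - 1) / ((n : ℝ) - 2)) *
        (|(T : EuclideanSpace ℝ (Fin n) →L[ℝ] EuclideanSpace ℝ (Fin n)).det| *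
          ‖ContinuousLinearMap.adjoint
            (T.symm : EuclideanSpace ℝ (Fin n) →L[ℝ] EuclideanSpace ℝ (Fin n)) θ‖)
        ∂(volume : Measure (EuclideanSpace ℝ (Fin n))).toSphere) := by
  have hsph : ∀ θ : sphere (0 : EuclideanSpace ℝ (Fin n)) 1, p + r • T θ ≠ 0 := fun θ =>
    h0 θ (sphere_subset_closedBall θ.2)
  set F : sphere (0 : EuclideanSpace ℝ (Fin n)) 1 → DoubledSchwarzschild n :=
    fun θ => ⟨p + r • T θ, hsph θ⟩ with hF
  have hcF : ∀ θ, coord (F θ) = p + r • T θ := fun θ => rfl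
  have hFc : Continuous F := by
    rw [isOpenEmbedding_coord.isInducing.continuous_iff]
    change Continuous fun θ : sphere (0 : EuclideanSpace ℝ (Fin n)) 1 => p + r • T θ
    fun_prop
  have hrange : frontier (ellipsoid p r T) = Set.range F := by
    rw [frontier_ellipsoid_eq (by omega) hr.ne']
    ext x
    constructor
    · rintro ⟨y, hy, hyx⟩
      exact ⟨⟨y, hy⟩, isOpenEmbedding_coord.injective hyx⟩
    · rintro ⟨θ, rfl⟩
      exact ⟨θ, θ.2, rfl⟩
  have hlam := hausdorff_range_le_lintegral T F (fun θ => r * √(conformalFactor (F θ)))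
    (fun θ => by positivity)
    (continuous_const.mul (continuous_conformalFactor.comp hFc).sqrt) (fun θ₀ L hL => ?_)
  · rw [finrank_euclideanSpace_fin] at hlam
    rw [area, hrange]
    refine hlam.trans_eq ?_
    have hcontφ : Continuous fun θ : sphere (0 : EuclideanSpace ℝ (Fin n)) 1 =>
        harmonicFactor (p + r • T θ) ^ (2 * ((n : ℝ) - 1) / ((n : ℝ) - 2)) :=
      (continuousOn_harmonicFactor_affine h0 _).comp_continuous continuous_subtype_val
        fun θ => sphere_subset_closedBall θ.2
    rw [← integral_const_mul, ofReal_integral_eq_lintegral_ofReal]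
    · congr 1 with θ
      rw [mul_pow, sqrt_conformalFactor_pow (by omega), hcF, mul_assoc]
    · refine Continuous.integrable_of_hasCompactSupport (by fun_prop) ?_
      exact HasCompactSupport.of_compactSpace _
    · refine Eventually.of_forall fun θ => ?_
      have := (harmonicFactor_pos (p + r • T θ)).le
      simp only [Pi.zero_apply]
      positivity
  · have h1 := eventually_edist_le (F θ₀) (L := L / r) (by rw [lt_div_iff₀ hr, mul_comm]; exact hL)
    have h2 : Tendsto (fun q : sphere (0 : EuclideanSpace ℝ (Fin n)) 1 ×
        sphere (0 : EuclideanSpace ℝ (Fin n)) 1 => (F q.1, F q.2)) (𝓝 (θ₀, θ₀)) (𝓝 (F θ₀, F θ₀)) :=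
      ((hFc.comp continuous_fst).prodMk (hFc.comp continuous_snd)).tendsto (θ₀, θ₀)
    filter_upwards [h2.eventually h1] with q hq
    refine hq.trans_eq ?_
    have hL0 : 0 ≤ L / r := div_nonneg ((by positivity : 0 ≤ r * √(conformalFactor (F θ₀))).trans
      hL.le) hr.le
    simp only [hcF]
    rw [edist_dist, edist_dist, dist_add_left, dist_smul₀, ENNReal.ofReal_mul (norm_nonneg _),
      ← mul_assoc, ← ENNReal.ofReal_mul hL0, Real.norm_of_nonneg hr.le, div_mul_cancel₀ _ hr.ne']

end Ellipsoid
end DoubledSchwarzschild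

/-! ### Expansion of the powers of the harmonic factor -/

open Filter Topology Asymptotics

lemma one_add_rpow_sub_cubic_isBigO (q : ℝ) :
    (fun x : ℝ => (1 + x) ^ q - (1 + q * x + q * (q - 1) / 2 * x ^ 2 +
      q * (q - 1) * (q - 2) / 6 * x ^ 3)) =O[𝓝 0] fun x => x ^ 4 := by
  have h := (Real.one_add_rpow_hasFPowerSeriesAt_zero (a := q)).isBigO_sub_partialSum_pow 4
  have h2 : Ring.choose q 2 = q * (q - 1) / 2 := by
    have := Ring.descPochhammer_eq_factorial_smul_choose q 2
    simp only [descPochhammer_succ_left, ← Polynomial.aeval_eq_smeval] at this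
    simp [Nat.factorial] at this
    linarith
  have h3 : Ring.choose q 3 = q * (q - 1) * (q - 2) / 6 := by
    have := Ring.descPochhammer_eq_factorial_smul_choose q 3
    simp only [descPochhammer_succ_left, ← Polynomial.aeval_eq_smeval] at this
    simp [Nat.factorial] at this
    linarith
  refine (h.congr_left fun x => ?_).trans (IsBigO.of_bound 1 (Eventually.of_forall fun x => by simp))
  simp [FormalMultilinearSeries.partialSum, Finset.sum_range_succ, binomialSeries,
    FormalMultilinearSeries.coeff_ofScalars, h2, h3]
  ring

namespace ShapeExpansion

/-- The parameters `((μ, δ), (u, ρ))` of the expansions: the small mass `μ` and the small relative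
radius `δ`, and, for a point `y` of the closed unit ball, its height `u = ⟪e, y⟫` and its squared
norm `ρ = ‖y‖²`. -/
abbrev Param := (ℝ × ℝ) × (ℝ × ℝ)

/-- Small positive `μ` and `δ`, uniformly over the closed unit ball. -/
def small : Filter Param :=
  (𝓝[>] 0 ×ˢ 𝓝[>] 0) ×ˢ 𝓟 (Set.Icc (-1) 1 ×ˢ Set.Icc 0 1)

/-- The mass parameter. -/
def μ (x : Param) : ℝ := x.1.1

/-- The relative radius. -/
def δ (x : Param) : ℝ := x.1.2

/-- The height of the point of the ball. -/
def u (x : Param) : ℝ := x.2.1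

/-- The squared norm of the point of the ball. -/
def ρ (x : Param) : ℝ := x.2.2

@[fun_prop] lemma continuous_μ : Continuous μ := by unfold μ; fun_prop
@[fun_prop] lemma continuous_δ : Continuous δ := by unfold δ; fun_prop
@[fun_prop] lemma continuous_u : Continuous u := by unfold u; fun_prop
@[fun_prop] lemma continuous_ρ : Continuous ρ := by unfold ρ; fun_prop

lemma tendsto_μ : Tendsto μ small (𝓝 0) :=
  ((tendsto_fst.mono_right nhdsWithin_le_nhds).comp tendsto_fst)

lemma tendsto_δ : Tendsto δ small (𝓝 0) :=
  ((tendsto_snd.mono_right nhdsWithin_le_nhds).comp tendsto_fst)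

lemma eventually_pos : ∀ᶠ x in small, 0 < μ x ∧ 0 < δ x := by
  have h1 : Tendsto μ small (𝓝[>] 0) := tendsto_fst.comp tendsto_fst
  have h2 : Tendsto δ small (𝓝[>] 0) := tendsto_snd.comp tendsto_fst
  exact (h1.eventually eventually_mem_nhdsWithin).and (h2.eventually eventually_mem_nhdsWithin)

lemma isBigO_one_of_continuous {F : Param → ℝ} (hF : Continuous F) :
    F =O[small] fun _ => (1 : ℝ) := by
  have hK : IsCompact ((Set.Icc (0 : ℝ) 1 ×ˢ Set.Icc (0 : ℝ) 1) ×ˢ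
      (Set.Icc (-1 : ℝ) 1 ×ˢ Set.Icc (0 : ℝ) 1)) :=
    (isCompact_Icc.prod isCompact_Icc).prod (isCompact_Icc.prod isCompact_Icc)
  obtain ⟨C, hC⟩ := hK.exists_bound_of_continuousOn hF.continuousOn
  refine IsBigO.of_bound C ?_
  have h1 : ∀ᶠ t : ℝ in 𝓝[>] 0, t ∈ Set.Icc (0 : ℝ) 1 := by
    filter_upwards [Ioc_mem_nhdsGT (zero_lt_one' ℝ)] with t ht using ⟨ht.1.le, ht.2⟩
  have h2 : ∀ᶠ y in 𝓟 (Set.Icc (-1 : ℝ) 1 ×ˢ Set.Icc (0 : ℝ) 1),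
      y ∈ Set.Icc (-1 : ℝ) 1 ×ˢ Set.Icc (0 : ℝ) 1 := mem_principal_self _
  have h3 := (h1.prod_mk h1).prod_mk h2
  filter_upwards [h3] with x hx
  rw [norm_one, mul_one]
  exact hC x ⟨⟨hx.1.1, hx.1.2⟩, hx.2⟩

/-- A multiple of `g` by a continuous function of the parameters is `O(g)`. -/
lemma isBigO_of_eq_mul {f g F : Param → ℝ} (hF : Continuous F) (h : ∀ x, f x = g x * F x) :
    f =O[small] g := by
  have := (isBigO_refl g small).mul (isBigO_one_of_continuous hF)
  simp only [mul_one] at this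
  exact this.congr_left fun x => (h x).symm

/-- The gauge `(μ + δ) μ² δ⁴` of negligible quantities. -/
def gauge (x : Param) : ℝ := (μ x + δ x) * (μ x ^ 2 * δ x ^ 4)

lemma isBigO_gauge_of_scale : (fun x => μ x ^ 2 * δ x ^ 5) =O[small] gauge := by
  refine IsBigO.of_bound 1 ?_
  filter_upwards [eventually_pos] with x hx
  obtain ⟨h1, h2⟩ := hx
  rw [gauge, Real.norm_of_nonneg (by positivity), Real.norm_of_nonneg (by positivity), one_mul]
  have : 0 ≤ μ x ^ 3 * δ x ^ 4 := by positivity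
  nlinarith

lemma isBigO_gauge_of_mass : (fun x => μ x ^ 3 * δ x ^ 4) =O[small] gauge := by
  refine IsBigO.of_bound 1 ?_
  filter_upwards [eventually_pos] with x hx
  obtain ⟨h1, h2⟩ := hx
  rw [gauge, Real.norm_of_nonneg (by positivity), Real.norm_of_nonneg (by positivity), one_mul]
  have : 0 ≤ μ x ^ 2 * δ x ^ 5 := by positivity
  nlinarith

/-- The stretching parameter `τ = -s μ δ²`. -/
def τ (s : ℝ) (x : Param) : ℝ := -s * (μ x * δ x ^ 2)

@[fun_prop] lemma continuous_τ (s : ℝ) : Continuous (τ s) := by unfold τ; fun_prop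

/-- `‖e + δ y‖² - 1`. -/
def v (x : Param) : ℝ := δ x * (2 * u x + δ x * ρ x)

@[fun_prop] lemma continuous_v : Continuous v := by unfold v; fun_prop

/-- The change of `‖e + δ y‖²` when `y` is stretched by `1 + τ` in the direction `e`. -/
def w (s : ℝ) (x : Param) : ℝ := δ x * τ s x * (2 * u x + δ x * (2 + τ s x) * u x ^ 2)

@[fun_prop] lemma continuous_w (s : ℝ) : Continuous (w s) := by unfold w; fun_prop

/-- First coefficient of the expansion of `‖e + δ y‖ ^ (2 p)` in powers of `δ`. -/
def f₁ (p : ℝ) (x : Param) : ℝ := 2 * p * u x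

/-- Second coefficient of the expansion of `‖e + δ y‖ ^ (2 p)` in powers of `δ`. -/
def f₂ (p : ℝ) (x : Param) : ℝ := p * ρ x + 2 * p * (p - 1) * u x ^ 2

/-- Third coefficient of the expansion of `‖e + δ y‖ ^ (2 p)` in powers of `δ`. -/
def f₃ (p : ℝ) (x : Param) : ℝ :=
  2 * p * (p - 1) * u x * ρ x + 4 / 3 * (p * (p - 1) * (p - 2)) * u x ^ 3

@[fun_prop] lemma continuous_f₁ (p : ℝ) : Continuous (f₁ p) := by unfold f₁; fun_prop
@[fun_prop] lemma continuous_f₂ (p : ℝ) : Continuous (f₂ p) := by unfold f₂; fun_prop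
@[fun_prop] lemma continuous_f₃ (p : ℝ) : Continuous (f₃ p) := by unfold f₃; fun_prop

lemma tendsto_zero_of_isBigO_δ {f : Param → ℝ} (h : f =O[small] δ) : Tendsto f small (𝓝 0) :=
  h.trans_tendsto tendsto_δ

lemma v_isBigO : v =O[small] δ := isBigO_of_eq_mul (F := fun x => 2 * u x + δ x * ρ x)
  (by fun_prop) fun _ => rfl

lemma w_isBigO (s : ℝ) : w s =O[small] fun x => δ x * τ s x :=
  isBigO_of_eq_mul (F := fun x => 2 * u x + δ x * (2 + τ s x) * u x ^ 2) (by fun_prop) fun _ => rfl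

lemma tendsto_v : Tendsto v small (𝓝 0) := tendsto_zero_of_isBigO_δ v_isBigO

lemma tendsto_w (s : ℝ) : Tendsto (w s) small (𝓝 0) :=
  tendsto_zero_of_isBigO_δ (isBigO_of_eq_mul
    (F := fun x => τ s x * (2 * u x + δ x * (2 + τ s x) * u x ^ 2)) (by fun_prop)
    fun x => by rw [w]; ring)

lemma one_add_rpow_sub_quadratic_isBigO (q : ℝ) :
    (fun x : ℝ => (1 + x) ^ q - (1 + q * x + q * (q - 1) / 2 * x ^ 2)) =O[𝓝 0] fun x => x ^ 3 := by
  have h1 := (one_add_rpow_sub_cubic_isBigO q).trans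
    (isLittleO_pow_pow (𝕜 := ℝ) (by norm_num : 3 < 4)).isBigO
  have h2 : (fun x : ℝ => q * (q - 1) * (q - 2) / 6 * x ^ 3) =O[𝓝 0] fun x => x ^ 3 :=
    (isBigO_refl _ _).const_mul_left _
  exact (h1.add h2).congr_left fun x => by ring

lemma one_add_rpow_sub_linear_isBigO (q : ℝ) :
    (fun x : ℝ => (1 + x) ^ q - (1 + q * x)) =O[𝓝 0] fun x => x ^ 2 := by
  have h1 := (one_add_rpow_sub_quadratic_isBigO q).trans
    (isLittleO_pow_pow (𝕜 := ℝ) (by norm_num : 2 < 3)).isBigO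
  have h2 : (fun x : ℝ => q * (q - 1) / 2 * x ^ 2) =O[𝓝 0] fun x => x ^ 2 :=
    (isBigO_refl _ _).const_mul_left _
  exact (h1.add h2).congr_left fun x => by ring

lemma one_add_rpow_isBigO_one (q : ℝ) {f : Param → ℝ} (hf : Tendsto f small (𝓝 0)) :
    (fun x => (1 + f x) ^ q) =O[small] fun _ => (1 : ℝ) := by
  have h : Tendsto (fun x => (1 + f x) ^ q) small (𝓝 ((1 + 0) ^ q)) :=
    (tendsto_const_nhds.add hf).rpow_const (Or.inl (by norm_num))
  exact h.isBigO_one ℝ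

/-- `‖e + δ y‖ ^ (2 p) - 1`. -/
def g (p : ℝ) (x : Param) : ℝ := (1 + v x) ^ p - 1

/-- The change of `‖e + δ y‖ ^ (2 p)` when `y` is stretched by `1 + τ` in the direction `e`. -/
def k (p s : ℝ) (x : Param) : ℝ := (1 + (v x + w s x)) ^ p - (1 + v x) ^ p

lemma g_expansion (p : ℝ) :
    (fun x => g p x - (δ x * f₁ p x + δ x ^ 2 * f₂ p x + δ x ^ 3 * f₃ p x)) =O[small]
      fun x => δ x ^ 4 := by
  have h1 := ((one_add_rpow_sub_cubic_isBigO p).comp_tendsto tendsto_v).trans (v_isBigO.pow 4)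
  have h2 : (fun x => δ x ^ 4 * (p * (p - 1) / 2 * ρ x ^ 2 + p * (p - 1) * (p - 2) / 6 *
      (12 * u x ^ 2 * ρ x + 6 * δ x * u x * ρ x ^ 2 + δ x ^ 2 * ρ x ^ 3))) =O[small]
      fun x => δ x ^ 4 := isBigO_of_eq_mul (by fun_prop) fun _ => rfl
  refine (h1.add h2).congr_left fun x => ?_
  simp only [Function.comp_apply, g, f₁, f₂, f₃, v]
  ring

lemma g_sub_linear_isBigO (p : ℝ) :
    (fun x => g p x - δ x * f₁ p x) =O[small] fun x => δ x ^ 2 := by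
  have h2 : (fun x => δ x ^ 2 * f₂ p x + δ x ^ 3 * f₃ p x) =O[small] fun x => δ x ^ 2 :=
    isBigO_of_eq_mul (F := fun x => f₂ p x + δ x * f₃ p x) (by fun_prop) fun x => by ring
  have h4 : (fun x => δ x ^ 4) =O[small] fun x => δ x ^ 2 :=
    isBigO_of_eq_mul (F := fun x => δ x ^ 2) (by fun_prop) fun x => by ring
  exact (((g_expansion p).trans h4).add h2).congr_left fun x => by ring

lemma k_expansion (p s : ℝ) :
    (fun x => k p s x - (δ x * τ s x * (2 * p * u x) +
      δ x ^ 2 * τ s x * (2 * p * (2 * p - 1) * u x ^ 2))) =O[small]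
      fun x => δ x ^ 3 * τ s x := by
  set w' : Param → ℝ := fun x => w s x * (1 + v x) ^ (-1 : ℝ) with hw'
  have hw'O : w' =O[small] w s := by
    simpa using (isBigO_refl (w s) small).mul (one_add_rpow_isBigO_one (-1) tendsto_v)
  have hw'0 : Tendsto w' small (𝓝 0) := hw'O.trans_tendsto (tendsto_w s)
  have hpos : ∀ᶠ x in small, 0 < 1 + v x ∧ 0 < 1 + w' x := by
    have h1 : ∀ᶠ x in small, -1 < v x := tendsto_v.eventually_const_lt (by norm_num)
    have h2 : ∀ᶠ x in small, -1 < w' x := hw'0.eventually_const_lt (by norm_num)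
    filter_upwards [h1, h2] with x a b
    constructor <;> linarith
  -- errors quadratic in `w` or of the form `w v ^ 2`
  have e1 : (fun x => (1 + v x) ^ p * ((1 + w' x) ^ p - (1 + p * w' x))) =O[small]
      fun x => δ x ^ 3 * τ s x := by
    have h1 := ((one_add_rpow_sub_linear_isBigO p).comp_tendsto hw'0).trans
      ((hw'O.trans (w_isBigO s)).pow 2)
    have h2 := (one_add_rpow_isBigO_one p tendsto_v).mul h1
    refine h2.trans (isBigO_of_eq_mul (F := fun x => -s * μ x * δ x) (by fun_prop) fun x => ?_)
    rw [τ]; ring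
  have e2 : (fun x => p * w s x * ((1 + v x) ^ (p - 1) - (1 + (p - 1) * v x))) =O[small]
      fun x => δ x ^ 3 * τ s x := by
    have h1 := ((one_add_rpow_sub_linear_isBigO (p - 1)).comp_tendsto tendsto_v).trans
      (v_isBigO.pow 2)
    have h2 := ((w_isBigO s).const_mul_left p).mul h1
    exact h2.trans (isBigO_of_eq_mul (F := fun _ => 1) (by fun_prop) fun x => by ring)
  have e3 : (fun x => p * w s x * (1 + (p - 1) * v x) - (δ x * τ s x * (2 * p * u x) +
      δ x ^ 2 * τ s x * (2 * p * (2 * p - 1) * u x ^ 2))) =O[small]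
      fun x => δ x ^ 3 * τ s x := by
    refine isBigO_of_eq_mul (F := fun x => p * (-s * μ x * δ x * u x ^ 2 +
      2 * (p - 1) * u x * ρ x + (2 * u x ^ 2 + τ s x * u x ^ 2) * (p - 1) *
        (2 * u x + δ x * ρ x))) (by fun_prop) fun x => ?_
    simp only [w, v, τ]
    ring
  refine ((e1.add e2).add e3).congr' ?_ EventuallyEq.rfl
  filter_upwards [hpos] with x hx
  obtain ⟨h1, h2⟩ := hx
  have a1 : 1 + (v x + w s x) = (1 + v x) * (1 + w' x) := by
    simp only [hw', Real.rpow_neg_one]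
    field_simp
    ring
  have a2 : (1 + v x) ^ p * w' x = w s x * (1 + v x) ^ (p - 1) := by
    simp only [hw']
    rw [mul_left_comm, ← Real.rpow_add h1]
    rfl
  rw [k, a1, Real.mul_rpow h1.le h2.le]
  linear_combination (-p) * a2

/-- `X = μ (‖e + δ T y‖ ^ (2 p) - 1)`, with `T` the stretching by `1 + τ` in the direction `e`. -/
def perturbation (p s : ℝ) (x : Param) : ℝ := μ x * (g p x + k p s x)

lemma k_isBigO (p s : ℝ) : k p s =O[small] fun x => μ x * δ x ^ 3 := by
  have h1 : (fun x => δ x ^ 3 * τ s x) =O[small] fun x => μ x * δ x ^ 3 :=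
    isBigO_of_eq_mul (F := fun x => -s * δ x ^ 2) (by fun_prop) fun x => by rw [τ]; ring
  have h2 : (fun x => δ x * τ s x * (2 * p * u x) +
      δ x ^ 2 * τ s x * (2 * p * (2 * p - 1) * u x ^ 2)) =O[small] fun x => μ x * δ x ^ 3 :=
    isBigO_of_eq_mul (F := fun x => -s * (2 * p * u x) + δ x * -s * (2 * p * (2 * p - 1) * u x ^ 2))
      (by fun_prop) fun x => by rw [τ]; ring
  exact (((k_expansion p s).trans h1).add h2).congr_left fun x => by ring

lemma perturbation_sub_linear_isBigO (p s : ℝ) :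
    (fun x => perturbation p s x - μ x * (δ x * f₁ p x)) =O[small] fun x => μ x * δ x ^ 2 := by
  have h1 := (isBigO_refl μ small).mul (g_sub_linear_isBigO p)
  have h2 := (isBigO_refl μ small).mul ((k_isBigO p s).trans
    (isBigO_of_eq_mul (g := fun x => δ x ^ 2) (F := fun x => μ x * δ x) (by fun_prop)
      fun x => by ring))
  exact (h1.add h2).congr_left fun x => by rw [perturbation]; ring

lemma perturbation_isBigO (p s : ℝ) : perturbation p s =O[small] fun x => μ x * δ x := by
  have h1 := (perturbation_sub_linear_isBigO p s).trans
    (isBigO_of_eq_mul (g := fun x => μ x * δ x) (F := δ) (by fun_prop) fun x => by ring)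
  have h2 : (fun x => μ x * (δ x * f₁ p x)) =O[small] fun x => μ x * δ x :=
    isBigO_of_eq_mul (F := f₁ p) (by fun_prop) fun x => by ring
  exact (h1.add h2).congr_left fun x => by ring

lemma tendsto_perturbation (p s : ℝ) : Tendsto (perturbation p s) small (𝓝 0) :=
  (perturbation_isBigO p s).trans_tendsto (by simpa using tendsto_μ.mul tendsto_δ)

lemma perturbation_sq_expansion (p s : ℝ) :
    (fun x => perturbation p s x ^ 2 - μ x ^ 2 * (δ x ^ 2 * f₁ p x ^ 2 +
      2 * δ x ^ 3 * (f₁ p x * f₂ p x) + δ x ^ 4 * (f₂ p x ^ 2 + 2 * (f₁ p x * f₃ p x))))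
      =O[small] gauge := by
  set Y : Param → ℝ := fun x => μ x * (δ x * f₁ p x + δ x ^ 2 * f₂ p x + δ x ^ 3 * f₃ p x) with hY
  have hXY : (fun x => perturbation p s x - Y x) =O[small]
      fun x => (μ x + δ x) * (μ x * δ x ^ 3) := by
    have h1 : (fun x => μ x * δ x ^ 4) =O[small] fun x => (μ x + δ x) * (μ x * δ x ^ 3) := by
      refine IsBigO.of_bound 1 ?_
      filter_upwards [eventually_pos] with x hx
      obtain ⟨h1, h2⟩ := hx
      rw [Real.norm_of_nonneg (by positivity), Real.norm_of_nonneg (by positivity), one_mul]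
      have : 0 ≤ μ x ^ 2 * δ x ^ 3 := by positivity
      nlinarith
    have h2 : (fun x => μ x * (μ x * δ x ^ 3)) =O[small]
        fun x => (μ x + δ x) * (μ x * δ x ^ 3) := by
      refine IsBigO.of_bound 1 ?_
      filter_upwards [eventually_pos] with x hx
      obtain ⟨h1, h2⟩ := hx
      rw [Real.norm_of_nonneg (by positivity), Real.norm_of_nonneg (by positivity), one_mul]
      have : 0 ≤ μ x * δ x ^ 4 := by positivity
      nlinarith
    have h3 := ((isBigO_refl μ small).mul (g_expansion p)).trans h1
    have h4 := ((isBigO_refl μ small).mul (k_isBigO p s)).trans h2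
    exact (h3.add h4).congr_left fun x => by simp only [perturbation, hY]; ring
  have hYO : Y =O[small] fun x => μ x * δ x :=
    isBigO_of_eq_mul (F := fun x => f₁ p x + δ x * f₂ p x + δ x ^ 2 * f₃ p x) (by fun_prop)
      fun x => by simp only [hY]; ring
  have h1 := hXY.mul ((perturbation_isBigO p s).add hYO)
  have h1' : (fun x => (μ x + δ x) * (μ x * δ x ^ 3) * (μ x * δ x)) =O[small] gauge :=
    isBigO_of_eq_mul (F := fun _ => 1) (by fun_prop) fun x => by rw [gauge]; ring
  have h2 : (fun x => μ x ^ 2 * δ x ^ 5 * (2 * f₂ p x * f₃ p x + δ x * f₃ p x ^ 2)) =O[small]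
      gauge :=
    (isBigO_of_eq_mul (g := fun x => μ x ^ 2 * δ x ^ 5) (by fun_prop) fun _ => rfl).trans
      isBigO_gauge_of_scale
  exact ((h1.trans h1').add h2).congr_left fun x => by simp only [hY]; ring

lemma perturbation_cube_expansion (p s : ℝ) :
    (fun x => perturbation p s x ^ 3 - μ x ^ 3 * δ x ^ 3 * f₁ p x ^ 3) =O[small] gauge := by
  have hYO : (fun x => μ x * (δ x * f₁ p x)) =O[small] fun x => μ x * δ x :=
    isBigO_of_eq_mul (F := f₁ p) (by fun_prop) fun x => by ring
  have hX := perturbation_isBigO p s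
  have h1 := (perturbation_sub_linear_isBigO p s).mul
    (((hX.mul hX).add (hX.mul hYO)).add (hYO.mul hYO))
  have h2 : (fun x => μ x * δ x ^ 2 * (μ x * δ x * (μ x * δ x))) =O[small] gauge :=
    (isBigO_of_eq_mul (g := fun x => μ x ^ 3 * δ x ^ 4) (F := fun _ => 1) (by fun_prop)
      fun x => by ring).trans isBigO_gauge_of_mass
  exact (h1.trans h2).congr_left fun x => by ring

/-- The part of `(1 + X) ^ q` which is not negligible; the harmonic first order term `μ g` is kept
unexpanded, since its averages vanish exactly. -/
def mainPart (p s q : ℝ) (x : Param) : ℝ :=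
  1 + q * (μ x * g p x) +
    q * (μ x * (δ x * τ s x * (2 * p * u x) +
      δ x ^ 2 * τ s x * (2 * p * (2 * p - 1) * u x ^ 2))) +
    q * (q - 1) / 2 * (μ x ^ 2 * (δ x ^ 2 * f₁ p x ^ 2 +
      2 * δ x ^ 3 * (f₁ p x * f₂ p x) + δ x ^ 4 * (f₂ p x ^ 2 + 2 * (f₁ p x * f₃ p x)))) +
    q * (q - 1) * (q - 2) / 6 * (μ x ^ 3 * δ x ^ 3 * f₁ p x ^ 3)

lemma rpow_expansion (p s q : ℝ) :
    (fun x => (1 + perturbation p s x) ^ q - mainPart p s q x) =O[small] gauge := by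
  have h4 : (fun x => (μ x * δ x) ^ 4) =O[small] gauge :=
    (isBigO_of_eq_mul (g := fun x => μ x ^ 3 * δ x ^ 4) (F := μ) (by fun_prop)
      fun x => by ring).trans isBigO_gauge_of_mass
  have e4 := (((one_add_rpow_sub_cubic_isBigO q).comp_tendsto (tendsto_perturbation p s)).trans
    ((perturbation_isBigO p s).pow 4)).trans h4
  have e3 := (perturbation_cube_expansion p s).const_mul_left (q * (q - 1) * (q - 2) / 6)
  have e2 := (perturbation_sq_expansion p s).const_mul_left (q * (q - 1) / 2)
  have e1 : (fun x => q * (μ x * (k p s x - (δ x * τ s x * (2 * p * u x) +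
      δ x ^ 2 * τ s x * (2 * p * (2 * p - 1) * u x ^ 2))))) =O[small] gauge := by
    refine (((isBigO_refl μ small).mul (k_expansion p s)).const_mul_left q).trans ?_
    exact (isBigO_of_eq_mul (g := fun x => μ x ^ 2 * δ x ^ 5) (F := fun _ => -s) (by fun_prop)
      fun x => by rw [τ]; ring).trans isBigO_gauge_of_scale
  refine (((e4.add e3).add e2).add e1).congr_left fun x => ?_
  simp only [Function.comp_apply, mainPart]
  rw [show perturbation p s x = μ x * (g p x + k p s x) from rfl]
  ring

end ShapeExpansion

/-! ### Expansion of the area density -/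

namespace ShapeExpansion
open Filter Topology Asymptotics

lemma exists_forall_of_eventually_small {P : Param → Prop} (h : ∀ᶠ x in small, P x) :
    ∃ η > 0, ∀ m ∈ Set.Ioo (0 : ℝ) η, ∀ d ∈ Set.Ioo (0 : ℝ) η,
      ∀ a ∈ Set.Icc (-1 : ℝ) 1, ∀ b ∈ Set.Icc (0 : ℝ) 1, P ((m, d), (a, b)) := by
  rw [small, eventually_prod_principal_iff] at h
  obtain ⟨A, hA, B, hB, h⟩ := eventually_prod_iff.1 h
  obtain ⟨η₁, hη₁, h₁⟩ := mem_nhdsGT_iff_exists_Ioo_subset.1 hA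
  obtain ⟨η₂, hη₂, h₂⟩ := mem_nhdsGT_iff_exists_Ioo_subset.1 hB
  exact ⟨min η₁ η₂, lt_min hη₁ hη₂, fun m hm d hd a ha b hb =>
    h (h₁ ⟨hm.1, hm.2.trans_le (min_le_left _ _)⟩)
      (h₂ ⟨hd.1, hd.2.trans_le (min_le_right _ _)⟩) (a, b) ⟨ha, hb⟩⟩

lemma exists_uniform_bound {F : Param → ℝ} (hF : F =O[small] gauge) :
    ∃ C > 0, ∃ η > 0, ∀ m ∈ Set.Ioo (0 : ℝ) η, ∀ d ∈ Set.Ioo (0 : ℝ) η,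
      ∀ a ∈ Set.Icc (-1 : ℝ) 1, ∀ b ∈ Set.Icc (0 : ℝ) 1,
        |F ((m, d), (a, b))| ≤ C * ((m + d) * (m ^ 2 * d ^ 4)) := by
  obtain ⟨C, hC0, hC⟩ := hF.exists_pos
  obtain ⟨η, hη, h⟩ := exists_forall_of_eventually_small hC.bound
  refine ⟨C, hC0, η, hη, fun m hm d hd a ha b hb => ?_⟩
  have := h m hm d hd a ha b hb
  have hm0 := hm.1
  have hd0 := hd.1
  simp only [gauge, μ, δ, Real.norm_eq_abs] at this
  rwa [abs_of_nonneg (a := (m + d) * (m ^ 2 * d ^ 4)) (by positivity)] at this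

/-- The area element of the ellipsoid with axis `1 + τ` in the direction `e`, relative to the unit
sphere. -/
def weight (s : ℝ) (x : Param) : ℝ := √(1 + τ s x * (2 + τ s x) * (1 - u x ^ 2))

/-- The second order Taylor polynomial of `weight - 1` in `τ`. -/
def weightMain (s : ℝ) (x : Param) : ℝ :=
  τ s x * (1 - u x ^ 2) + τ s x ^ 2 * ((1 - u x ^ 2) / 2 - (1 - u x ^ 2) ^ 2 / 2)

@[fun_prop] lemma continuous_weightMain (s : ℝ) : Continuous (weightMain s) := by
  unfold weightMain; fun_prop

lemma weight_expansion (s : ℝ) :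
    (fun x => weight s x - (1 + weightMain s x)) =O[small] fun x => τ s x ^ 3 := by
  have hZ : (fun x => τ s x * (2 + τ s x) * (1 - u x ^ 2)) =O[small] τ s :=
    isBigO_of_eq_mul (F := fun x => (2 + τ s x) * (1 - u x ^ 2)) (by fun_prop) fun x => by ring
  have hτ : Tendsto (τ s) small (𝓝 0) := tendsto_zero_of_isBigO_δ
    (isBigO_of_eq_mul (F := fun x => -s * μ x * δ x) (by fun_prop) fun x => by rw [τ]; ring)
  have h1 := ((one_add_rpow_sub_quadratic_isBigO (1 / 2)).comp_tendsto
    (hZ.trans_tendsto hτ)).trans (hZ.pow 3)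
  have h2 : (fun x => -(τ s x ^ 3 * ((1 - u x ^ 2) ^ 2 * (4 + τ s x) / 8))) =O[small]
      fun x => τ s x ^ 3 :=
    isBigO_of_eq_mul (F := fun x => -((1 - u x ^ 2) ^ 2 * (4 + τ s x) / 8)) (by fun_prop)
      fun x => by ring
  refine (h1.add h2).congr_left fun x => ?_
  simp only [Function.comp_apply, weight, weightMain, Real.sqrt_eq_rpow]
  ring

lemma τ_isBigO (s : ℝ) : τ s =O[small] fun x => μ x * δ x ^ 2 :=
  isBigO_of_eq_mul (F := fun _ => -s) (by fun_prop) fun x => by rw [τ]; ring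

lemma τ_cube_isBigO (s : ℝ) : (fun x => τ s x ^ 3) =O[small] gauge :=
  (isBigO_of_eq_mul (g := fun x => μ x ^ 3 * δ x ^ 4) (F := fun x => -s ^ 3 * δ x ^ 2) (by fun_prop)
    fun x => by rw [τ]; ring).trans isBigO_gauge_of_mass

lemma weightMain_isBigO (s : ℝ) : weightMain s =O[small] fun x => μ x * δ x ^ 2 :=
  (isBigO_of_eq_mul (F := fun x => (1 - u x ^ 2) +
    τ s x * ((1 - u x ^ 2) / 2 - (1 - u x ^ 2) ^ 2 / 2)) (by fun_prop)
      fun x => by rw [weightMain]; ring).trans (τ_isBigO s)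

lemma mainPart_sub_quadratic_isBigO (p s q : ℝ) :
    (fun x => mainPart p s q x - 1 - q * (μ x * (δ x * f₁ p x + δ x ^ 2 * f₂ p x))) =O[small]
      fun x => (μ x + δ x) * (μ x * δ x ^ 2) := by
  have a1 : (fun x => μ x * (δ x) ^ 3) =O[small] fun x => (μ x + δ x) * (μ x * δ x ^ 2) := by
    refine IsBigO.of_bound 1 ?_
    filter_upwards [eventually_pos] with x hx
    obtain ⟨h1, h2⟩ := hx
    rw [Real.norm_of_nonneg (by positivity), Real.norm_of_nonneg (by positivity), one_mul]
    have : 0 ≤ μ x ^ 2 * δ x ^ 2 := by positivity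
    nlinarith
  have a2 : (fun x => μ x ^ 2 * (δ x) ^ 2) =O[small] fun x => (μ x + δ x) * (μ x * δ x ^ 2) := by
    refine IsBigO.of_bound 1 ?_
    filter_upwards [eventually_pos] with x hx
    obtain ⟨h1, h2⟩ := hx
    rw [Real.norm_of_nonneg (by positivity), Real.norm_of_nonneg (by positivity), one_mul]
    have : 0 ≤ μ x * δ x ^ 3 := by positivity
    nlinarith
  have h4 : (fun x => δ x ^ 4) =O[small] fun x => δ x ^ 3 :=
    isBigO_of_eq_mul (F := fun x => δ x) (by fun_prop) fun x => by ring
  have b1 := ((((isBigO_refl μ small).mul ((g_expansion p).trans h4))).trans a1).const_mul_left q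
  have b2 : (fun x => μ x * δ x ^ 3 * (q * f₃ p x)) =O[small]
      fun x => (μ x + δ x) * (μ x * δ x ^ 2) :=
    (isBigO_of_eq_mul (g := fun x => μ x * δ x ^ 3) (by fun_prop) fun _ => rfl).trans a1
  have b3 : (fun x => μ x ^ 2 * δ x ^ 2 * (
      q * (-s * δ x * (2 * p * u x) + δ x ^ 2 * -s * (2 * p * (2 * p - 1) * u x ^ 2)) +
    q * (q - 1) / 2 * (f₁ p x ^ 2 +
      2 * δ x * (f₁ p x * f₂ p x) + δ x ^ 2 * (f₂ p x ^ 2 + 2 * (f₁ p x * f₃ p x))) +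
    q * (q - 1) * (q - 2) / 6 * (μ x * δ x * f₁ p x ^ 3))) =O[small]
      fun x => (μ x + δ x) * (μ x * δ x ^ 2) :=
    (isBigO_of_eq_mul (g := fun x => μ x ^ 2 * δ x ^ 2) (by fun_prop) fun _ => rfl).trans a2
  refine ((b1.add b2).add b3).congr_left fun x => ?_
  simp only [mainPart, τ]
  ring

/-- The part of `(1 + X) ^ q * weight` which is not negligible. -/
def areaMain (p s q : ℝ) (x : Param) : ℝ :=
  mainPart p s q x + weightMain s x +
    q * (μ x * (δ x * f₁ p x + δ x ^ 2 * f₂ p x)) * (τ s x * (1 - u x ^ 2))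

lemma area_expansion (p s q : ℝ) :
    (fun x => (1 + perturbation p s x) ^ q * weight s x - areaMain p s q x) =O[small] gauge := by
  have hlow : (fun x => q * (μ x * (δ x * f₁ p x + δ x ^ 2 * f₂ p x))) =O[small]
      fun x => μ x * δ x :=
    isBigO_of_eq_mul (F := fun x => q * (f₁ p x + δ x * f₂ p x)) (by fun_prop) fun x => by ring
  -- the factor `weight` is bounded
  have hW : weight s =O[small] fun _ => (1 : ℝ) := by
    have : Continuous (weight s) := by unfold weight; fun_prop
    exact isBigO_one_of_continuous this
  have hψ1 : (fun x => (1 + weightMain s x)) =O[small] fun _ => (1 : ℝ) :=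
    isBigO_one_of_continuous (by fun_prop)
  have hψ : (fun x => (1 + perturbation p s x) ^ q) =O[small] fun _ => (1 : ℝ) :=
    one_add_rpow_isBigO_one q (tendsto_perturbation p s)
  have e1 := hψ.mul ((weight_expansion s).trans (τ_cube_isBigO s))
  have e2 := (rpow_expansion p s q).mul hψ1
  have e3 := (mainPart_sub_quadratic_isBigO p s q).mul (weightMain_isBigO s)
  have e3' : (fun x => (μ x + δ x) * (μ x * δ x ^ 2) * (μ x * δ x ^ 2)) =O[small] gauge :=
    isBigO_of_eq_mul (F := fun _ => 1) (by fun_prop) fun x => by rw [gauge]; ring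
  have hW2 : (fun x => weightMain s x - τ s x * (1 - u x ^ 2)) =O[small] fun x => τ s x ^ 2 :=
    isBigO_of_eq_mul (F := fun x => (1 - u x ^ 2) / 2 - (1 - u x ^ 2) ^ 2 / 2) (by fun_prop)
      fun x => by rw [weightMain]; ring
  have e4 := hlow.mul hW2
  have e4' : (fun x => μ x * δ x * τ s x ^ 2) =O[small] gauge :=
    (isBigO_of_eq_mul (g := fun x => μ x ^ 3 * δ x ^ 4) (F := fun x => s ^ 2 * δ x) (by fun_prop)
      fun x => by rw [τ]; ring).trans isBigO_gauge_of_mass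
  simp only [one_mul, mul_one] at e1 e2
  refine (((e1.add e2).add (e3.trans e3')).add (e4.trans e4')).congr_left fun x => ?_
  simp only [areaMain]
  ring

end ShapeExpansion

/-! ### Integration by parts on the unit sphere -/

section SphereIntegrals

open Module Measure Filter Topology Metric
open scoped Pointwise RealInnerProductSpace

/-- The integral over the unit sphere is invariant under linear isometries. -/
lemma integral_sphere_comp_isometry {V : Type*} [NormedAddCommGroup V] [InnerProductSpace ℝ V]
    [MeasurableSpace V] [BorelSpace V] [FiniteDimensional ℝ V] (L : V ≃ₗᵢ[ℝ] V) (F : V → ℝ) :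
    ∫ θ : sphere (0 : V) 1, F (L θ) ∂(volume : Measure V).toSphere =
      ∫ θ : sphere (0 : V) 1, F θ ∂(volume : Measure V).toSphere := by
  set φ : sphere (0 : V) 1 ≃ₜ sphere (0 : V) 1 := L.toHomeomorph.subtype fun x => by simp with hφ
  have hφL : ∀ θ, (φ θ : V) = L θ := fun θ => rfl
  have hmp : MeasurePreserving φ (volume : Measure V).toSphere (volume : Measure V).toSphere := by
    refine ⟨φ.continuous.measurable, ?_⟩
    ext s hs
    rw [map_apply φ.continuous.measurable hs, toSphere_apply' _ hs,
      toSphere_apply' _ (φ.continuous.measurable hs)]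
    have hset : Set.Ioo (0 : ℝ) 1 • (((↑) : sphere (0 : V) 1 → V) '' (φ ⁻¹' s)) =
        L ⁻¹' (Set.Ioo (0 : ℝ) 1 • (((↑) : sphere (0 : V) 1 → V) '' s)) := by
      ext x
      constructor
      · rintro ⟨t, ht, _, ⟨θ, hθ, rfl⟩, rfl⟩
        exact ⟨t, ht, _, ⟨φ θ, hθ, rfl⟩, by simp [hφL]⟩
      · rintro ⟨t, ht, _, ⟨θ, hθ, rfl⟩, h⟩
        refine ⟨t, ht, _, ⟨φ.symm θ, by simpa using hθ, rfl⟩, ?_⟩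
        apply L.injective
        rw [← h]
        simp only [map_smul, ← hφL, Homeomorph.apply_symm_apply]
    rw [hset]
    congr 1
    exact L.measurePreserving.measure_preimage_emb
      L.toHomeomorph.toMeasurableEquiv.measurableEmbedding _
  exact hmp.integral_comp φ.measurableEmbedding fun θ => F θ

/-- Differentiation under the integral sign over a compact space. -/
lemma hasDerivAt_integral_of_compactSpace {S : Type*} [TopologicalSpace S] [CompactSpace S]
    [MeasurableSpace S] [OpensMeasurableSpace S] (σ : Measure S) [IsFiniteMeasure σ]
    {Φ Φ' : ℝ → S → ℝ} {a b t₀ : ℝ} (ht₀ : t₀ ∈ Set.Ioo a b)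
    (hΦ : ∀ t ∈ Set.Icc a b, ∀ θ, HasDerivAt (fun t => Φ t θ) (Φ' t θ) t)
    (hc : ∀ t ∈ Set.Icc a b, Continuous (Φ t))
    (hc' : ContinuousOn (fun p : ℝ × S => Φ' p.1 p.2) (Set.Icc a b ×ˢ Set.univ)) :
    HasDerivAt (fun t => ∫ θ, Φ t θ ∂σ) (∫ θ, Φ' t₀ θ ∂σ) t₀ := by
  have hint : ∀ {f : S → ℝ}, Continuous f → Integrable f σ := fun hf =>
    hf.integrable_of_hasCompactSupport (HasCompactSupport.of_compactSpace _)
  obtain ⟨C, hC⟩ := (isCompact_Icc.prod isCompact_univ).exists_bound_of_continuousOn hc'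
  have hΦ'c : Continuous (Φ' t₀) :=
    (hc'.comp_continuous (f := fun θ => (t₀, θ)) (by fun_prop)
      fun θ => ⟨Set.Ioo_subset_Icc_self ht₀, trivial⟩)
  refine (hasDerivAt_integral_of_dominated_loc_of_deriv_le (bound := fun _ => C)
    (Icc_mem_nhds ht₀.1 ht₀.2) ?_ (hint (hc t₀ (Set.Ioo_subset_Icc_self ht₀)))
    (hint hΦ'c).aestronglyMeasurable ?_ (integrable_const C) ?_).2
  · filter_upwards [Icc_mem_nhds ht₀.1 ht₀.2] with t ht
    exact (hint (hc t ht)).aestronglyMeasurable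
  · exact Eventually.of_forall fun θ t ht => hC (t, θ) ⟨ht, trivial⟩
  · exact Eventually.of_forall fun θ t ht => hΦ t ht θ

variable {n : ℕ}

local notation "E" => EuclideanSpace ℝ (Fin n)

lemma integrable_sphere {f : sphere (0 : E) 1 → ℝ} (hf : Continuous f) :
    Integrable f (volume : Measure E).toSphere :=
  hf.integrable_of_hasCompactSupport (HasCompactSupport.of_compactSpace _)

lemma coord_mem_Icc (θ : sphere (0 : E) 1) (i : Fin n) : (θ : E) i ∈ Set.Icc (-1 : ℝ) 1 := by
  have h := PiLp.norm_apply_le (θ : E) i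
  rw [show ‖(θ : E)‖ = 1 by simp, Real.norm_eq_abs] at h
  exact abs_le.1 h

/-- The derivative of the integral of `h(x_i) x_j` along the reflections in the hyperplanes
orthogonal to `cos t e_j + sin t e_i` vanishes. -/
lemma integral_sphere_deriv_mul_sq_sub {h h' : ℝ → ℝ}
    (hd : ∀ x ∈ Set.Icc (-1 : ℝ) 1, HasDerivAt h (h' x) x) (hc : ContinuousOn h' (Set.Icc (-1) 1))
    {i j : Fin n} (hij : i ≠ j) :
    ∫ θ : sphere (0 : E) 1, (h' ((θ : E) i) * (θ : E) j ^ 2 - (θ : E) i * h ((θ : E) i))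
      ∂(volume : Measure E).toSphere = 0 := by
  set ei : E := EuclideanSpace.single i 1 with hei
  set ej : E := EuclideanSpace.single j 1 with hej
  set W : ℝ → E := fun t => Real.cos t • ej + Real.sin t • ei with hW
  have hWn : ∀ t, ‖W t‖ = 1 := by
    intro t
    have : ‖W t‖ ^ 2 = 1 := by
      rw [← real_inner_self_eq_norm_sq, hW]
      simp only [inner_add_left, inner_add_right, inner_smul_left, inner_smul_right, hei, hej,
        EuclideanSpace.inner_single_left]
      simp [hij, hij.symm]
      linarith [Real.sin_sq_add_cos_sq t]
    nlinarith [norm_nonneg (W t)]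
  set R : ℝ → E ≃ₗᵢ[ℝ] E := fun t => (ℝ ∙ W t)ᗮ.reflection with hR
  -- `b t θ = ⟪W t, θ⟫`
  set b : ℝ → sphere (0 : E) 1 → ℝ := fun t θ =>
    Real.cos t * (θ : E) j + Real.sin t * (θ : E) i with hb
  have hRx : ∀ t (θ : sphere (0 : E) 1), R t θ = (θ : E) - (2 * b t θ) • W t := by
    intro t θ
    rw [hR]
    simp only [Submodule.reflection_orthogonal_apply, Submodule.reflection_singleton_apply, hWn]
    have : ⟪W t, (θ : E)⟫ = b t θ := by
      simp only [hW, hb, inner_add_left, inner_smul_left, hei, hej, EuclideanSpace.inner_single_left]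
      simp
    rw [this]
    simp only [RCLike.ofReal_real_eq_id, id, one_pow, div_one, two_smul, two_mul, add_smul]
    abel
  have hRi : ∀ t (θ : sphere (0 : E) 1), R t θ i = (θ : E) i - 2 * b t θ * Real.sin t := by
    intro t θ; rw [hRx]; simp [hW, hei, hej, hij]
  have hRj : ∀ t (θ : sphere (0 : E) 1), R t θ j = (θ : E) j - 2 * b t θ * Real.cos t := by
    intro t θ; rw [hRx]; simp [hW, hei, hej, hij.symm]
  have hRmem : ∀ t (θ : sphere (0 : E) 1), (θ : E) i - 2 * b t θ * Real.sin t ∈ Set.Icc (-1 : ℝ) 1 := by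
    intro t θ
    rw [← hRi]
    exact coord_mem_Icc ⟨R t θ, by simp⟩ i
  set b' : ℝ → sphere (0 : E) 1 → ℝ := fun t θ =>
    -Real.sin t * (θ : E) j + Real.cos t * (θ : E) i with hb'
  have hbd : ∀ t θ, HasDerivAt (fun t => b t θ) (b' t θ) t := fun t θ =>
    ((Real.hasDerivAt_cos t).mul_const _).add ((Real.hasDerivAt_sin t).mul_const _)
  set A : ℝ → sphere (0 : E) 1 → ℝ := fun t θ => (θ : E) i - 2 * b t θ * Real.sin t with hA
  set B : ℝ → sphere (0 : E) 1 → ℝ := fun t θ => (θ : E) j - 2 * b t θ * Real.cos t with hB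
  set A' : ℝ → sphere (0 : E) 1 → ℝ := fun t θ =>
    -(2 * b' t θ * Real.sin t + 2 * b t θ * Real.cos t) with hA'
  set B' : ℝ → sphere (0 : E) 1 → ℝ := fun t θ =>
    -(2 * b' t θ * Real.cos t + 2 * b t θ * -Real.sin t) with hB'
  have hAd : ∀ t θ, HasDerivAt (fun t => A t θ) (A' t θ) t := fun t θ =>
    (((hbd t θ).const_mul 2).mul (Real.hasDerivAt_sin t)).const_sub _
  have hBd : ∀ t θ, HasDerivAt (fun t => B t θ) (B' t θ) t := fun t θ =>
    (((hbd t θ).const_mul 2).mul (Real.hasDerivAt_cos t)).const_sub _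
  have hhc : ContinuousOn h (Set.Icc (-1) 1) := fun x hx => (hd x hx).continuousAt.continuousWithinAt
  have hcomp : ∀ {f : ℝ → ℝ}, ContinuousOn f (Set.Icc (-1) 1) →
      Continuous fun p : ℝ × sphere (0 : E) 1 => f (A p.1 p.2) := fun hf =>
    hf.comp_continuous (by fun_prop) fun p => hRmem p.1 p.2
  have hmain := hasDerivAt_integral_of_compactSpace (volume : Measure E).toSphere
    (Φ := fun t θ => h (A t θ) * B t θ)
    (Φ' := fun t θ => h' (A t θ) * A' t θ * B t θ + h (A t θ) * B' t θ)
    (a := -1) (b := 1) (t₀ := 0) (by norm_num)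
    (fun t _ θ => ((hd _ (hRmem t θ)).comp t (hAd t θ)).mul (hBd t θ))
    (fun t _ => ((hcomp hhc).comp (by fun_prop : Continuous fun θ : sphere (0 : E) 1 => (t, θ))).mul
      (by fun_prop))
    (by
      have h1 := hcomp hhc
      have h2 := hcomp hc
      have c1 : Continuous fun p : ℝ × sphere (0 : E) 1 => A' p.1 p.2 := by
        simp only [hA', hb, hb']; fun_prop
      have c2 : Continuous fun p : ℝ × sphere (0 : E) 1 => B p.1 p.2 := by
        simp only [hB, hb]; fun_prop
      have c3 : Continuous fun p : ℝ × sphere (0 : E) 1 => B' p.1 p.2 := by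
        simp only [hB', hb, hb']; fun_prop
      exact (((h2.mul c1).mul c2).add (h1.mul c3)).continuousOn)
  have hconst : (fun t => ∫ θ : sphere (0 : E) 1, h (A t θ) * B t θ ∂(volume : Measure E).toSphere) =
      fun _ => ∫ θ : sphere (0 : E) 1, h ((θ : E) i) * (θ : E) j ∂(volume : Measure E).toSphere := by
    funext t
    rw [← integral_sphere_comp_isometry (R t) fun x => h (x i) * x j]
    simp only [hRi, hRj, hA, hB]
  rw [hconst] at hmain
  have h0 := hmain.unique (hasDerivAt_const _ _)
  have h2 : ∫ θ : sphere (0 : E) 1, (h' (A 0 θ) * A' 0 θ * B 0 θ + h (A 0 θ) * B' 0 θ)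
      ∂(volume : Measure E).toSphere = 2 * ∫ θ : sphere (0 : E) 1,
        (h' ((θ : E) i) * (θ : E) j ^ 2 - (θ : E) i * h ((θ : E) i)) ∂(volume : Measure E).toSphere := by
    rw [← integral_const_mul]
    congr 1 with θ
    simp only [hA, hB, hA', hB', hb, hb', Real.cos_zero, Real.sin_zero]
    ring_nf
  rw [h2] at h0
  linarith

/-- The divergence theorem on the sphere for the tangential gradient of a function of one
coordinate. -/
lemma integral_sphere_zonal_divergence {h h' : ℝ → ℝ}
    (hd : ∀ x ∈ Set.Icc (-1 : ℝ) 1, HasDerivAt h (h' x) x) (hc : ContinuousOn h' (Set.Icc (-1) 1))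
    (i : Fin n) :
    ∫ θ : sphere (0 : E) 1, (h' ((θ : E) i) * (1 - (θ : E) i ^ 2) -
      ((n : ℝ) - 1) * (θ : E) i * h ((θ : E) i)) ∂(volume : Measure E).toSphere = 0 := by
  have hhc : ContinuousOn h (Set.Icc (-1) 1) := fun x hx => (hd x hx).continuousAt.continuousWithinAt
  have hcomp : ∀ {f : ℝ → ℝ}, ContinuousOn f (Set.Icc (-1) 1) →
      Continuous fun θ : sphere (0 : E) 1 => f ((θ : E) i) := fun hf =>
    hf.comp_continuous (by fun_prop) fun θ => coord_mem_Icc θ i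
  have h1 := hcomp hhc
  have h2 := hcomp hc
  have hsum : ∑ j ∈ Finset.univ.erase i, ∫ θ : sphere (0 : E) 1,
      (h' ((θ : E) i) * (θ : E) j ^ 2 - (θ : E) i * h ((θ : E) i))
        ∂(volume : Measure E).toSphere = 0 :=
    Finset.sum_eq_zero fun j hj =>
      integral_sphere_deriv_mul_sq_sub hd hc (Finset.ne_of_mem_erase hj).symm
  have hint : ∀ j ∈ Finset.univ.erase i, Integrable (fun θ : sphere (0 : E) 1 =>
      h' ((θ : E) i) * (θ : E) j ^ 2 - (θ : E) i * h ((θ : E) i)) (volume : Measure E).toSphere :=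
    fun j _ => integrable_sphere ((h2.mul (by fun_prop)).sub (Continuous.mul (by fun_prop) h1))
  rw [← integral_finsetSum _ hint] at hsum
  rw [← hsum]
  congr 1 with θ
  have hnorm : ∑ j ∈ Finset.univ.erase i, (θ : E) j ^ 2 = 1 - (θ : E) i ^ 2 := by
    have h3 : ∑ j, (θ : E) j ^ 2 = 1 := by
      rw [← EuclideanSpace.real_norm_sq_eq]; simp
    have h4 := Finset.sum_erase_add _ (fun j => (θ : E) j ^ 2) (Finset.mem_univ i)
    linarith
  rw [Finset.sum_sub_distrib, ← Finset.mul_sum, hnorm, Finset.sum_const,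
    Finset.card_erase_of_mem (Finset.mem_univ i), Finset.card_univ, Fintype.card_fin, nsmul_eq_mul,
    Nat.cast_sub (Fin.pos i)]
  push_cast
  ring

end SphereIntegrals

/-! ### Moments, the mean value property and polar coordinates -/

section SphereMoments
open Module Measure Filter Topology Metric
open scoped RealInnerProductSpace

variable {n : ℕ}

local notation "E" => EuclideanSpace ℝ (Fin n)

local notation "σ" => Measure.toSphere (volume : Measure E)

/-- The moments of the sphere up to order four: `x_i` and `x_i³` average to `0`, `x_i²` to `1 / n` and
`x_i⁴` to `3 / (n (n + 2))`. -/
lemma integral_sphere_quartic (hn : 2 ≤ n) (i : Fin n) (c₀ c₁ c₂ c₃ c₄ : ℝ) :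
    ∫ θ : sphere (0 : E) 1, (c₀ + c₁ * (θ : E) i + c₂ * (θ : E) i ^ 2 + c₃ * (θ : E) i ^ 3 +
      c₄ * (θ : E) i ^ 4) ∂σ =
      (Measure.real σ Set.univ) * (c₀ + c₂ / n + c₄ * (3 / (n * (n + 2)))) := by
  have hn' : (2 : ℝ) ≤ n := by exact_mod_cast hn
  -- the divergence identity for `h(x) = x ^ k`; at `k = 0` the right hand side vanishes
  have key : ∀ k : ℕ, ((k : ℝ) + n - 1) * ∫ θ : sphere (0 : E) 1, (θ : E) i ^ (k + 1) ∂σ =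
      k * ∫ θ : sphere (0 : E) 1, (θ : E) i ^ (k - 1) ∂σ := by
    intro k
    have h := integral_sphere_zonal_divergence (n := n) (h := fun x => x ^ k)
      (h' := fun x => k * x ^ (k - 1)) (fun x _ => hasDerivAt_pow k x) (by fun_prop) i
    have e : ∀ θ : sphere (0 : E) 1, (k * (θ : E) i ^ (k - 1) * (1 - (θ : E) i ^ 2) -
        ((n : ℝ) - 1) * (θ : E) i * (θ : E) i ^ k) =
        k * (θ : E) i ^ (k - 1) - (k + n - 1) * (θ : E) i ^ (k + 1) := by
      intro θ
      rcases k with _ | k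
      · simp
      · simp; ring
    simp only [e] at h
    rw [integral_sub (integrable_sphere (by fun_prop)) (integrable_sphere (by fun_prop)),
      integral_const_mul, integral_const_mul] at h
    linarith
  have m0 : ∫ _θ : sphere (0 : E) 1, (1 : ℝ) ∂σ = Measure.real σ Set.univ := by simp
  have m1 : ∫ θ : sphere (0 : E) 1, (θ : E) i ∂σ = 0 := by
    have := key 0
    simp only [CharP.cast_eq_zero, zero_add, zero_mul, pow_one, mul_eq_zero] at this
    exact this.resolve_left (by linarith)
  have m2 := key 1
  have m3 := key 2
  have m4 := key 3
  simp only [Nat.sub_self, pow_zero, m0] at m2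
  norm_num [m1] at m3 m4
  have m3' := m3.resolve_left (by linarith)
  have m2' : ∫ θ : sphere (0 : E) 1, (θ : E) i ^ 2 ∂σ = Measure.real σ Set.univ / n := by
    rw [eq_div_iff (by linarith)]; push_cast at m2; linarith
  have m4' : ∫ θ : sphere (0 : E) 1, (θ : E) i ^ 4 ∂σ =
      Measure.real σ Set.univ * (3 / (n * (n + 2))) := by
    rw [m2'] at m4
    field_simp
    field_simp at m4
    linarith
  rw [integral_add (integrable_sphere (by fun_prop)) (integrable_sphere (by fun_prop)),
    integral_add (integrable_sphere (by fun_prop)) (integrable_sphere (by fun_prop)),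
    integral_add (integrable_sphere (by fun_prop)) (integrable_sphere (by fun_prop)),
    integral_add (integrable_sphere (by fun_prop)) (integrable_sphere (by fun_prop)),
    integral_const_mul, integral_const_mul, integral_const_mul, integral_const_mul, m1, m2', m3',
    m4']
  simp
  ring

lemma one_add_sq_add_pos {t x : ℝ} (ht : |t| < 1) (hx : x ∈ Set.Icc (-1 : ℝ) 1) :
    0 < 1 + t ^ 2 + 2 * t * x := by
  have h1 : |t * x| ≤ |t| := by
    rw [abs_mul]; exact mul_le_of_le_one_right (abs_nonneg _) (abs_le.2 hx)
  have h2 := (abs_le.1 h1).1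
  have h3 : 0 < (1 - |t|) ^ 2 := by have : 0 < 1 - |t| := by linarith
                                    positivity
  nlinarith [sq_abs t]

/-- The mean value property of the harmonic function `|x| ^ (2 - n)` on the spheres centered at `e`
of radius `|t| < 1`. -/
lemma integral_sphere_rpow_harmonic (hn : 3 ≤ n) (i : Fin n) {p : ℝ} (hp : 2 * p = 2 - n) {t : ℝ}
    (ht : |t| < 1) :
    ∫ θ : sphere (0 : E) 1, (1 + t ^ 2 + 2 * t * (θ : E) i) ^ p ∂σ = Measure.real σ Set.univ := by
  set Q : ℝ → sphere (0 : E) 1 → ℝ := fun t θ => 1 + t ^ 2 + 2 * t * (θ : E) i with hQ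
  have hQpos : ∀ t, |t| < 1 → ∀ θ, 0 < Q t θ := fun t ht θ => one_add_sq_add_pos ht (coord_mem_Icc θ i)
  have hQc : Continuous fun x : ℝ × sphere (0 : E) 1 => Q x.1 x.2 := by
    simp only [hQ]; fun_prop
  have hQt : ∀ t, Continuous (Q t) := fun t => by simp only [hQ]; fun_prop
  have hQd : ∀ t θ, HasDerivAt (fun t => Q t θ) (2 * (t + (θ : E) i)) t := by
    intro t θ
    have := (((hasDerivAt_id t).pow 2).const_add 1).add
      (((hasDerivAt_id t).const_mul 2).mul_const ((θ : E) i))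
    refine this.congr_deriv ?_
    simp; ring
  have hQr : ∀ (r : ℝ) t, |t| < 1 → ∀ θ, HasDerivAt (fun t => Q t θ ^ r)
      (r * Q t θ ^ (r - 1) * (2 * (t + (θ : E) i))) t := by
    intro r t ht θ
    refine ((hQd t θ).rpow_const (Or.inl (hQpos t ht θ).ne')).congr_deriv ?_
    ring
  have hQrc : ∀ (r : ℝ) {b : ℝ}, b < 1 → ContinuousOn (fun x : ℝ × sphere (0 : E) 1 => Q x.1 x.2 ^ r)
      (Set.Icc (-b) b ×ˢ Set.univ) := fun r b hb =>
    hQc.continuousOn.rpow_const fun x hx =>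
      Or.inl (hQpos _ ((abs_le.2 hx.1).trans_lt hb) _).ne'
  have hQrt : ∀ (r t : ℝ), |t| < 1 → Continuous fun θ => Q t θ ^ r := fun r t ht =>
    (hQt t).rpow_const fun θ => Or.inl (hQpos t ht θ).ne'
  -- a multiple of the flux of the gradient through the sphere of radius `t`
  set N : ℝ → ℝ := fun t => ∫ θ, t ^ (n - 1) * (Q t θ ^ (p - 1) * (t + (θ : E) i)) ∂σ with hN
  have hNd : ∀ t ∈ Set.Ioo (-1 : ℝ) 1, HasDerivAt N 0 t := by
    intro t ht
    obtain ⟨b, hb1, hb2⟩ := exists_between (abs_lt.2 ht)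
    have hlt : ∀ s ∈ Set.Icc (-b) b, |s| < 1 := fun s hs => (abs_le.2 hs).trans_lt hb2
    have h := hasDerivAt_integral_of_compactSpace σ (a := -b) (b := b) (t₀ := t)
      (Φ := fun t θ => t ^ (n - 1) * (Q t θ ^ (p - 1) * (t + (θ : E) i)))
      (Φ' := fun t θ => ((n - 1 : ℕ) : ℝ) * t ^ (n - 1 - 1) * (Q t θ ^ (p - 1) * (t + (θ : E) i)) +
        t ^ (n - 1) * ((p - 1) * Q t θ ^ (p - 1 - 1) * (2 * (t + (θ : E) i)) * (t + (θ : E) i) +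
          Q t θ ^ (p - 1) * 1)) (abs_lt.1 hb1)
      (fun s hs θ => (hasDerivAt_pow (n - 1) s).mul
        ((hQr _ s (hlt s hs) θ).mul ((hasDerivAt_id s).add_const _)))
      (fun s hs => continuous_const.mul ((hQrt _ s (hlt s hs)).mul (by fun_prop)))
      (by
        have c1 := hQrc (p - 1) hb2
        have c2 := hQrc (p - 1 - 1) hb2
        fun_prop)
    refine h.congr_deriv ?_
    have habs := abs_lt.2 ht
    have hdiv := integral_sphere_zonal_divergence (n := n) (h := fun x => (1 + t ^ 2 + 2 * t * x) ^ (p - 1))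
      (h' := fun x => 2 * t * (p - 1) * (1 + t ^ 2 + 2 * t * x) ^ (p - 1 - 1))
      (fun x hx => by
        have := (((hasDerivAt_id x).const_mul (2 * t)).const_add (1 + t ^ 2)).rpow_const
          (p := p - 1) (Or.inl (one_add_sq_add_pos habs hx).ne')
        refine this.congr_deriv ?_
        simp)
      (by
        refine ContinuousOn.mul (by fun_prop) (ContinuousOn.rpow_const (by fun_prop) fun x hx =>
          Or.inl (one_add_sq_add_pos habs hx).ne')) i
    have hfin : ∀ θ : sphere (0 : E) 1,
        ((n - 1 : ℕ) : ℝ) * t ^ (n - 1 - 1) * (Q t θ ^ (p - 1) * (t + (θ : E) i)) +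
        t ^ (n - 1) * ((p - 1) * Q t θ ^ (p - 1 - 1) * (2 * (t + (θ : E) i)) * (t + (θ : E) i) +
          Q t θ ^ (p - 1) * 1) = -t ^ (n - 1 - 1) *
          (2 * t * (p - 1) * Q t θ ^ (p - 1 - 1) * (1 - (θ : E) i ^ 2) -
            ((n : ℝ) - 1) * (θ : E) i * Q t θ ^ (p - 1)) := by
      intro θ
      have e1 : Q t θ ^ (p - 1) = Q t θ ^ (p - 1 - 1) * Q t θ := by
        conv_rhs => rw [← Real.rpow_add_one (hQpos t habs θ).ne']
        congr 1; ring
      have e2 : t ^ (n - 1) = t ^ (n - 1 - 1) * t := by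
        rw [← pow_succ]; congr 1; omega
      have e3 : ((n - 1 : ℕ) : ℝ) = n - 1 := by
        rw [Nat.cast_sub (by omega)]; simp
      rw [e1, e2, e3]
      have e4 : p = (2 - n) / 2 := by linarith
      rw [e4]
      generalize Q t θ ^ ((2 - (n : ℝ)) / 2 - 1 - 1) = Z
      simp only [hQ]
      ring
    simp only [hfin]
    rw [integral_const_mul]
    simp only [hQ]
    rw [hdiv, mul_zero]
  have hconv : IsPreconnected (Set.Ioo (-1 : ℝ) 1) := isPreconnected_Ioo
  have hzero : ∀ t ∈ Set.Ioo (-1 : ℝ) 1, ∫ θ, Q t θ ^ (p - 1) * (t + (θ : E) i) ∂σ = 0 := by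
    intro t ht
    by_cases h0 : t = 0
    · subst h0
      have := integral_sphere_quartic (by omega : 2 ≤ n) i 0 1 0 0 0
      simpa [hQ] using this
    · have h := isOpen_Ioo.is_const_of_deriv_eq_zero hconv
        (fun s hs => (hNd s hs).differentiableAt.differentiableWithinAt)
        (fun s hs => (hNd s hs).deriv) ht (by norm_num : (0 : ℝ) ∈ Set.Ioo (-1 : ℝ) 1)
      simp only [hN, integral_const_mul] at h
      rw [zero_pow (by omega), zero_mul] at h
      exact (mul_eq_zero.1 h).resolve_left (pow_ne_zero _ h0)
  have hMd : ∀ t ∈ Set.Ioo (-1 : ℝ) 1, HasDerivAt (fun t => ∫ θ, Q t θ ^ p ∂σ) 0 t := by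
    intro t ht
    obtain ⟨b, hb1, hb2⟩ := exists_between (abs_lt.2 ht)
    have hlt : ∀ s ∈ Set.Icc (-b) b, |s| < 1 := fun s hs => (abs_le.2 hs).trans_lt hb2
    have h := hasDerivAt_integral_of_compactSpace σ (a := -b) (b := b) (t₀ := t)
      (Φ := fun t θ => Q t θ ^ p)
      (Φ' := fun t θ => p * Q t θ ^ (p - 1) * (2 * (t + (θ : E) i))) (abs_lt.1 hb1)
      (fun s hs θ => hQr _ s (hlt s hs) θ)
      (fun s hs => hQrt _ s (hlt s hs))
      (by
        have c1 := hQrc (p - 1) hb2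
        fun_prop)
    refine h.congr_deriv ?_
    have : ∀ θ : sphere (0 : E) 1, p * Q t θ ^ (p - 1) * (2 * (t + (θ : E) i)) =
        2 * p * (Q t θ ^ (p - 1) * (t + (θ : E) i)) := fun θ => by ring
    simp only [this]
    rw [integral_const_mul, hzero t ht, mul_zero]
  have h := isOpen_Ioo.is_const_of_deriv_eq_zero hconv
    (fun s hs => (hMd s hs).differentiableAt.differentiableWithinAt)
    (fun s hs => (hMd s hs).deriv) (abs_lt.1 ht) (by norm_num : (0 : ℝ) ∈ Set.Ioo (-1 : ℝ) 1)
  rw [h]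
  simp [hQ]

/-- Integration over the unit ball in polar coordinates. -/
lemma integral_closedBall_eq_of_sphere (hn : 1 ≤ n) {F : E → ℝ} {q : ℝ → ℝ}
    (hF : ContinuousOn F (closedBall 0 1))
    (h : ∀ s ∈ Set.Ioo (0 : ℝ) 1, ∫ θ : sphere (0 : E) 1, F (s • (θ : E)) ∂σ = q s) :
    ∫ y in closedBall (0 : E) 1, F y = ∫ s in (0 : ℝ)..1, s ^ (n - 1) * q s := by
  have : Nonempty (Fin n) := ⟨⟨0, hn⟩⟩
  have h1 : ∫ y in closedBall (0 : E) 1, F y = ∫ y in ball (0 : E) 1, F y :=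
    by
    refine setIntegral_congr_set (Filter.EventuallyEq.symm ?_)
    refine ae_eq_of_subset_of_measure_ge ball_subset_closedBall ?_ measurableSet_ball.nullMeasurableSet ?_
    · rw [addHaar_closedBall_eq_addHaar_ball]
    · exact (isCompact_closedBall 0 1).measure_lt_top.ne
  have hint : Integrable ((ball (0 : E) 1).indicator F) := by
    rw [integrable_indicator_iff measurableSet_ball]
    exact (hF.integrableOn_compact (isCompact_closedBall 0 1)).mono_set ball_subset_closedBall
  set G : E → ℝ := (ball (0 : E) 1).indicator F with hG
  have hmp := (volume : Measure E).measurePreserving_homeomorphUnitSphereProd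
  have hemb := (homeomorphUnitSphereProd E).measurableEmbedding
  set H : sphere (0 : E) 1 × Set.Ioi (0 : ℝ) → ℝ := fun x => G (x.2.1 • (x.1 : E)) with hH
  have hHG : ∀ x : ({0}ᶜ : Set E), H (homeomorphUnitSphereProd E x) = G x := by
    intro x
    rw [hH]
    have h0 : ‖(x : E)‖ ≠ 0 := norm_ne_zero_iff.2 x.2
    simp [smul_smul, h0]
  have e1 : ∫ y, G y = ∫ x : ({0}ᶜ : Set E), G x ∂((volume : Measure E).comap (↑)) := by
    rw [integral_subtype_comap (measurableSet_singleton _).compl G, restrict_compl_singleton]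
  have hint' : Integrable H (Measure.prod σ (volumeIoiPow (finrank ℝ E - 1))) := by
    rw [← hmp.integrable_comp_emb hemb]
    have : H ∘ homeomorphUnitSphereProd E = G ∘ ((↑) : ({0}ᶜ : Set E) → E) := funext hHG
    rw [this]
    rw [← integrableOn_iff_comap_subtypeVal (measurableSet_singleton _).compl]
    exact hint.integrableOn
  have e2 : ∫ y, G y = ∫ x, H x ∂(Measure.prod σ (volumeIoiPow (finrank ℝ E - 1))) := by
    rw [e1, ← hmp.integral_comp hemb]
    simp only [hHG]
  have e3 : ∀ s : Set.Ioi (0 : ℝ), ∫ θ : sphere (0 : E) 1, H (θ, s) ∂σ =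
      (Set.Iio (1 : ℝ)).indicator q s := by
    intro s
    have hs0 : (0 : ℝ) < s := s.2
    have : ∀ θ : sphere (0 : E) 1, s.1 • (θ : E) ∈ ball (0 : E) 1 ↔ (s : ℝ) ∈ Set.Iio (1 : ℝ) := by
      intro θ
      simp [norm_smul, abs_of_pos hs0]
    by_cases hs : (s : ℝ) ∈ Set.Iio (1 : ℝ)
    · rw [Set.indicator_of_mem hs, ← h s ⟨hs0, hs⟩]
      congr 1 with θ
      exact Set.indicator_of_mem ((this θ).2 hs) F
    · rw [Set.indicator_of_notMem hs]
      have : ∀ θ : sphere (0 : E) 1, H (θ, s) = 0 := fun θ =>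
        Set.indicator_of_notMem (fun h' => hs ((this θ).1 h')) F
      simp [this]
  rw [h1, ← integral_indicator measurableSet_ball, ← hG, e2, integral_prod_symm _ hint']
  simp only [e3]
  simp only [volumeIoiPow, ENNReal.ofReal]
  rw [integral_withDensity_eq_integral_smul (measurable_subtype_coe.pow_const _).real_toNNReal,
    integral_subtype_comap measurableSet_Ioi fun s : ℝ =>
      Real.toNNReal (s ^ (finrank ℝ E - 1)) • (Set.Iio (1 : ℝ)).indicator q s,
    intervalIntegral.integral_of_le zero_le_one, integral_Ioc_eq_integral_Ioo,
    ← integral_indicator measurableSet_Ioi, ← integral_indicator measurableSet_Ioo]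
  congr 1 with s
  by_cases h0 : s ∈ Set.Ioi (0 : ℝ)
  · rw [Set.indicator_of_mem h0, NNReal.smul_def, Real.coe_toNNReal _ (pow_nonneg h0.out.le _)]
    by_cases hs : s ∈ Set.Iio (1 : ℝ)
    · rw [Set.indicator_of_mem hs, Set.indicator_of_mem (show s ∈ Set.Ioo 0 1 from ⟨h0, hs⟩)]
      simp
    · rw [Set.indicator_of_notMem hs, Set.indicator_of_notMem fun h' : s ∈ Set.Ioo 0 1 => hs h'.2,
        smul_zero]
  · rw [Set.indicator_of_notMem h0, Set.indicator_of_notMem fun h' : s ∈ Set.Ioo 0 1 => h0 h'.1]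

end SphereMoments

/-! ### Averages over the sphere and the ball, and the isoperimetric deficit -/

namespace ShapeExpansion
open Filter Topology Asymptotics

/-- The average of `areaMain` with exponent `q` over the unit sphere of `ℝ^N`. -/
def areaPoly (N s q : ℝ) (x : Param) : ℝ :=
  1 + τ s x * ((N - 1) / N) + τ s x ^ 2 * ((N - 1) / (2 * N * (N + 2))) +
    μ x * δ x ^ 2 * τ s x * (q * (N - 2) * (N ^ 2 - 1) / (N * (N + 2))) +
    q * (q - 1) / 2 * (μ x ^ 2 * δ x ^ 2 * ((N - 2) ^ 2 / N) +
      μ x ^ 2 * δ x ^ 4 * ((N - 2) ^ 2 * (N - 1) / (2 * (N + 2))))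

/-- The average of `mainPart` with exponent `q` over the unit ball of `ℝ^N`. -/
def volPoly (N s q : ℝ) (x : Param) : ℝ :=
  1 + μ x * δ x ^ 2 * τ s x * (q * (N - 2) * (N - 1) / (N + 2)) +
    q * (q - 1) / 2 * (μ x ^ 2 * δ x ^ 2 * ((N - 2) ^ 2 / (N + 2)) +
      μ x ^ 2 * δ x ^ 4 * ((N - 2) ^ 2 * (N * (N - 1)) / (2 * (N + 2) * (N + 4))))

/-- The coefficient `s` for which the stretching `τ = -s μ δ²` minimizes the leading term of the
isoperimetric deficit. -/
def optimalStretch (N : ℝ) : ℝ := N * (N - 1) / (N + 1)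

/-- `(volPoly - 1) / (μ² δ²)`, without the division. -/
def volCoeff (N s q : ℝ) (x : Param) : ℝ :=
  δ x ^ 2 * -s * (q * (N - 2) * (N - 1) / (N + 2)) +
    q * (q - 1) / 2 * (((N - 2) ^ 2 / (N + 2)) +
      δ x ^ 2 * ((N - 2) ^ 2 * (N * (N - 1)) / (2 * (N + 2) * (N + 4))))

@[fun_prop] lemma continuous_volCoeff (N s q : ℝ) : Continuous (volCoeff N s q) := by
  unfold volCoeff; fun_prop

lemma volPoly_eq (N s q : ℝ) (x : Param) :
    volPoly N s q x = 1 + μ x ^ 2 * δ x ^ 2 * volCoeff N s q x := by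
  simp only [volPoly, volCoeff, τ]; ring

/-- The leading terms of the area and of the power of the volume agree up to the gain obtained by
completing the square in `τ`. -/
lemma areaPoly_eq {N : ℝ} (hN : 3 ≤ N) (x : Param) :
    areaPoly N (optimalStretch N) (2 * (N - 1) / (N - 2)) x =
      1 + (N - 1) / N * τ (optimalStretch N) x +
      (N - 1) / N * (μ x ^ 2 * δ x ^ 2 * volCoeff N (optimalStretch N) (2 * N / (N - 2)) x) +
      (N - 1) / N * ((N - 1) / N - 1) / 2 * τ (optimalStretch N) x ^ 2 -
      2 * (N - 1) ^ 2 * (N - 2) / ((N + 1) * (N + 2) * (N + 4)) * (μ x ^ 2 * δ x ^ 4) := by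
  simp only [areaPoly, volCoeff, optimalStretch, τ]
  generalize μ x = m
  generalize δ x = d
  have h0 : N - 2 ≠ 0 := by linarith
  have h1 : N ≠ 0 := by linarith
  have h2 : N + 1 ≠ 0 := by linarith
  have h3 : N + 2 ≠ 0 := by linarith
  have h4 : N + 4 ≠ 0 := by linarith
  field_simp
  ring

lemma areaPoly_sub_rpow_isBigO {N : ℝ} (hN : 3 ≤ N) (C : ℝ) :
    (fun x => areaPoly N (optimalStretch N) (2 * (N - 1) / (N - 2)) x + C * gauge x -
      ((1 + τ (optimalStretch N) x) *
        (volPoly N (optimalStretch N) (2 * N / (N - 2)) x - C * gauge x)) ^ ((N - 1) / N) +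
      2 * (N - 1) ^ 2 * (N - 2) / ((N + 1) * (N + 2) * (N + 4)) * (μ x ^ 2 * δ x ^ 4))
      =O[small] gauge := by
  set s := optimalStretch N with hs
  set b := 2 * N / (N - 2) with hb
  set γ := (N - 1) / N with hγ
  -- `volPoly - 1` and the relative change of volume, as multiples of small quantities
  set P : Param → ℝ := volCoeff N s b with hP
  have hPc : Continuous P := continuous_volCoeff N s b
  have hvol : ∀ x, volPoly N s b x = 1 + μ x ^ 2 * δ x ^ 2 * P x := volPoly_eq N s b
  set Z : Param → ℝ := fun x => (1 + τ s x) * (P x - C * ((μ x + δ x) * δ x ^ 2))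
    with hZ
  have hZc : Continuous Z := by simp only [hZ]; fun_prop
  set Ω : Param → ℝ := fun x => τ s x + μ x ^ 2 * δ x ^ 2 * Z x with hΩ
  have hΩ' : ∀ x, (1 + τ s x) * (volPoly N s b x - C * gauge x) = 1 + Ω x := by
    intro x; rw [hvol]; simp only [hΩ, hZ, gauge]; ring
  have hΩO : Ω =O[small] fun x => μ x * δ x ^ 2 :=
    isBigO_of_eq_mul (F := fun x => -s + μ x * Z x) (by fun_prop)
      fun x => by simp only [hΩ, τ]; ring
  have hΩ0 : Tendsto Ω small (𝓝 0) :=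
    hΩO.trans_tendsto (by simpa using tendsto_μ.mul (tendsto_δ.pow 2))
  have e1 := ((one_add_rpow_sub_quadratic_isBigO γ).comp_tendsto hΩ0).trans (hΩO.pow 3)
  have e1' : (fun x => (μ x * δ x ^ 2) ^ 3) =O[small] gauge :=
    (isBigO_of_eq_mul (g := fun x => μ x ^ 3 * δ x ^ 4) (F := fun x => δ x ^ 2) (by fun_prop)
      fun x => by ring).trans isBigO_gauge_of_mass
  have e2 : (fun x => C * gauge x) =O[small] gauge := (isBigO_refl _ _).const_mul_left C
  have e3 : (fun x => γ * ((1 + τ s x) * C) * gauge x) =O[small] gauge :=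
    isBigO_of_eq_mul (F := fun x => γ * ((1 + τ s x) * C)) (by fun_prop) fun x => by ring
  have e4 : (fun x => -γ * (τ s x * (μ x ^ 2 * δ x ^ 2 * P x)) -
      γ * (γ - 1) / 2 * (μ x ^ 2 * δ x ^ 2 * Z x * (2 * τ s x + μ x ^ 2 * δ x ^ 2 * Z x)))
      =O[small] gauge :=
    (isBigO_of_eq_mul (g := fun x => μ x ^ 3 * δ x ^ 4) (F := fun x => γ * s * P x -
      γ * (γ - 1) / 2 * (Z x * (2 * -s + μ x * Z x))) (by fun_prop)
      fun x => by simp only [τ]; ring).trans isBigO_gauge_of_mass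
  refine ((((e1.trans e1').neg_left.add e2).add e3).add e4).congr_left fun x => ?_
  rw [hΩ' x]
  rw [areaPoly_eq hN]
  simp only [Function.comp_apply, hΩ, hZ, gauge]
  ring

/-- Up to errors of the size of the gauge, the stretched balls beat the Euclidean isoperimetric
ratio. -/
lemma exists_isoperimetric_gain {N : ℝ} (hN : 3 ≤ N) (C : ℝ) :
    ∃ η > 0, ∀ m ∈ Set.Ioo (0 : ℝ) η, ∀ d ∈ Set.Ioo (0 : ℝ) η, ∀ u ∈ Set.Icc (-1 : ℝ) 1,
      ∀ ρ ∈ Set.Icc (0 : ℝ) 1,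
      areaPoly N (optimalStretch N) (2 * (N - 1) / (N - 2)) ((m, d), (u, ρ)) +
          C * ((m + d) * (m ^ 2 * d ^ 4)) <
        ((1 + τ (optimalStretch N) ((m, d), (u, ρ))) *
          (volPoly N (optimalStretch N) (2 * N / (N - 2)) ((m, d), (u, ρ)) -
            C * ((m + d) * (m ^ 2 * d ^ 4)))) ^ ((N - 1) / N) := by
  obtain ⟨C', hC', η, hη, h⟩ := exists_uniform_bound (areaPoly_sub_rpow_isBigO hN C)
  set κ := 2 * (N - 1) ^ 2 * (N - 2) / ((N + 1) * (N + 2) * (N + 4)) with hκ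
  have hκ0 : 0 < κ := by
    have h1 : 0 < N - 1 := by linarith
    have h2 : 0 < N - 2 := by linarith
    positivity
  refine ⟨min η (κ / (2 * C')), by positivity, fun m hm d hd u hu ρ hρ => ?_⟩
  have hb := h m ⟨hm.1, hm.2.trans_le (min_le_left _ _)⟩ d ⟨hd.1, hd.2.trans_le (min_le_left _ _)⟩
    u hu ρ hρ
  have hm2 : m < κ / (2 * C') := hm.2.trans_le (min_le_right _ _)
  have hd2 : d < κ / (2 * C') := hd.2.trans_le (min_le_right _ _)
  have hsum : C' * (m + d) < κ := by
    rw [lt_div_iff₀ (by positivity)] at hm2 hd2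
    linarith
  have hpos : 0 < m ^ 2 * d ^ 4 := mul_pos (pow_pos hm.1 _) (pow_pos hd.1 _)
  have hlt : C' * ((m + d) * (m ^ 2 * d ^ 4)) < κ * (m ^ 2 * d ^ 4) := by
    rw [← mul_assoc]; exact mul_lt_mul_of_pos_right hsum hpos
  have := (abs_le.1 hb).2
  simp only [gauge, μ, δ] at this ⊢
  linarith

/-- For small parameters the lower bound for the volume is positive, and the stretching is mild. -/
lemma exists_volPoly_pos (N s q C : ℝ) :
    ∃ η > 0, ∀ m ∈ Set.Ioo (0 : ℝ) η, ∀ d ∈ Set.Ioo (0 : ℝ) η, ∀ u ∈ Set.Icc (-1 : ℝ) 1,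
      ∀ ρ ∈ Set.Icc (0 : ℝ) 1,
      0 < volPoly N s q ((m, d), (u, ρ)) - C * ((m + d) * (m ^ 2 * d ^ 4)) ∧
        -(1 / 2) < τ s ((m, d), (u, ρ)) := by
  have h1 : (fun x => μ x ^ 2 * δ x ^ 2 * volCoeff N s q x - C * gauge x) =O[small] δ :=
    isBigO_of_eq_mul (F := fun x => μ x ^ 2 * δ x * volCoeff N s q x -
      C * ((μ x + δ x) * (μ x ^ 2 * δ x ^ 3))) (by fun_prop) fun x => by rw [gauge]; ring
  have h2 : τ s =O[small] δ :=
    isBigO_of_eq_mul (F := fun x => -s * (μ x * δ x)) (by fun_prop) fun x => by rw [τ]; ring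
  have h3 := (tendsto_zero_of_isBigO_δ h1).eventually_const_lt (by norm_num : (-1 : ℝ) < 0)
  have h4 := (tendsto_zero_of_isBigO_δ h2).eventually_const_lt (by norm_num : (-(1 / 2) : ℝ) < 0)
  obtain ⟨η, hη, h⟩ := exists_forall_of_eventually_small (h3.and h4)
  refine ⟨η, hη, fun m hm d hd u hu ρ hρ => ⟨?_, (h m hm d hd u hu ρ hρ).2⟩⟩
  have := (h m hm d hd u hu ρ hρ).1
  rw [volPoly_eq]
  simp only [gauge, μ, δ] at this ⊢
  linarith

section Averages
open Metric Measure

variable {n : ℕ}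

local notation "E" => EuclideanSpace ℝ (Fin n)

local notation "σ" => Measure.toSphere (volume : Measure E)

lemma integral_sphere_g (hn : 3 ≤ n) (i : Fin n) {p : ℝ} (hp : 2 * p = 2 - n) {m d t : ℝ}
    (ht : |t * d| < 1) :
    Continuous (fun θ : sphere (0 : E) 1 => g p ((m, d), (t * (θ : E) i, t ^ 2))) ∧
    ∫ θ : sphere (0 : E) 1, g p ((m, d), (t * (θ : E) i, t ^ 2)) ∂σ = 0 := by
  have e : ∀ θ : sphere (0 : E) 1, g p ((m, d), (t * (θ : E) i, t ^ 2)) =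
      (1 + (t * d) ^ 2 + 2 * (t * d) * (θ : E) i) ^ p - 1 := by
    intro θ
    simp only [g, v, u, ρ, δ]
    congr 2
    ring
  have hc : Continuous fun θ : sphere (0 : E) 1 => (1 + (t * d) ^ 2 + 2 * (t * d) * (θ : E) i) ^ p :=
    Continuous.rpow_const (by fun_prop) fun θ =>
      Or.inl (one_add_sq_add_pos ht (coord_mem_Icc θ i)).ne'
  simp only [e]
  refine ⟨hc.sub continuous_const, ?_⟩
  rw [integral_sub (integrable_sphere hc) (integrable_sphere continuous_const),
    integral_sphere_rpow_harmonic hn i hp ht]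
  simp

lemma integral_sphere_mainPart (hn : 3 ≤ n) (i : Fin n) {p : ℝ} (hp : 2 * p = 2 - n) (s q : ℝ)
    {m d t : ℝ} (ht : |t * d| < 1) :
    Continuous (fun θ : sphere (0 : E) 1 => mainPart p s q ((m, d), (t * (θ : E) i, t ^ 2))) ∧
    ∫ θ : sphere (0 : E) 1, mainPart p s q ((m, d), (t * (θ : E) i, t ^ 2)) ∂σ =
      (Measure.real σ Set.univ) * (1 +
        (m * d ^ 2 * (-s * (m * d ^ 2)) * (q * (n - 2) * (n - 1) / n) +
          q * (q - 1) / 2 * (m ^ 2 * d ^ 2 * ((n - 2) ^ 2 / n))) * t ^ 2 +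
        q * (q - 1) / 2 * (m ^ 2 * d ^ 4 * ((n - 2) ^ 2 * (n - 1) / (2 * (n + 2)))) * t ^ 4) := by
  obtain ⟨hgc, hg⟩ := integral_sphere_g (m := m) hn i hp ht
  set T := -s * (m * d ^ 2) with hT
  have e : ∀ θ : sphere (0 : E) 1, mainPart p s q ((m, d), (t * (θ : E) i, t ^ 2)) =
      q * m * g p ((m, d), (t * (θ : E) i, t ^ 2)) +
      ((1 + q * (q - 1) / 2 * (m ^ 2 * (d ^ 4 * (p ^ 2 * t ^ 4)))) +
      (q * (m * (d * T * (2 * p * t))) +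
        q * (q - 1) / 2 * (m ^ 2 * (2 * d ^ 3 * (2 * p ^ 2 * t ^ 3)))) * (θ : E) i +
      (q * (m * (d ^ 2 * T * (2 * p * (2 * p - 1) * t ^ 2))) +
        q * (q - 1) / 2 * (m ^ 2 * (d ^ 2 * (4 * p ^ 2 * t ^ 2) +
          d ^ 4 * (12 * p ^ 2 * (p - 1) * t ^ 4)))) * (θ : E) i ^ 2 +
      (q * (q - 1) / 2 * (m ^ 2 * (2 * d ^ 3 * (4 * p ^ 2 * (p - 1) * t ^ 3))) +
        q * (q - 1) * (q - 2) / 6 * (m ^ 3 * d ^ 3 * (8 * p ^ 3 * t ^ 3))) * (θ : E) i ^ 3 +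
      (q * (q - 1) / 2 * (m ^ 2 * (d ^ 4 * (4 * p ^ 2 * (p - 1) ^ 2 +
        16 / 3 * (p ^ 2 * (p - 1) * (p - 2))) * t ^ 4))) * (θ : E) i ^ 4) := by
    intro θ
    simp only [mainPart, f₁, f₂, f₃, τ, μ, δ, u, ρ, hT]
    ring
  simp only [e]
  refine ⟨by fun_prop, ?_⟩
  rw [integral_add (integrable_sphere (by fun_prop)) (integrable_sphere (by fun_prop)),
    integral_const_mul, hg, mul_zero, zero_add, integral_sphere_quartic (by omega)]
  congr 1
  have hp' : p = (2 - n) / 2 := by linarith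
  have h3 : (3 : ℝ) ≤ n := by exact_mod_cast hn
  have h1 : (n : ℝ) ≠ 0 := by linarith
  have h2 : (n : ℝ) + 2 ≠ 0 := by linarith
  rw [hp', hT]
  field_simp
  ring

lemma integral_sphere_areaMain (hn : 3 ≤ n) (i : Fin n) {p : ℝ} (hp : 2 * p = 2 - n) (s q : ℝ)
    {m d : ℝ} (hd : |d| < 1) (x : ℝ × ℝ) :
    Continuous (fun θ : sphere (0 : E) 1 => areaMain p s q ((m, d), ((θ : E) i, 1))) ∧
    ∫ θ : sphere (0 : E) 1, areaMain p s q ((m, d), ((θ : E) i, 1)) ∂σ =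
      (Measure.real σ Set.univ) * areaPoly n s q ((m, d), x) := by
  obtain ⟨hmc, hm⟩ := integral_sphere_mainPart (m := m) (d := d) (t := 1) hn i hp s q (by simpa using hd)
  simp only [one_mul, one_pow] at hmc hm
  set T := -s * (m * d ^ 2) with hT
  have e : ∀ θ : sphere (0 : E) 1, areaMain p s q ((m, d), ((θ : E) i, 1)) =
      mainPart p s q ((m, d), ((θ : E) i, 1)) +
      ((T + q * m * d ^ 2 * p * T) + (q * m * d * (2 * p) * T) * (θ : E) i +
      (-T + T ^ 2 / 2 + q * m * d ^ 2 * (2 * p * (p - 1) - p) * T) * (θ : E) i ^ 2 +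
      (-(q * m * d * (2 * p) * T)) * (θ : E) i ^ 3 +
      (-(T ^ 2 / 2) - q * m * d ^ 2 * (2 * p * (p - 1)) * T) * (θ : E) i ^ 4) := by
    intro θ
    simp only [areaMain, weightMain, f₁, f₂, τ, μ, δ, u, ρ, hT]
    ring
  simp only [e]
  refine ⟨by fun_prop, ?_⟩
  rw [integral_add (integrable_sphere (by fun_prop)) (integrable_sphere (by fun_prop)), hm,
    integral_sphere_quartic (by omega), ← mul_add]
  congr 1
  have hp' : p = (2 - n) / 2 := by linarith
  have h3 : (3 : ℝ) ≤ n := by exact_mod_cast hn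
  have h1 : (n : ℝ) ≠ 0 := by linarith
  have h2 : (n : ℝ) + 2 ≠ 0 := by linarith
  simp only [areaPoly, τ, μ, δ]
  rw [← hT, hp']
  field_simp
  ring

lemma integral_ball_mainPart (hn : 3 ≤ n) (i : Fin n) {p : ℝ} (hp : 2 * p = 2 - n) (s q : ℝ)
    {m d : ℝ} (hd0 : 0 < d) (hd : d < 1 / 2) (x : ℝ × ℝ) :
    ContinuousOn (fun y : E => mainPart p s q ((m, d), (y i, ‖y‖ ^ 2))) (closedBall 0 1) ∧
    ∫ y in closedBall (0 : E) 1, mainPart p s q ((m, d), (y i, ‖y‖ ^ 2)) =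
      volume.real (ball (0 : E) 1) * volPoly n s q ((m, d), x) := by
  have hc : ContinuousOn (fun y : E => mainPart p s q ((m, d), (y i, ‖y‖ ^ 2))) (closedBall 0 1) := by
    have hg : ContinuousOn (fun y : E => g p ((m, d), (y i, ‖y‖ ^ 2))) (closedBall 0 1) := by
      simp only [g, v, u, ρ, δ]
      refine ContinuousOn.sub (ContinuousOn.rpow_const (by fun_prop) fun y hy => Or.inl ?_)
        continuousOn_const
      have h1 : |y i| ≤ 1 := (PiLp.norm_apply_le y i).trans (by simpa using hy)
      have h2 := (abs_le.1 h1).1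
      have h3 : 0 ≤ d * (d * ‖y‖ ^ 2) := by positivity
      apply ne_of_gt
      nlinarith
    simp only [mainPart, f₁, f₂, f₃, τ, μ, δ, u, ρ]
    fun_prop
  refine ⟨hc, ?_⟩
  have h3 : (3 : ℝ) ≤ n := by exact_mod_cast hn
  have hsph : ∀ t ∈ Set.Ioo (0 : ℝ) 1, ∫ θ : sphere (0 : E) 1, mainPart p s q
      ((m, d), ((t • (θ : E)) i, ‖t • (θ : E)‖ ^ 2)) ∂σ =
      ∫ θ : sphere (0 : E) 1, mainPart p s q ((m, d), (t * (θ : E) i, t ^ 2)) ∂σ := by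
    intro t ht
    congr 1 with θ
    have : ‖t • (θ : E)‖ = t := by simp [norm_smul, abs_of_pos ht.1]
    rw [this]
    simp
  have hsph' := fun t ht => (hsph t ht).trans
    (integral_sphere_mainPart (m := m) (d := d) (t := t) hn i hp s q (by
      rw [abs_of_pos (mul_pos ht.1 hd0)]
      nlinarith [ht.1, ht.2])).2
  rw [integral_closedBall_eq_of_sphere (by omega) hc hsph']
  rw [toSphere_real_apply_univ, finrank_euclideanSpace, Fintype.card_fin]
  set a₂ := (m * d ^ 2 * (-s * (m * d ^ 2)) * (q * (n - 2) * (n - 1) / n) +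
          q * (q - 1) / 2 * (m ^ 2 * d ^ 2 * ((n - 2) ^ 2 / n))) with ha₂
  set a₄ := q * (q - 1) / 2 * (m ^ 2 * d ^ 4 * ((n - 2) ^ 2 * (n - 1) / (2 * (n + 2)))) with ha₄
  set B := volume.real (ball (0 : E) 1)
  have hsplit : ∀ t : ℝ, t ^ (n - 1) * ((n : ℝ) * B * (1 + a₂ * t ^ 2 + a₄ * t ^ 4)) =
      n * B * t ^ (n - 1) + n * B * a₂ * t ^ (n - 1 + 2) + n * B * a₄ * t ^ (n - 1 + 4) := by
    intro t; ring
  simp only [hsplit]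
  rw [intervalIntegral.integral_add (Continuous.intervalIntegrable (by fun_prop) _ _)
      (Continuous.intervalIntegrable (by fun_prop) _ _),
    intervalIntegral.integral_add (Continuous.intervalIntegrable (by fun_prop) _ _)
      (Continuous.intervalIntegrable (by fun_prop) _ _),
    intervalIntegral.integral_const_mul, intervalIntegral.integral_const_mul,
    intervalIntegral.integral_const_mul, integral_pow, integral_pow, integral_pow]
  have hcast : ((n - 1 : ℕ) : ℝ) = n - 1 := by rw [Nat.cast_sub (by omega)]; simp
  simp only [one_pow, ne_eq, Nat.add_eq_zero_iff, one_ne_zero, and_false, not_false_eq_true, zero_pow]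
  push_cast
  rw [hcast]
  have h1 : (n : ℝ) ≠ 0 := by linarith
  have h2 : (n : ℝ) + 2 ≠ 0 := by linarith
  have h4 : (n : ℝ) + 4 ≠ 0 := by linarith
  have h5 : (n : ℝ) - 1 + 1 = n := by ring
  have h6 : (n : ℝ) - 1 + 2 + 1 = n + 2 := by ring
  have h7 : (n : ℝ) - 1 + 4 + 1 = n + 4 := by ring
  rw [h5, h6, h7]
  simp only [volPoly, τ, μ, δ, ha₂, ha₄]
  field_simp
  ring

end Averages
end ShapeExpansion

/-! ### Far out ellipsoids beat the Euclidean isoperimetric ratio -/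

section Stretch
open Module Metric Measure
open scoped RealInnerProductSpace

variable {n : ℕ}

local notation "E" => EuclideanSpace ℝ (Fin n)

/-- The stretching by the factor `1 + τ` in the `i`-th coordinate direction. -/
def axisStretch (i : Fin n) (τ : ℝ) (h : 1 + τ ≠ 0) : E ≃L[ℝ] E :=
  ContinuousLinearEquiv.equivOfInverse
    (ContinuousLinearMap.id ℝ E + (τ • EuclideanSpace.proj i : E →L[ℝ] ℝ).smulRight
      (EuclideanSpace.single i 1))
    (ContinuousLinearMap.id ℝ E - ((τ / (1 + τ)) • EuclideanSpace.proj i : E →L[ℝ] ℝ).smulRight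
      (EuclideanSpace.single i 1))
    (fun y => by
      ext j
      by_cases hj : j = i
      · subst hj; simp; field_simp; ring
      · simp [hj])
    (fun y => by
      ext j
      by_cases hj : j = i
      · subst hj; simp; field_simp; ring
      · simp [hj])

variable {i : Fin n} {τ : ℝ} (h : 1 + τ ≠ 0)

lemma axisStretch_apply (y : E) :
    axisStretch i τ h y = y + (τ * y i) • EuclideanSpace.single i (1 : ℝ) := by
  simp [axisStretch]

lemma axisStretch_symm_apply (y : E) :
    (axisStretch i τ h).symm y = y - (τ / (1 + τ) * y i) • EuclideanSpace.single i (1 : ℝ) := by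
  simp [axisStretch]

lemma det_axisStretch : (axisStretch i τ h : E →L[ℝ] E).det = 1 + τ := by
  have : ((axisStretch i τ h : E →L[ℝ] E) : E →ₗ[ℝ] E) = LinearMap.transvection
      ((τ • EuclideanSpace.proj i : E →L[ℝ] ℝ) : E →ₗ[ℝ] ℝ) (EuclideanSpace.single i (1 : ℝ)) := by
    ext1 y
    simp [axisStretch_apply, LinearMap.transvection]
  rw [ContinuousLinearMap.det, this, LinearMap.transvection.det]
  simp

lemma adjoint_axisStretch_symm :
    ContinuousLinearMap.adjoint ((axisStretch i τ h).symm : E →L[ℝ] E) =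
      ((axisStretch i τ h).symm : E →L[ℝ] E) := by
  symm
  rw [ContinuousLinearMap.eq_adjoint_iff]
  intro x y
  simp only [ContinuousLinearEquiv.coe_coe, axisStretch_symm_apply, inner_sub_left, inner_sub_right,
    inner_smul_left, inner_smul_right, EuclideanSpace.inner_single_left,
    EuclideanSpace.inner_single_right]
  simp
  ring

/-- `|det T| ‖T⁻ᵀ θ‖` is the Jacobian at `θ` of the restriction of `T` to the unit sphere. -/
lemma abs_det_mul_norm_adjoint_axisStretch (hτ : 0 < 1 + τ) (θ : sphere (0 : E) 1) :
    |(axisStretch i τ h : E →L[ℝ] E).det| *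
      ‖ContinuousLinearMap.adjoint ((axisStretch i τ h).symm : E →L[ℝ] E) θ‖ =
      √(1 + τ * (2 + τ) * (1 - (θ : E) i ^ 2)) := by
  rw [det_axisStretch, adjoint_axisStretch_symm, abs_of_pos hτ, ← Real.sqrt_sq hτ.le,
    ← Real.sqrt_sq (norm_nonneg _), ← Real.sqrt_mul (sq_nonneg _)]
  congr 1
  rw [ContinuousLinearEquiv.coe_coe, axisStretch_symm_apply, norm_sub_sq_real, norm_smul,
    inner_smul_right, EuclideanSpace.inner_single_right]
  simp only [norm_eq_of_mem_sphere, PiLp.norm_single, Real.norm_eq_abs, mul_pow, sq_abs]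
  simp
  field_simp
  ring

lemma norm_single_add_sq (d : ℝ) (y : E) :
    ‖EuclideanSpace.single i (1 : ℝ) + d • (y + (τ * y i) • EuclideanSpace.single i (1 : ℝ))‖ ^ 2 =
      1 + (d * (2 * y i + d * ‖y‖ ^ 2) + d * τ * (2 * y i + d * (2 + τ) * y i ^ 2)) := by
  rw [← real_inner_self_eq_norm_sq, ← real_inner_self_eq_norm_sq]
  simp only [inner_add_left, inner_add_right, inner_smul_left, inner_smul_right,
    EuclideanSpace.inner_single_left, EuclideanSpace.inner_single_right]
  simp
  ring

end Stretch

namespace DoubledSchwarzschild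
open Module Metric Measure ShapeExpansion

variable {n : ℕ}

local notation "E" => EuclideanSpace ℝ (Fin n)

local notation "σ" => Measure.toSphere (volume : Measure E)

/-- The mass `m / (1 + m)`, `m = R^(2-n)`, of the metric seen from distance `R`. -/
def relativeMass (n : ℕ) (R : ℝ) : ℝ := R ^ (2 - (n : ℝ)) / (1 + R ^ (2 - (n : ℝ)))

lemma harmonicFactor_eq (i : Fin n) {R : ℝ} (hR : 0 < R) (d s : ℝ) {t : ℝ}
    (ht : t = -s * (relativeMass n R * d ^ 2)) (y : E) :
    harmonicFactor (R • EuclideanSpace.single i (1 : ℝ) +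
      (R * d) • (y + (t * y i) • EuclideanSpace.single i (1 : ℝ))) =
      (1 + R ^ (2 - (n : ℝ))) * (1 + perturbation ((2 - n) / 2) s
        ((relativeMass n R, d), (y i, ‖y‖ ^ 2))) := by
  have hm : 0 < R ^ (2 - (n : ℝ)) := by positivity
  have e1 : R • EuclideanSpace.single i (1 : ℝ) +
      (R * d) • (y + (t * y i) • EuclideanSpace.single i (1 : ℝ)) =
      R • (EuclideanSpace.single i (1 : ℝ) +
        d • (y + (t * y i) • EuclideanSpace.single i (1 : ℝ))) := by
    rw [mul_smul, ← smul_add]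
  have e2 : 1 + (v ((relativeMass n R, d), (y i, ‖y‖ ^ 2)) + w s ((relativeMass n R, d), (y i, ‖y‖ ^ 2))) =
      ‖EuclideanSpace.single i (1 : ℝ) +
        d • (y + (t * y i) • EuclideanSpace.single i (1 : ℝ))‖ ^ 2 := by
    rw [norm_single_add_sq]
    simp only [v, w, τ, ShapeExpansion.μ, δ, u, ρ, ht]
  have e3 : perturbation ((2 - n) / 2) s ((relativeMass n R, d), (y i, ‖y‖ ^ 2)) =
      relativeMass n R * (‖EuclideanSpace.single i (1 : ℝ) +
        d • (y + (t * y i) • EuclideanSpace.single i (1 : ℝ))‖ ^ (2 - (n : ℝ)) - 1) := by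
    have hpow : ∀ z : ℝ, 0 ≤ z → (z ^ 2) ^ ((2 - (n : ℝ)) / 2) = z ^ (2 - (n : ℝ)) := by
      intro z hz
      rw [← Real.rpow_natCast, ← Real.rpow_mul hz]
      congr 1
      push_cast
      ring
    rw [perturbation, g, k, e2, hpow _ (norm_nonneg _)]
    simp only [ShapeExpansion.μ]
    ring
  rw [e1, e3, harmonicFactor, norm_smul, Real.norm_of_nonneg hR.le,
    Real.mul_rpow hR.le (norm_nonneg _), relativeMass]
  field_simp
  ring

/-- Far out, suitably flattened ellipsoids have an isoperimetric ratio below that of the Euclidean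
ball. -/
lemma exists_area_frontier_ellipsoid_lt (hn : 3 ≤ n) (i : Fin n) :
    ∃ η > 0, ∀ R r t : ℝ, 0 < R → 0 < r → R ^ (2 - (n : ℝ)) < η → r / R < η →
      t = -optimalStretch n * (relativeMass n R * (r / R) ^ 2) →
      -(1 / 2) < t ∧ ∀ h : 1 + t ≠ 0,
      (∀ y ∈ closedBall (0 : E) 1, R • EuclideanSpace.single i (1 : ℝ) +
        r • axisStretch i t h y ≠ 0) →
      area (frontier (ellipsoid (R • EuclideanSpace.single i (1 : ℝ)) r (axisStretch i t h))) <
        ENNReal.ofReal (n * volume.real (ball (0 : E) 1) ^ (1 / (n : ℝ)) *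
          (r ^ n * |(axisStretch i t h : E →L[ℝ] E).det| * ∫ y in closedBall (0 : E) 1,
            harmonicFactor (R • EuclideanSpace.single i (1 : ℝ) + r • axisStretch i t h y) ^
              (2 * (n : ℝ) / ((n : ℝ) - 2))) ^ (((n : ℝ) - 1) / n)) := by
  have h3 : (3 : ℝ) ≤ n := by exact_mod_cast hn
  set s := optimalStretch n with hs
  set p : ℝ := (2 - n) / 2 with hp
  have hp2 : 2 * p = 2 - n := by rw [hp]; ring
  set a : ℝ := 2 * ((n : ℝ) - 1) / ((n : ℝ) - 2) with ha
  set b : ℝ := 2 * (n : ℝ) / ((n : ℝ) - 2) with hb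
  obtain ⟨C₁, hC₁, η₁, hη₁, H₁⟩ := exists_uniform_bound (area_expansion p s a)
  obtain ⟨C₂, hC₂, η₂, hη₂, H₂⟩ := exists_uniform_bound (rpow_expansion p s b)
  set C := max C₁ C₂ with hC
  obtain ⟨η₃, hη₃, H₃⟩ := exists_isoperimetric_gain h3 C
  obtain ⟨η₄, hη₄, H₄⟩ := exists_volPoly_pos n s b C
  refine ⟨min (min η₁ η₂) (min (min η₃ η₄) (1 / 2)), by positivity, ?_⟩
  intro R r t hR hr hRη hrη ht
  simp only [lt_min_iff] at hRη hrη
  obtain ⟨⟨hR1, hR2⟩, ⟨⟨hR3, hR4⟩, hR5⟩⟩ := hRη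
  obtain ⟨⟨hr1, hr2⟩, ⟨⟨hr3, hr4⟩, hr5⟩⟩ := hrη
  set d := r / R with hd
  set m := relativeMass n R with hm
  have hM : 0 < R ^ (2 - (n : ℝ)) := by positivity
  have hd0 : 0 < d := by positivity
  have hm0 : 0 < m := by rw [hm, relativeMass]; positivity
  have hmM : m ≤ R ^ (2 - (n : ℝ)) := by
    rw [hm, relativeMass]; exact div_le_self hM.le (by linarith)
  have hrd : r = R * d := by rw [hd]; field_simp
  set x₀ : ℝ × ℝ := (0, 0)
  have hx1 : (0 : ℝ) ∈ Set.Icc (-1 : ℝ) 1 := by norm_num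
  have hx2 : (0 : ℝ) ∈ Set.Icc (0 : ℝ) 1 := by norm_num
  obtain ⟨hvpos, hτ⟩ := H₄ m ⟨hm0, by linarith⟩ d ⟨hd0, hr4⟩ 0 hx1 0 hx2
  have hgain := H₃ m ⟨hm0, by linarith⟩ d ⟨hd0, hr3⟩ 0 hx1 0 hx2
  have hτt : τ s ((m, d), ((0 : ℝ), (0 : ℝ))) = t := by rw [ht]; rfl
  rw [← hs, ← ha, ← hb] at hgain
  rw [hτt] at hτ hgain
  refine ⟨hτ, fun h h0 => ?_⟩
  have h1t : 0 < 1 + t := by linarith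
  set T := axisStretch i t h with hT
  set M := 1 + R ^ (2 - (n : ℝ)) with hMdef
  have hM1 : 0 < M := by positivity
  have hφ : ∀ y : E, harmonicFactor (R • EuclideanSpace.single i (1 : ℝ) + r • T y) =
      M * (1 + perturbation p s ((m, d), (y i, ‖y‖ ^ 2))) := by
    intro y
    rw [hT, axisStretch_apply, hrd]
    exact harmonicFactor_eq i hR d s ht y
  have hpos : ∀ y : E, 0 < 1 + perturbation p s ((m, d), (y i, ‖y‖ ^ 2)) := by
    intro y
    have := harmonicFactor_pos (R • EuclideanSpace.single i (1 : ℝ) + r • T y)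
    rw [hφ] at this
    exact pos_of_mul_pos_right this hM1.le
  have hφr : ∀ (q : ℝ) (y : E), harmonicFactor (R • EuclideanSpace.single i (1 : ℝ) + r • T y) ^ q =
      M ^ q * (1 + perturbation p s ((m, d), (y i, ‖y‖ ^ 2))) ^ q := by
    intro q y
    rw [hφ, Real.mul_rpow hM1.le (hpos y).le]
  have hcont : ∀ q : ℝ, ContinuousOn (fun y : E =>
      (1 + perturbation p s ((m, d), (y i, ‖y‖ ^ 2))) ^ q) (closedBall 0 1) := by
    intro q
    have := (continuousOn_harmonicFactor_affine h0 q).const_mul ((M ^ q)⁻¹)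
    refine this.congr fun y _ => ?_
    simp only [hφr]
    rw [inv_mul_cancel_left₀ (by positivity)]
  have hi : ∀ y ∈ closedBall (0 : E) 1, y i ∈ Set.Icc (-1 : ℝ) 1 ∧ ‖y‖ ^ 2 ∈ Set.Icc (0 : ℝ) 1 := by
    intro y hy
    have hy1 : ‖y‖ ≤ 1 := by simpa using hy
    exact ⟨abs_le.1 ((PiLp.norm_apply_le y i).trans hy1), by positivity,
      pow_le_one₀ (norm_nonneg _) hy1⟩
  set A := Measure.real σ Set.univ with hA
  set B := volume.real (ball (0 : E) 1) with hB
  have : Nonempty (Fin n) := ⟨i⟩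
  have hB0 : 0 < B := ENNReal.toReal_pos (measure_ball_pos _ _ one_pos).ne' measure_ball_lt_top.ne
  have hAB : A = n * B := by
    rw [hA, toSphere_real_apply_univ, finrank_euclideanSpace, Fintype.card_fin]
  set G := C * ((m + d) * (m ^ 2 * d ^ 4)) with hG
  have hGp : 0 ≤ (m + d) * (m ^ 2 * d ^ 4) := by positivity
  -- the average over the ball is at least its main part minus the error
  set Ib := ∫ y in closedBall (0 : E) 1, (1 + perturbation p s ((m, d), (y i, ‖y‖ ^ 2))) ^ b with hIb
  have hvol : B * (volPoly n s b ((m, d), x₀) - G) ≤ Ib := by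
    obtain ⟨hc, hI⟩ := integral_ball_mainPart hn i hp2 s b (m := m) hd0 hr5 x₀
    have hcl : volume.real (closedBall (0 : E) 1) = B := by
      rw [hB, Measure.real, Measure.real, addHaar_closedBall_eq_addHaar_ball]
    have hK := isCompact_closedBall (0 : E) 1
    have : ∫ y in closedBall (0 : E) 1, (mainPart p s b ((m, d), (y i, ‖y‖ ^ 2)) - G) =
        B * (volPoly n s b ((m, d), x₀) - G) := by
      rw [integral_sub (hc.integrableOn_compact hK) (integrableOn_const hK.measure_lt_top.ne), hI,
        setIntegral_const, hcl, smul_eq_mul]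
      ring
    rw [← this]
    refine setIntegral_mono_on ((hc.sub continuousOn_const).integrableOn_compact hK)
      ((hcont b).integrableOn_compact hK) measurableSet_closedBall fun y hy => ?_
    have hb1 := H₂ m ⟨hm0, by linarith⟩ d ⟨hd0, hr2⟩ (y i) (hi y hy).1 (‖y‖ ^ 2) (hi y hy).2
    have hb2 : C₂ * ((m + d) * (m ^ 2 * d ^ 4)) ≤ G :=
      mul_le_mul_of_nonneg_right (le_max_right _ _) hGp
    have := (abs_le.1 hb1).1
    linarith
  -- the average over the sphere is at most its main part plus the error
  set Ia := ∫ θ : sphere (0 : E) 1, (1 + perturbation p s ((m, d), ((θ : E) i, 1))) ^ a *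
    weight s ((m, d), ((θ : E) i, 1)) ∂σ with hIa
  have harea : Ia ≤ A * (areaPoly n s a ((m, d), x₀) + G) := by
    obtain ⟨hc, hI⟩ := integral_sphere_areaMain hn i hp2 s a (m := m)
      (by rw [abs_of_pos hd0]; linarith : |d| < 1) x₀
    have : ∫ θ : sphere (0 : E) 1, (areaMain p s a ((m, d), ((θ : E) i, 1)) + G) ∂σ =
        A * (areaPoly n s a ((m, d), x₀) + G) := by
      rw [integral_add (integrable_sphere hc) (integrable_sphere continuous_const), hI,
        integral_const, smul_eq_mul]
      ring
    rw [← this]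
    refine integral_mono_of_nonneg (Filter.Eventually.of_forall fun θ => ?_)
      (integrable_sphere (hc.add continuous_const)) (Filter.Eventually.of_forall fun θ => ?_)
    · have := hpos (θ : E)
      simp only [norm_eq_of_mem_sphere, one_pow] at this
      exact mul_nonneg (Real.rpow_nonneg this.le _) (Real.sqrt_nonneg _)
    · have hb1 := H₁ m ⟨hm0, by linarith⟩ d ⟨hd0, hr1⟩ ((θ : E) i) (coord_mem_Icc θ i) 1 (by norm_num)
      have hb2 : C₁ * ((m + d) * (m ^ 2 * d ^ 4)) ≤ G :=
        mul_le_mul_of_nonneg_right (le_max_left _ _) hGp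
      have := (abs_le.1 hb1).2
      simp only
      linarith
  have hIbpos : 0 < Ib := lt_of_lt_of_le (mul_pos hB0 hvpos) hvol
  -- the inequality `A < W ^ ((n - 1) / n)` between the averages; `r` and `M` enter only below
  have hkey : Ia < n * B * ((1 + t) * (Ib / B)) ^ (((n : ℝ) - 1) / n) := by
    have hn0 : (0 : ℝ) < n := by linarith
    refine harea.trans_lt ?_
    rw [hAB]
    refine mul_lt_mul_of_pos_left (hgain.trans_le ?_) (by positivity)
    refine Real.rpow_le_rpow (mul_nonneg h1t.le hvpos.le) ?_ (div_nonneg (by linarith) (by linarith))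
    refine mul_le_mul_of_nonneg_left ?_ h1t.le
    rw [le_div_iff₀ hB0, mul_comm]
    exact hvol
  refine (area_frontier_ellipsoid_le (by omega) hr h0).trans_lt ?_
  have hareaEq : r ^ (n - 1) * ∫ θ : sphere (0 : E) 1,
      harmonicFactor (R • EuclideanSpace.single i (1 : ℝ) + r • T θ) ^ a *
        (|(T : E →L[ℝ] E).det| * ‖ContinuousLinearMap.adjoint (T.symm : E →L[ℝ] E) θ‖) ∂σ =
      r ^ (n - 1) * (M ^ a * Ia) := by
    congr 1
    rw [hIa, ← integral_const_mul]
    refine integral_congr_ae (Filter.Eventually.of_forall fun θ => ?_)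
    simp only
    rw [hφr, hT, abs_det_mul_norm_adjoint_axisStretch h h1t]
    simp only [norm_eq_of_mem_sphere, one_pow, weight]
    have : τ s ((m, d), ((θ : E) i, 1)) = t := by rw [ht]; rfl
    rw [this, mul_assoc]
    rfl
  have hvolEq : ∫ y in closedBall (0 : E) 1,
      harmonicFactor (R • EuclideanSpace.single i (1 : ℝ) + r • T y) ^ b = M ^ b * Ib := by
    rw [hIb, ← integral_const_mul]
    exact integral_congr_ae (Filter.Eventually.of_forall fun y => hφr b y)
  rw [hareaEq, hvolEq, hT, det_axisStretch, abs_of_pos h1t]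
  have hn0 : (0 : ℝ) < n := by linarith
  have e1 : (r ^ n * (1 + t) * (M ^ b * Ib)) ^ (((n : ℝ) - 1) / n) =
      r ^ (n - 1) * M ^ a * B ^ (((n : ℝ) - 1) / n) * ((1 + t) * (Ib / B)) ^ (((n : ℝ) - 1) / n) := by
    have : r ^ n * (1 + t) * (M ^ b * Ib) = r ^ n * M ^ b * B * ((1 + t) * (Ib / B)) := by
      field_simp
    rw [this, Real.mul_rpow (by positivity) (by positivity),
      Real.mul_rpow (by positivity) (by positivity), Real.mul_rpow (by positivity) (by positivity),
      ← Real.rpow_natCast, ← Real.rpow_mul hr.le, ← Real.rpow_mul hM1.le, ← Real.rpow_natCast]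
    have hn2 : (n : ℝ) - 2 ≠ 0 := by linarith
    congr 4
    · rw [Nat.cast_sub (by omega)]
      push_cast
      field_simp
    · rw [ha, hb]
      field_simp
  have e2 : B ^ (1 / (n : ℝ)) * B ^ (((n : ℝ) - 1) / n) = B := by
    rw [← Real.rpow_add hB0]
    rw [show 1 / (n : ℝ) + ((n : ℝ) - 1) / n = 1 by field_simp; ring, Real.rpow_one]
  rw [ENNReal.ofReal_lt_ofReal_iff (by positivity), e1]
  calc r ^ (n - 1) * (M ^ a * Ia) < r ^ (n - 1) * (M ^ a *
        (n * B * ((1 + t) * (Ib / B)) ^ (((n : ℝ) - 1) / n))) := by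
        gcongr
    _ = _ := by
        linear_combination
          (-(r ^ (n - 1) * M ^ a * n * ((1 + t) * (Ib / B)) ^ (((n : ℝ) - 1) / n))) * e2

end DoubledSchwarzschild

/-! ### Prescribing the volume -/

namespace DoubledSchwarzschild
open Module Metric Measure ShapeExpansion

variable {n : ℕ}

local notation "E" => EuclideanSpace ℝ (Fin n)

lemma harmonicFactor_le_two (hn : 2 ≤ n) {x : E} (hx : 1 ≤ ‖x‖) : harmonicFactor x ≤ 2 := by
  have hn' : (2 : ℝ) ≤ n := by exact_mod_cast hn
  have := Real.rpow_le_one_of_one_le_of_nonpos hx (by linarith : 2 - (n : ℝ) ≤ 0)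
  rw [harmonicFactor]
  linarith

lemma norm_center_add_stretch_ge (i : Fin n) {R r t : ℝ} (hR : 0 ≤ R) (hr : 0 ≤ r) (ht : |t| ≤ 1)
    {y : E} (hy : y ∈ closedBall (0 : E) 1) :
    R - 2 * r ≤ ‖R • EuclideanSpace.single i (1 : ℝ) +
      r • (y + (t * y i) • EuclideanSpace.single i (1 : ℝ))‖ := by
  have hy1 : ‖y‖ ≤ 1 := by simpa using hy
  have hyi : ‖y i‖ ≤ 1 := (PiLp.norm_apply_le y i).trans hy1
  have h1 : ‖(t * y i) • EuclideanSpace.single i (1 : ℝ)‖ ≤ 1 := by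
    rw [norm_smul, norm_mul]
    simpa using mul_le_one₀ ht (norm_nonneg _) hyi
  have h2 : ‖r • (y + (t * y i) • EuclideanSpace.single i (1 : ℝ))‖ ≤ r * 2 := by
    rw [norm_smul, Real.norm_of_nonneg hr]
    refine mul_le_mul_of_nonneg_left ((norm_add_le _ _).trans ?_) hr
    linarith
  have h3 : ‖R • EuclideanSpace.single i (1 : ℝ)‖ = R := by
    rw [norm_smul, Real.norm_of_nonneg hR]; simp
  have h4 := norm_sub_le_norm_add (R • EuclideanSpace.single i (1 : ℝ))
    (r • (y + (t * y i) • EuclideanSpace.single i (1 : ℝ)))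
  linarith

/-- The volume of the ellipsoid with semi-axes `r` and `(1 - c r²) r` centered at distance `R` takes
every value between two bounds that come from `1 ≤ φ ≤ 2` and `1 / 2 ≤ 1 - c r² ≤ 1`. -/
lemma exists_radius_of_volume (hn : 3 ≤ n) (i : Fin n) {R r₁ r₂ V c : ℝ} (hr₁ : 0 ≤ r₁)
    (hr₁₂ : r₁ ≤ r₂) (hR : 1 ≤ R - 2 * r₂) (hc : 0 ≤ c) (hcr : c * r₂ ^ 2 ≤ 1 / 2)
    (hV₁ : r₁ ^ n * (2 ^ (2 * (n : ℝ) / ((n : ℝ) - 2)) * volume.real (ball (0 : E) 1)) ≤ V)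
    (hV₂ : V ≤ r₂ ^ n * (1 / 2 * volume.real (ball (0 : E) 1))) :
    ∃ r ∈ Set.Icc r₁ r₂, r ^ n * (1 + -(c * r ^ 2)) * ∫ y in closedBall (0 : E) 1,
      harmonicFactor (R • EuclideanSpace.single i (1 : ℝ) +
        r • (y + (-(c * r ^ 2) * y i) • EuclideanSpace.single i (1 : ℝ))) ^
          (2 * (n : ℝ) / ((n : ℝ) - 2)) = V := by
  have h3 : (3 : ℝ) ≤ n := by exact_mod_cast hn
  set b : ℝ := 2 * (n : ℝ) / ((n : ℝ) - 2) with hb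
  have hb0 : 0 ≤ b := div_nonneg (by linarith) (by linarith)
  have hcr' : ∀ r ∈ Set.Icc r₁ r₂, 0 ≤ c * r ^ 2 ∧ c * r ^ 2 ≤ 1 / 2 := by
    intro r hr
    have h0 : 0 ≤ r := hr₁.trans hr.1
    have : r ^ 2 ≤ r₂ ^ 2 := pow_le_pow_left₀ h0 hr.2 2
    exact ⟨by positivity, (mul_le_mul_of_nonneg_left this hc).trans hcr⟩
  set X : ℝ → E → E := fun r y => R • EuclideanSpace.single i (1 : ℝ) +
        r • (y + (-(c * r ^ 2) * y i) • EuclideanSpace.single i (1 : ℝ)) with hX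
  have hXn : ∀ r ∈ Set.Icc r₁ r₂, ∀ y ∈ closedBall (0 : E) 1, 1 ≤ ‖X r y‖ := by
    intro r hr y hy
    have h0 : 0 ≤ r := hr₁.trans hr.1
    have := norm_center_add_stretch_ge i (R := R) (t := -(c * r ^ 2)) (by linarith) h0
      (by rw [abs_neg, abs_of_nonneg (hcr' r hr).1]; linarith [(hcr' r hr).2]) hy
    linarith [hr.2]
  have hX0 : ∀ r ∈ Set.Icc r₁ r₂, ∀ y ∈ closedBall (0 : E) 1, X r y ≠ 0 := fun r hr y hy h => by
    have := hXn r hr y hy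
    rw [h, norm_zero] at this
    linarith
  have hlow : ∀ x : E, 1 ≤ harmonicFactor x ^ b := fun x =>
    Real.one_le_rpow (one_le_harmonicFactor x) hb0
  have hup : ∀ r ∈ Set.Icc r₁ r₂, ∀ y ∈ closedBall (0 : E) 1, harmonicFactor (X r y) ^ b ≤ 2 ^ b :=
    fun r hr y hy => Real.rpow_le_rpow (harmonicFactor_pos _).le
      (harmonicFactor_le_two (by omega) (hXn r hr y hy)) hb0
  have hK := isCompact_closedBall (0 : E) 1
  have hKv : volume (closedBall (0 : E) 1) ≠ ⊤ := hK.measure_lt_top.ne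
  have hcy : ∀ r ∈ Set.Icc r₁ r₂, ContinuousOn (fun y => harmonicFactor (X r y) ^ b)
      (closedBall 0 1) := fun r hr y hy =>
    (((continuousAt_harmonicFactor (hX0 r hr y hy)).comp (f := X r)
      (by simp only [hX]; fun_prop)).rpow_const
        (Or.inl (harmonicFactor_pos _).ne')).continuousWithinAt
  have hcr : ∀ y ∈ closedBall (0 : E) 1, ContinuousOn (fun r => harmonicFactor (X r y) ^ b)
      (Set.Icc r₁ r₂) := fun y hy r hr =>
    (((continuousAt_harmonicFactor (hX0 r hr y hy)).comp (f := fun r => X r y)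
      (by simp only [hX]; fun_prop)).rpow_const
        (Or.inl (harmonicFactor_pos _).ne')).continuousWithinAt
  have hIc : ContinuousOn (fun r => ∫ y in closedBall (0 : E) 1, harmonicFactor (X r y) ^ b)
      (Set.Icc r₁ r₂) := by
    refine continuousOn_of_dominated (bound := fun _ => 2 ^ b)
      (fun r hr => ((hcy r hr).integrableOn_compact hK).aestronglyMeasurable) (fun r hr => ?_)
      (integrableOn_const hKv) ?_
    · filter_upwards [ae_restrict_mem measurableSet_closedBall] with y hy
      rw [Real.norm_of_nonneg (zero_le_one.trans (hlow _))]
      exact hup r hr y hy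
    · filter_upwards [ae_restrict_mem measurableSet_closedBall] with y hy using hcr y hy
  have hcl : volume.real (closedBall (0 : E) 1) = volume.real (ball (0 : E) 1) := by
    have : Nonempty (Fin n) := ⟨i⟩
    rw [Measure.real, Measure.real, addHaar_closedBall_eq_addHaar_ball]
  have hIlow : ∀ r ∈ Set.Icc r₁ r₂, volume.real (ball (0 : E) 1) ≤
      ∫ y in closedBall (0 : E) 1, harmonicFactor (X r y) ^ b := by
    intro r hr
    have := setIntegral_mono_on (integrableOn_const hKv (C := (1 : ℝ)))
      ((hcy r hr).integrableOn_compact hK) measurableSet_closedBall fun y _ => hlow (X r y)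
    simpa [hcl] using this
  have hIup : ∀ r ∈ Set.Icc r₁ r₂, ∫ y in closedBall (0 : E) 1, harmonicFactor (X r y) ^ b ≤
      2 ^ b * volume.real (ball (0 : E) 1) := by
    intro r hr
    have := setIntegral_mono_on ((hcy r hr).integrableOn_compact hK)
      (integrableOn_const hKv (C := (2 : ℝ) ^ b)) measurableSet_closedBall
      (hup r hr)
    rwa [setIntegral_const, hcl, smul_eq_mul, mul_comm (volume.real _)] at this
  set F : ℝ → ℝ := fun r => r ^ n * (1 + -(c * r ^ 2)) *
    ∫ y in closedBall (0 : E) 1, harmonicFactor (X r y) ^ b with hF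
  have hFc : ContinuousOn F (Set.Icc r₁ r₂) := by
    simp only [hF]
    fun_prop
  have hm1 : r₁ ∈ Set.Icc r₁ r₂ := ⟨le_rfl, hr₁₂⟩
  have hm2 : r₂ ∈ Set.Icc r₁ r₂ := ⟨hr₁₂, le_rfl⟩
  have hB0 : 0 ≤ volume.real (ball (0 : E) 1) := measureReal_nonneg
  have hF1 : F r₁ ≤ V := by
    refine le_trans ?_ hV₁
    simp only [hF, mul_assoc]
    refine mul_le_mul_of_nonneg_left ?_ (by positivity)
    have h1 := hIup r₁ hm1
    have h2 := hIlow r₁ hm1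
    have h4 := (hcr' r₁ hm1).1
    nlinarith
  have hF2 : V ≤ F r₂ := by
    refine hV₂.trans ?_
    simp only [hF, mul_assoc]
    refine mul_le_mul_of_nonneg_left ?_ (pow_nonneg (hr₁.trans hr₁₂) _)
    have h2 := hIlow r₂ hm2
    have h4 := (hcr' r₂ hm2).2
    nlinarith
  exact intermediate_value_Icc hr₁₂ hFc ⟨hF1, hF2⟩

end DoubledSchwarzschild

end

open Module Metric Measure Filter Topology DoubledSchwarzschild ShapeExpansion in
theorem proposition3p3 (n : ℕ) (hn : 3 ≤ n) (V : ℝ) (hV : 0 < V)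
    (K : Set (DoubledSchwarzschild n)) (hK : IsCompact K) :
    ∃ D : Set (DoubledSchwarzschild n),
      DoubledSchwarzschild.IsSmoothRegion D ∧ Disjoint D K ∧
      DoubledSchwarzschild.vol n D = ENNReal.ofReal V ∧
      DoubledSchwarzschild.area (frontier D) <
        ENNReal.ofReal (((n : ℝ) ^ (n - 1) * unitSphereArea n) ^ (1 / (n : ℝ)) *
          V ^ (((n : ℝ) - 1) / (n : ℝ))) := by
  have h3 : (3 : ℝ) ≤ n := by exact_mod_cast hn
  set i : Fin n := ⟨0, by omega⟩
  have : Nonempty (Fin n) := ⟨i⟩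
  set B := volume.real (ball (0 : EuclideanSpace ℝ (Fin n)) 1) with hB
  have hB0 : 0 < B := ENNReal.toReal_pos (measure_ball_pos _ _ one_pos).ne' measure_ball_lt_top.ne
  set b : ℝ := 2 * (n : ℝ) / ((n : ℝ) - 2) with hb
  have hb0 : 0 ≤ b := div_nonneg (by linarith) (by linarith)
  -- far out `1 ≤ φ ≤ 2`, so that the radius of the ellipsoid of volume `V` lies in `[r₁, r₂]`
  set r₁ : ℝ := (V / (2 ^ b * B)) ^ (1 / (n : ℝ)) with hr₁
  set r₂ : ℝ := (V / (1 / 2 * B)) ^ (1 / (n : ℝ)) with hr₂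
  have hr₁0 : 0 < r₁ := by positivity
  have hr₂0 : 0 < r₂ := by positivity
  have hpow : ∀ x : ℝ, 0 ≤ x → (x ^ (1 / (n : ℝ))) ^ n = x := by
    intro x hx
    rw [← Real.rpow_natCast, ← Real.rpow_mul hx, one_div_mul_cancel (by linarith), Real.rpow_one]
  have hr₁₂ : r₁ ≤ r₂ := by
    refine Real.rpow_le_rpow (by positivity) ?_ (by positivity)
    refine div_le_div_of_nonneg_left hV.le (by positivity) ?_
    refine mul_le_mul_of_nonneg_right ?_ hB0.le
    have := Real.one_le_rpow (one_le_two (α := ℝ)) hb0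
    linarith
  obtain ⟨η, hη, H⟩ := exists_area_frontier_ellipsoid_lt hn i
  obtain ⟨L, hL⟩ : ∃ L, ∀ x ∈ K, ‖coord x‖ ≤ L := by
    obtain ⟨L, hL⟩ := (hK.image contMDiff_coord.continuous).isBounded.exists_norm_le
    exact ⟨L, fun x hx => hL _ ⟨x, hx, rfl⟩⟩
  obtain ⟨R, hRη, hrη, hR0, hR1, hRL⟩ : ∃ R : ℝ, R ^ (2 - (n : ℝ)) < η ∧ r₂ / R < η ∧ 0 < R ∧
      1 + 2 * r₂ ≤ R ∧ L + 2 * r₂ < R := by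
    have t1 : Tendsto (fun R : ℝ => R ^ (2 - (n : ℝ))) atTop (𝓝 0) := by
      have := tendsto_rpow_neg_atTop (y := (n : ℝ) - 2) (by linarith)
      simpa using this
    have t2 : Tendsto (fun R : ℝ => r₂ / R) atTop (𝓝 0) := tendsto_const_nhds.div_atTop tendsto_id
    exact ((t1.eventually_lt_const hη).and ((t2.eventually_lt_const hη).and
      ((eventually_gt_atTop 0).and ((eventually_ge_atTop _).and (eventually_gt_atTop _))))).exists
  set c : ℝ := optimalStretch n * relativeMass n R / R ^ 2 with hc
  have hc0 : 0 ≤ c := by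
    have : 0 < R ^ (2 - (n : ℝ)) := by positivity
    have h1 : 0 ≤ (n : ℝ) - 1 := by linarith
    rw [hc, optimalStretch, relativeMass]
    positivity
  have hct : ∀ r : ℝ, -(c * r ^ 2) = -optimalStretch n * (relativeMass n R * (r / R) ^ 2) := by
    intro r; rw [hc]; field_simp
  have hcr : c * r₂ ^ 2 ≤ 1 / 2 := by
    have := (H R r₂ _ hR0 hr₂0 hRη hrη (hct r₂)).1
    linarith
  obtain ⟨r, hr, hvol⟩ := exists_radius_of_volume hn i hr₁0.le hr₁₂ (by linarith : 1 ≤ R - 2 * r₂)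
    hc0 hcr (V := V)
    (by rw [hr₁, hpow _ (by positivity), div_mul_cancel₀ _ (by positivity)])
    (by rw [hr₂, hpow _ (by positivity), div_mul_cancel₀ _ (by positivity)])
  have hr0 : 0 < r := hr₁0.trans_le hr.1
  obtain ⟨ht, harea⟩ := H R r _ hR0 hr0 hRη
    ((div_le_div_of_nonneg_right hr.2 hR0.le).trans_lt hrη) (hct r)
  set t := -(c * r ^ 2) with htdef
  have ht0 : t ≤ 0 := by have : 0 ≤ c * r ^ 2 := by positivity
                         linarith
  have h1t : 0 < 1 + t := by linarith
  have hnorm : ∀ y ∈ closedBall (0 : EuclideanSpace ℝ (Fin n)) 1, R - 2 * r₂ ≤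
      ‖R • EuclideanSpace.single i (1 : ℝ) + r • axisStretch i t h1t.ne' y‖ := by
    intro y hy
    rw [axisStretch_apply]
    have := norm_center_add_stretch_ge i hR0.le hr0.le (t := t)
      (by rw [abs_of_nonpos ht0]; linarith) hy
    linarith [hr.2]
  have h0 : ∀ y ∈ closedBall (0 : EuclideanSpace ℝ (Fin n)) 1,
      R • EuclideanSpace.single i (1 : ℝ) + r • axisStretch i t h1t.ne' y ≠ 0 := fun y hy h => by
    have := hnorm y hy
    rw [h, norm_zero] at this
    linarith
  have hvol' : r ^ n * |(axisStretch i t h1t.ne' :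
      EuclideanSpace ℝ (Fin n) →L[ℝ] EuclideanSpace ℝ (Fin n)).det| *
      ∫ y in closedBall (0 : EuclideanSpace ℝ (Fin n)) 1, harmonicFactor
        (R • EuclideanSpace.single i (1 : ℝ) + r • axisStretch i t h1t.ne' y) ^ b = V := by
    rw [det_axisStretch, abs_of_pos h1t, ← hvol]
    simp only [axisStretch_apply]
    rfl
  refine ⟨ellipsoid (R • EuclideanSpace.single i (1 : ℝ)) r (axisStretch i t h1t.ne'),
    ellipsoid_isSmoothRegion (by omega) hr0.ne' h0, ?_, ?_, ?_⟩
  · rw [Set.disjoint_left]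
    rintro x ⟨y, hy, hxy⟩ hxK
    have e1 := hnorm y hy
    have e2 := hL x hxK
    simp only at hxy
    rw [hxy] at e1
    linarith
  · rw [vol_ellipsoid hr0 h0, hvol']
  · refine (harea h1t.ne' h0).trans_eq ?_
    rw [hvol']
    congr 2
    have hn0 : (0 : ℝ) < n := by linarith
    rw [unitSphereArea, toSphere_real_apply_univ, finrank_euclideanSpace, Fintype.card_fin,
      ← mul_assoc, ← pow_succ, Nat.sub_add_cancel (by omega), Real.mul_rpow (by positivity) hB0.le,
      ← Real.rpow_natCast, ← Real.rpow_mul hn0.le, mul_one_div_cancel hn0.ne', Real.rpow_one]
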